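/- Let $(M,g)$ be a connected smooth Riemannian manifold without boundary (finite-dimensional, Hausdorff). Let $\pi:E\to M$ be a smooth real vector bundle of finite rank with a smooth fiber metric and a smooth metric-compatible covariant derivative $\nabla$. For an absolutely continuous (AC) path $\sigma:[0,1]\to M$ let $\ell_M(\sigma)=\int_0^1|\dot\sigma(t)|\,dt$, let $d(m,p)$ be the infimum of $\ell_M(\sigma)$ over AC paths from $m$ to $p$, and let $/\!/_t(\sigma)$ denote parallel translation along $\sigma$ from time $0$ to time $t$. The total space $E$ carries the Riemannian metric $$\langle\dot\xi(0),\dot\eta(0)\rangle=\langle\pi_*\dot\xi(0),\pi_*\dot\eta(0)\rangle_g+\Big\langle\tfrac{\nabla\xi}{dt}(0),\tfrac{\nabla\eta}{dt}(0)\Big\rangle_E$$ for smooth curves $\xi,\eta$ in $E$ with $\xi(0)=\eta(0)$, and $d^E$ is the induced distance, i.e. the infimum of the lengths of AC paths in $E$. For $e\in E_{\sigma(0)}$, $e'\in E_{\sigma(1)}$ put $$L_\sigma(e,e')=\sqrt{\ell_M(\sigma)^2+\big|/\!/_1(\sigma)^{-1}e'-e\big|^2}.$$ For $f\in C^1(M,M)$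 let $\operatorname{Lip}(f)=\sup_{m\ne p}d(f(m),f(p))/d(m,p)\in[0,\infty]$, $|f_*|_m=\sup_{v\in T_mM,|v|=1}|f_*v|$ and $|f_*|_\sigma=\sup_{t\in[0,1]}|f_*|_{\sigma(t)}$. Let $F:E\to E$ be a bundle map covering $f$, i.e. $F$ restricts to linear maps $F_m:E_m\to E_{f(m)}$. Put $|F_m|=\sup_{e\in E_m,|e|=1}|F_me|$. For $v\in T_mM$ let $$\nabla_vF=\tfrac{d}{dt}\Big|_0\,/\!/_t(f\circ\sigma)^{-1}F_{\sigma(t)}/\!/_t(\sigma)\in\operatorname{Hom}(E_m,E_{f(m)}),$$ where $\sigma$ is any $C^1$ curve with $\dot\sigma(0)=v$, and put $|\nabla F|_m=\sup_{|v|=1=|e|}|(\nabla_vF)e|$ ($v\in T_mM$, $e\in E_m$), $|\nabla F|_\sigma=\sup_{t\in[0,1]}|\nabla F|_{\sigma(t)}$ and $|\nabla F|_M=\sup_{m\in M}|\nabla F|_m$. Suprema lie in $[0,\infty]$, a supremum over the empty set is $0$, and $0\cdot\infty=0$. (1) Let $f:M\to M$ be smooth and let $F:E\to E$ be a smooth bundle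 map covering $f$. If $\sigma$ is an AC path in $M$ from $m$ to $p$, $e\in E_m$ and $e'\in E_p$, then $$d^E(Fe,Fe')\le\big(\max(|f_*|_\sigma,|F_m|)+|\nabla F|_\sigma\,|e'|\big)\,L_\sigma(e,e').$$ Moreover, for all $m,p\in M$, $e\in E_m$ and $e'\in E_p$, $$d^E(Fe,Fe')\le\big(\max(\operatorname{Lip}(f),|F_m|)+|\nabla F|_M\,|e'|\big)\,d^E(e,e').$$ (2) Let $E=TM$ with fiber metric $g$ and the Levi-Civita covariant derivative, write $d^{TM}$ for $d^E$, and let $f\in C^2(M,M)$. If $\sigma$ is an AC path in $M$ from $m$ to $p$, $v_m\in T_mM$ and $w_p\in T_pM$, then $$d^{TM}(f_*v_m,f_*w_p)\le\big(|f_*|_\sigma+|\nabla f_*|_\sigma\,|w_p|\big)\,L_\sigma(v_m,w_p).$$ Moreover, for all $v_m,w_p\in TM$, $$d^{TM}(f_*v_m,f_*w_p)\le\big(\operatorname{Lip}(f)+|\nabla f_*|_M\,|w_p|\big)\,d^{TM}(v_m,w_p).$$ -/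

import Mathlib

open Bundle Manifold MeasureTheory Set
open scoped ENNReal ContDiff Topology

noncomputable section

namespace BundleDistance

section Curves

variable {E : Type*} [NormedAddCommGroup E] [NormedSpace ℝ E]
  {H : Type*} [TopologicalSpace H] (I : ModelWithCorners ℝ E H)
  {M : Type*} [TopologicalSpace M] [ChartedSpace H M]

/-- Absolute continuity on `[[a, b]]` of a curve in a smooth manifold: the curve is continuous,
and its expression in every smooth chart is absolutely continuous on every closed subinterval
which is mapped into the domain of that chart. -/
def IsACOn (γ : ℝ → M) (a b : ℝ) : Prop :=
  ContinuousOn γ (uIcc a b) ∧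
    ∀ x ∈ IsManifold.maximalAtlas I ∞ M, ∀ c ∈ uIcc a b, ∀ d ∈ uIcc a b,
      MapsTo γ (uIcc c d) x.source →
        AbsolutelyContinuousOnInterval (fun t => x.extend I (γ t)) c d

/-- The velocity vector of a curve; an absolutely continuous curve has one at almost every
time. -/
def velocity (γ : ℝ → M) (t : ℝ) : TangentSpace I (γ t) :=
  mfderiv 𝓘(ℝ, ℝ) I γ t (1 : ℝ)

variable [RiemannianBundle (fun x : M => TangentSpace I x)]

/-- The length of `σ` restricted to `[0, 1]`. -/
def baseLength (σ : ℝ → M) : ℝ≥0∞ :=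
  ∫⁻ t in Icc (0 : ℝ) 1, ‖velocity I σ t‖ₑ

/-- The Riemannian distance: the infimum of the lengths of the absolutely continuous paths
`[0, 1] → M` between two points. -/
def baseDist (m p : M) : ℝ≥0∞ :=
  ⨅ (σ : ℝ → M) (_ : IsACOn I σ 0 1) (_ : σ 0 = m) (_ : σ 1 = p), baseLength I σ

/-- The best Lipschitz constant of `f : M → M`, in `[0, ∞]`. -/
def lip (f : M → M) : ℝ≥0∞ :=
  ⨆ (m : M) (p : M) (_ : m ≠ p), baseDist I (f m) (f p) / baseDist I m p

end Curves

section FiberMaps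

variable {M : Type*} {V : M → Type*} [∀ x, NormedAddCommGroup (V x)]
  {W : M → Type*} [∀ x, NormedAddCommGroup (W x)]

/-- `|Φ|_m`, the supremum of `|Φ e|` over the unit vectors `e` of the fiber over `m`, for a
family of maps `Φ m : V m → V (f m)`. -/
def fiberNorm {f : M → M} (Φ : ∀ m, V m → V (f m)) (m : M) : ℝ≥0∞ :=
  ⨆ (e : V m) (_ : ‖e‖ = 1), ‖Φ m e‖ₑ

/-- The supremum of a `[0, ∞]`-valued function on `M` over the points `σ t`, `t ∈ [0, 1]`. -/
def supAlong (ρ : M → ℝ≥0∞) (σ : ℝ → M) : ℝ≥0∞ :=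
  ⨆ t ∈ Icc (0 : ℝ) 1, ρ (σ t)

end FiberMaps

section Connection

variable {E : Type*} [NormedAddCommGroup E] [NormedSpace ℝ E]
  {H : Type*} [TopologicalSpace H] {I : ModelWithCorners ℝ E H}
  {M : Type*} [TopologicalSpace M] [ChartedSpace H M]
  {F : Type*} [NormedAddCommGroup F] [NormedSpace ℝ F]
  {V : M → Type*} [TopologicalSpace (TotalSpace F V)]
  [∀ x, NormedAddCommGroup (V x)] [∀ x, InnerProductSpace ℝ (V x)]
  [FiberBundle F V] [VectorBundle ℝ F V]
  (cov : CovariantDerivative I F V)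

/-- The differential `π_*` of the projection of the bundle, at the point `e`. -/
def projDeriv (I : ModelWithCorners ℝ E H) (e : TotalSpace F V)
    (w : TangentSpace (I.prod 𝓘(ℝ, F)) e) : TangentSpace I e.proj :=
  mfderiv (I.prod 𝓘(ℝ, F)) I (TotalSpace.proj : TotalSpace F V → M) e w

/-- The connection map `T_e(TotalSpace) → V (π e)` of a covariant derivative. In the local
trivialization at `m = π e`, a tangent vector to the total space at `e = (m, α)` is a pair
`(v, β)`, and its image is `β + Γ(v) α`, where `Γ(v) α` is the covariant derivative in the
direction `v` of the local section through `e` which is constant in the trivialization. Applied to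
the velocity of a curve `ξ` in the total space, this is `∇ξ/dt`. -/
def connector (e : TotalSpace F V) (w : TangentSpace (I.prod 𝓘(ℝ, F)) e) : V e.proj :=
  (trivializationAt F V e.proj).symm e.proj
      (mfderiv (I.prod 𝓘(ℝ, F)) 𝓘(ℝ, F)
        (fun e' : TotalSpace F V => (trivializationAt F V e.proj e').2) e w : F)
    + cov (FiberBundle.extend F e.2) e.proj (projDeriv I e w)

/-- The covariant derivative `∇ξ/dt` of a curve in the total space. -/
def covAlong (ξ : ℝ → TotalSpace F V) (t : ℝ) : V (ξ t).proj :=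
  connector cov (ξ t) (velocity (I.prod 𝓘(ℝ, F)) ξ t)

/-- `η` is a parallel section along `σ` on `[[a, b]]`. -/
def IsParallelOn (σ : ℝ → M) (η : ∀ t, V (σ t)) (a b : ℝ) : Prop :=
  IsACOn (I.prod 𝓘(ℝ, F)) (fun t => (⟨σ t, η t⟩ : TotalSpace F V)) a b ∧
    ∀ᵐ t ∂volume, t ∈ uIcc a b →
      covAlong cov (fun t => (⟨σ t, η t⟩ : TotalSpace F V)) t = 0

open Classical in
/-- Parallel translation along `σ` from the fiber over `σ a` to the fiber over `σ b`; here
`a ≤ b` is not required, and translation from `σ b` to `σ a` is inverse to translation from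
`σ a` to `σ b`. The value `0` is only used if no parallel section through `e` exists, which does
not happen if `σ` is absolutely continuous. -/
def parallelTransport (σ : ℝ → M) (a b : ℝ) (e : V (σ a)) : V (σ b) :=
  if h : ∃ η : ∀ t, V (σ t), IsParallelOn cov σ η a b ∧ η a = e then h.choose b else 0

/-- `(∇_v Φ) e` for `v` the velocity at time `0` of the curve `σ`, which is `C¹` near `0`, where
`Φ` is a bundle map covering `f`: the derivative at `t = 0` of
`//_t(f ∘ σ)⁻¹ (Φ (//_t(σ) e))`. -/
def covDerivMap (f : M → M) (Φ : ∀ m, V m → V (f m)) (σ : ℝ → M) (e : V (σ 0)) :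
    V (f (σ 0)) :=
  deriv (fun t : ℝ =>
    (parallelTransport cov (fun s => f (σ s)) t 0
      (Φ (σ t) (parallelTransport cov σ 0 t e)) : V (f (σ 0)))) 0

section Metric

variable [RiemannianBundle (fun x : M => TangentSpace I x)]

/-- `|∇Φ|_m`, the supremum of `|(∇_v Φ) e|` over unit vectors `v ∈ T_m M` (given as velocities of
curves) and unit vectors `e ∈ V m`. -/
def covDerivNorm (f : M → M) (Φ : ∀ m, V m → V (f m)) (m : M) : ℝ≥0∞ :=
  ⨆ (σ : ℝ → M) (_ : ContMDiffAt 𝓘(ℝ, ℝ) I 1 σ 0) (_ : σ 0 = m) (_ : ‖velocity I σ 0‖ = 1)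
    (e : V (σ 0)) (_ : ‖e‖ = 1), ‖covDerivMap cov f Φ σ e‖ₑ

/-- The Riemannian metric on the total space: `⟨π_* w, π_* w'⟩ + ⟨K w, K w'⟩`, with `K` the
connection map. -/
def totalInner (e : TotalSpace F V) (w w' : TangentSpace (I.prod 𝓘(ℝ, F)) e) : ℝ :=
  inner ℝ (projDeriv I e w) (projDeriv I e w') +
    inner ℝ (connector cov e w) (connector cov e w')

/-- The length of a curve in the total space restricted to `[0, 1]`. -/
def totalLength (ξ : ℝ → TotalSpace F V) : ℝ≥0∞ :=
  ∫⁻ t in Icc (0 : ℝ) 1, ENNReal.ofReal √(totalInner cov (ξ t)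
    (velocity (I.prod 𝓘(ℝ, F)) ξ t) (velocity (I.prod 𝓘(ℝ, F)) ξ t))

/-- The Riemannian distance on the total space: the infimum of the lengths of the absolutely
continuous paths `[0, 1] → TotalSpace F V` between two points. -/
def totalDist (e e' : TotalSpace F V) : ℝ≥0∞ :=
  ⨅ (ξ : ℝ → TotalSpace F V) (_ : IsACOn (I.prod 𝓘(ℝ, F)) ξ 0 1) (_ : ξ 0 = e) (_ : ξ 1 = e'),
    totalLength cov ξ

/-- `L_σ(e, e') = (ℓ(σ)² + |//_1(σ)⁻¹ e' - e|²)^{1/2}`. -/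
def pathDist (σ : ℝ → M) (e : V (σ 0)) (e' : V (σ 1)) : ℝ≥0∞ :=
  (baseLength I σ ^ 2 + ‖parallelTransport cov σ 1 0 e' - e‖ₑ ^ 2) ^ (1 / 2 : ℝ)

end Metric

end Connection

end BundleDistance

end

/-!
Both halves of the theorem come from one estimate along a fixed path, and the distance `d^E` is
compared with the quantities `L_σ` from both sides.

* `pathDist_le_totalLength`: a curve `ξ` in `E` with projection `σ` has length at least
  `L_σ(ξ 0, ξ 1)`. Indeed `|ξ - η|`, for the parallel section `η` with `η 1 = ξ 1`, changes by at
  most `∫ |∇ξ/dt|`, so that Minkowski's inequality for the pair `(|σ'|, |∇ξ/dt|)` applies.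
* `totalDist_le_pathDist`: conversely `d^E(e, e') ≤ L_σ(e, e')` for every path `σ`. Interpolating
  between the parallel sections through `e` and through `e'` proportionally to the arc length gives
  a curve of this length, up to a regularization of the arc length where the path stands still.
* `pathDist_totalMap_le`: let `η` be the parallel section along `σ` which ends at `e'`. The section
  `Φ η` along `f ∘ σ` has covariant derivative of norm at most `|∇Φ| |η| |σ'|`, with `|η| = |e'|`,
  hence differs at time `0` from the parallel section ending at `Φ e'` by at most
  `|∇Φ|_σ |e'| ℓ(σ)`. An elementary inequality between square roots then gives the estimate for
  `L_{f ∘ σ}(Φ e, Φ e')`.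

The inequalities for a fixed path follow at once. For the inequalities between distances, take the
infimum over all curves in `E`, and bound the operator norm of the differential of `f` by its
Lipschitz constant (`fiberNorm_mfderiv_le_lip`). An infinite or vanishing constant is harmless
because the distance on `E` separates points and is finite (`le_mul_totalDist`).

Parallel sections along absolutely continuous curves solve a linear differential equation with
integrable coefficients in local trivializations (`exists_isParallelOn`). The pointwise definition
of `∇_v Φ` uses parallel translation along a `C¹` curve; it is related to the connection map by the
fact that along such a curve a parallel section is differentiable at every time, with vanishing
covariant derivative (`IsParallelOn.covAlong_eq_zero`, `hasDerivAt_parallelTransport`). The tangent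
bundle is the special case in which `Φ` is the differential of `f`; the vanishing of the torsion
plays no role.
-/

noncomputable section

set_option linter.unusedSectionVars false

/-! ### Absolutely continuous functions of a real variable and linear differential equations -/

/-- A property of compact intervals which holds on all small intervals and which passes to the
union of two adjacent intervals holds on all of `[a, b]`. -/
theorem interval_induction {P : ℝ → ℝ → Prop} {a b : ℝ} (hab : a ≤ b)
    (hloc : ∀ t ∈ Icc a b, ∃ u ∈ 𝓝 t, ∀ c d, a ≤ c → c ≤ d → d ≤ b → Icc c d ⊆ u → P c d)
    (htrans : ∀ c d e, a ≤ c → c ≤ d → d ≤ e → e ≤ b → P c d → P d e → P c e) : P a b := by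
  choose! u hu hP using hloc
  obtain ⟨t, t0, tmono, ⟨m, hm⟩, ht⟩ := exists_monotone_Icc_subset_open_cover_Icc hab
    (c := fun x : Icc a b => (Subtype.val ⁻¹' interior (u x) : Set (Icc a b)))
    (fun x => isOpen_interior.preimage continuous_subtype_val)
    (fun x _ => mem_iUnion.2 ⟨x, mem_interior_iff_mem_nhds.2 (hu x x.2)⟩)
  have hstep : ∀ n, P (t n) (t (n + 1)) := by
    intro n
    obtain ⟨i, hi⟩ := ht n
    refine hP i i.2 _ _ (t n).2.1 (tmono (Nat.le_succ n)) (t (n + 1)).2.2 ?_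
    intro x hx
    have hxab : x ∈ Icc a b := ⟨(t n).2.1.trans hx.1, hx.2.trans (t (n + 1)).2.2⟩
    exact interior_subset (hi (show (⟨x, hxab⟩ : Icc a b) ∈ _ from ⟨hx.1, hx.2⟩))
  have hind : ∀ n, P a (t (n + 1)) := by
    intro n
    induction n with
    | zero => simpa [t0] using hstep 0
    | succ k ih =>
      exact htrans _ _ _ le_rfl (t (k + 1)).2.1 (tmono (Nat.le_succ _)) (t _).2.2 ih (hstep (k + 1))
  have := hind m
  rwa [hm (m + 1) (Nat.le_succ m)] at this

section Metric

open AbsolutelyContinuousOnInterval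

variable {X Y : Type*} [PseudoMetricSpace X] [PseudoMetricSpace Y]

theorem AbsolutelyContinuousOnInterval.of_dist_le {f : ℝ → X} {g : ℝ → Y} {a b : ℝ}
    (hg : AbsolutelyContinuousOnInterval g a b) (C : ℝ)
    (h : ∀ s ∈ uIcc a b, ∀ t ∈ uIcc a b, dist (f s) (f t) ≤ C * dist (g s) (g t)) :
    AbsolutelyContinuousOnInterval f a b := by
  rw [absolutelyContinuousOnInterval_iff] at hg ⊢
  intro ε hε
  obtain ⟨δ, hδ, H⟩ := hg (ε / (|C| + 1)) (by positivity)
  refine ⟨δ, hδ, fun E hE hlen => ?_⟩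
  have h1 : ∑ i ∈ Finset.range E.1, dist (f (E.2 i).1) (f (E.2 i).2) ≤
      (|C| + 1) * ∑ i ∈ Finset.range E.1, dist (g (E.2 i).1) (g (E.2 i).2) := by
    rw [Finset.mul_sum]
    refine Finset.sum_le_sum fun i hi => (h _ (hE.1 i hi).1 _ (hE.1 i hi).2).trans ?_
    gcongr
    linarith [le_abs_self C]
  refine h1.trans_lt ?_
  have := H E hE hlen
  rw [lt_div_iff₀ (by positivity)] at this
  linarith

theorem AbsolutelyContinuousOnInterval.comp_lipschitzOnWith {f : ℝ → X} {G : X → Y} {a b : ℝ}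
    {K : NNReal} {s : Set X} (hf : AbsolutelyContinuousOnInterval f a b)
    (hG : LipschitzOnWith K G s) (hs : MapsTo f (uIcc a b) s) :
    AbsolutelyContinuousOnInterval (fun t => G (f t)) a b :=
  of_dist_le hf K fun _ hx _ hy => hG.dist_le_mul _ (hs hx) _ (hs hy)

theorem AbsolutelyContinuousOnInterval.prodMk {f : ℝ → X} {g : ℝ → Y} {a b : ℝ}
    (hf : AbsolutelyContinuousOnInterval f a b) (hg : AbsolutelyContinuousOnInterval g a b) :
    AbsolutelyContinuousOnInterval (fun t => (f t, g t)) a b := by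
  refine squeeze_zero (fun t => ?_) (fun t => ?_) (by simpa using Filter.Tendsto.add hf hg)
  · exact Finset.sum_nonneg fun i hi => by positivity
  · rw [← Finset.sum_add_distrib]
    refine Finset.sum_le_sum fun i _ => ?_
    rw [Prod.dist_eq]
    exact max_le (le_add_of_nonneg_right dist_nonneg) (le_add_of_nonneg_left dist_nonneg)

theorem AbsolutelyContinuousOnInterval.congr {f g : ℝ → X} {a b : ℝ}
    (hf : AbsolutelyContinuousOnInterval f a b) (h : EqOn g f (uIcc a b)) :
    AbsolutelyContinuousOnInterval g a b :=
  of_dist_le hf 1 fun s hs t ht => by rw [h hs, h ht, one_mul]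

theorem AbsolutelyContinuousOnInterval.trans {f : ℝ → X} {a b c : ℝ} (hab : a ≤ b) (hbc : b ≤ c)
    (hf : AbsolutelyContinuousOnInterval f a b) (hg : AbsolutelyContinuousOnInterval f b c) :
    AbsolutelyContinuousOnInterval f a c := by
  rw [absolutelyContinuousOnInterval_iff] at hf hg ⊢
  intro ε hε
  obtain ⟨δ, hδ, H⟩ := hf (ε / 2) (by positivity)
  obtain ⟨δ', hδ', H'⟩ := hg (ε / 2) (by positivity)
  refine ⟨min δ δ', by positivity, fun E hE hlen => ?_⟩
  -- The part of the family `E` in `[a, b]`, and the part in `[b, c]`.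
  set L : ℕ × (ℕ → ℝ × ℝ) := (E.1, fun i => (min (E.2 i).1 b, min (E.2 i).2 b)) with hL
  set R : ℕ × (ℕ → ℝ × ℝ) := (E.1, fun i => (max (E.2 i).1 b, max (E.2 i).2 b)) with hR
  have hEab : ∀ i ∈ Finset.range E.1, (E.2 i).1 ∈ Icc a c ∧ (E.2 i).2 ∈ Icc a c := by
    intro i hi
    have := hE.1 i hi
    rwa [uIcc_of_le (hab.trans hbc)] at this
  have hLm : L ∈ disjWithin a b := by
    refine ⟨fun i hi => ?_, hE.2.mono fun i => ?_⟩
    · obtain ⟨h1, h2⟩ := hEab i hi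
      rw [uIcc_of_le hab]
      exact ⟨⟨le_min h1.1 hab, min_le_right _ _⟩, ⟨le_min h2.1 hab, min_le_right _ _⟩⟩
    · intro x hx
      simp only [hL, uIoc, mem_Ioc] at hx ⊢
      grind
  have hRm : R ∈ disjWithin b c := by
    refine ⟨fun i hi => ?_, hE.2.mono fun i => ?_⟩
    · obtain ⟨h1, h2⟩ := hEab i hi
      rw [uIcc_of_le hbc]
      exact ⟨⟨le_max_right _ _, max_le h1.2 hbc⟩, ⟨le_max_right _ _, max_le h2.2 hbc⟩⟩
    · intro x hx
      simp only [hR, uIoc, mem_Ioc] at hx ⊢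
      grind
  have hLl := H L hLm (lt_of_le_of_lt (Finset.sum_le_sum fun i _ => by
    simp only [hL, Real.dist_eq]; exact (abs_min_sub_min_le_max _ _ _ _).trans (by simp))
      (hlen.trans_le (min_le_left _ _)))
  have hRl := H' R hRm (lt_of_le_of_lt (Finset.sum_le_sum fun i _ => by
    simp only [hR, Real.dist_eq]; exact (abs_max_sub_max_le_max _ _ _ _).trans (by simp))
      (hlen.trans_le (min_le_right _ _)))
  refine lt_of_le_of_lt (b := ∑ i ∈ Finset.range L.1, dist (f (L.2 i).1) (f (L.2 i).2) +
    ∑ i ∈ Finset.range R.1, dist (f (R.2 i).1) (f (R.2 i).2)) ?_ (by linarith)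
  simp only [hL, hR]
  rw [← Finset.sum_add_distrib]
  refine Finset.sum_le_sum fun i _ => ?_
  rcases le_total (E.2 i).1 b with h1 | h1 <;> rcases le_total (E.2 i).2 b with h2 | h2
  · simp [h1, h2]
  · simpa [h1, h2] using dist_triangle _ _ _
  · simpa [h1, h2, add_comm] using dist_triangle (f (E.2 i).1) (f b) (f (E.2 i).2)
  · simp [h1, h2]

/-- Absolute continuity on an interval is a local property. -/
theorem AbsolutelyContinuousOnInterval.of_local {f : ℝ → X} {a b : ℝ} (hab : a ≤ b)
    (h : ∀ t ∈ Icc a b, ∃ u ∈ 𝓝 t, ∀ c d, a ≤ c → c ≤ d → d ≤ b → Icc c d ⊆ u →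
      AbsolutelyContinuousOnInterval f c d) : AbsolutelyContinuousOnInterval f a b :=
  interval_induction hab h fun _ _ _ _ h1 h2 _ => trans h1 h2

end Metric

section Normed

variable {F : Type*} [NormedAddCommGroup F] [NormedSpace ℝ F]

theorem absolutelyContinuousOnInterval_intervalIntegral [CompleteSpace F] {f : ℝ → F} {a b c : ℝ}
    (h : IntervalIntegrable f volume a b) (hc : c ∈ uIcc a b) :
    AbsolutelyContinuousOnInterval (fun x => ∫ v in c..x, f v) a b := by
  refine AbsolutelyContinuousOnInterval.of_dist_le
    (h.norm.absolutelyContinuousOnInterval_intervalIntegral hc) 1 fun s hs t ht => ?_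
  have hi : ∀ x ∈ uIcc a b, ∀ y ∈ uIcc a b, IntervalIntegrable f volume x y := fun x hx y hy =>
    h.mono_set (uIcc_subset_uIcc hx hy)
  rw [dist_eq_norm, dist_eq_norm, intervalIntegral.integral_interval_sub_left (hi _ hc _ hs)
    (hi _ hc _ ht), intervalIntegral.integral_interval_sub_left (hi _ hc _ hs).norm
    (hi _ hc _ ht).norm, one_mul, Real.norm_eq_abs]
  exact intervalIntegral.norm_integral_le_abs_integral_norm

theorem AbsolutelyContinuousOnInterval.ae_differentiableAt' [FiniteDimensional ℝ F] {f : ℝ → F}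
    {a b : ℝ} (hf : AbsolutelyContinuousOnInterval f a b) :
    ∀ᵐ x : ℝ, x ∈ uIcc a b → DifferentiableAt ℝ f x :=
  hf.boundedVariationOn.ae_differentiableAt_of_mem_uIcc

theorem AbsolutelyContinuousOnInterval.intervalIntegrable_deriv' [FiniteDimensional ℝ F]
    {f : ℝ → F} {a b : ℝ} (hf : AbsolutelyContinuousOnInterval f a b) :
    IntervalIntegrable (deriv f) volume a b := by
  set B := Module.finBasis ℝ F
  set ℓ : ∀ i, F →L[ℝ] ℝ := fun i => LinearMap.toContinuousLinearMap (B.coord i)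
  have h1 : ∀ i, IntervalIntegrable (deriv fun t => ℓ i (f t)) volume a b := fun i =>
    (AbsolutelyContinuousOnInterval.comp_lipschitzOnWith hf ((ℓ i).lipschitz.lipschitzOnWith
      (s := univ)) (mapsTo_univ _ _)).intervalIntegrable_deriv
  have h2 : IntervalIntegrable (fun t => ∑ i, (deriv (fun t => ℓ i (f t)) t) • B i) volume a b := by
    have := IntervalIntegrable.sum (μ := volume) (a := a) (b := b) Finset.univ
      (f := fun i t => (deriv (fun t => ℓ i (f t)) t) • B i)
      (fun i _ => (h1 i).smul_continuousOn continuousOn_const)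
    convert! this using 1
    ext t
    simp
  refine h2.congr_ae ?_
  rw [Filter.EventuallyEq, ae_restrict_iff' measurableSet_uIoc]
  filter_upwards [hf.ae_differentiableAt'] with t ht htm
  have hd := ht (uIoc_subset_uIcc htm)
  have : ∀ i, deriv (fun t => ℓ i (f t)) t = B.coord i (deriv f t) := fun i =>
    ((ℓ i).hasFDerivAt.comp_hasDerivAt t hd.hasDerivAt).deriv
  simp only [this]
  exact B.sum_repr (deriv f t)

theorem enorm_sub_le_lintegral_deriv {f : ℝ → ℝ} {a b : ℝ} (hab : a ≤ b)
    (hf : AbsolutelyContinuousOnInterval f a b) :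
    ‖f b - f a‖ₑ ≤ ∫⁻ t in Icc a b, ‖deriv f t‖ₑ := by
  rw [← hf.integral_deriv_eq_sub, intervalIntegral.integral_of_le hab,
    ← integral_Icc_eq_integral_Ioc]
  exact enorm_integral_le_lintegral_enorm _

theorem IntegrableOn.clm_apply_of_continuousOn {E G : Type*} [NormedAddCommGroup E]
    [NormedSpace ℝ E] [NormedAddCommGroup G] [NormedSpace ℝ G] {Γ : ℝ → E →L[ℝ] G} {w : ℝ → E}
    {a b : ℝ} (hΓ : ContinuousOn Γ (Icc a b)) (hw : IntegrableOn w (Icc a b)) :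
    IntegrableOn (fun t => Γ t (w t)) (Icc a b) := by
  obtain ⟨K, hK⟩ := isCompact_Icc.exists_bound_of_continuousOn hΓ
  refine Integrable.mono' (hw.norm.const_mul K) ?_ ?_
  · exact (ContinuousLinearMap.apply ℝ G).flip.aestronglyMeasurable_comp₂
      (hΓ.aestronglyMeasurable measurableSet_Icc) hw.aestronglyMeasurable
  · exact (ae_restrict_iff' measurableSet_Icc).2
      (Filter.Eventually.of_forall fun t ht => (Γ t).le_of_opNorm_le (hK t ht) _)

/-- Linear ordinary differential equations with integrable coefficients have absolutely continuous
solutions on short intervals. -/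
theorem exists_linear_ode_solution [CompleteSpace F] {A : ℝ → F →L[ℝ] F} {a b : ℝ} (hab : a ≤ b)
    (hA : IntervalIntegrable A volume a b) (hsmall : ∫ t in a..b, ‖A t‖ ≤ 1 / 2) {t₁ : ℝ}
    (ht₁ : t₁ ∈ Icc a b) (y₁ : F) :
    ∃ y : ℝ → F, AbsolutelyContinuousOnInterval y a b ∧ y t₁ = y₁ ∧
      ∀ᵐ t : ℝ, t ∈ uIcc a b → HasDerivAt y (-(A t (y t))) t := by
  have hI : ∀ y : C(Icc a b, F),
      IntervalIntegrable (fun s => A s (y (projIcc a b hab s))) volume a b := by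
    intro y
    have hy : ContinuousOn (fun s => y (projIcc a b hab s)) (uIcc a b) :=
      (y.continuous.comp continuous_projIcc).continuousOn
    rw [intervalIntegrable_iff] at hA ⊢
    refine Integrable.mono' (hA.norm.mul_const ‖y‖) ?_ ?_
    · exact (ContinuousLinearMap.apply ℝ F).flip.aestronglyMeasurable_comp₂ hA.aestronglyMeasurable
        (y.continuous.comp continuous_projIcc).aestronglyMeasurable
    · exact Filter.Eventually.of_forall fun s =>
        (A s).le_opNorm_of_le (y.norm_coe_le_norm _)
  -- The Picard iteration, a contraction because the coefficient has small integral.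
  let S : C(Icc a b, F) → C(Icc a b, F) := fun y =>
    { toFun := fun t => y₁ - ∫ s in t₁..t, A s (y (projIcc a b hab s))
      continuous_toFun := by
        have h1 := (absolutelyContinuousOnInterval_intervalIntegral (hI y)
          (c := t₁) (by rwa [uIcc_of_le hab])).continuousOn
        rw [uIcc_of_le hab] at h1
        exact continuous_const.sub (continuousOn_iff_continuous_domRestrict.1 h1) }
  have hS : ContractingWith (1 / 2 : NNReal) S := by
    refine ⟨by norm_num, LipschitzWith.of_dist_le_mul fun y z => ?_⟩
    rw [ContinuousMap.dist_le (by positivity)]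
    intro t
    have hsub : ∀ w : C(Icc a b, F),
        IntervalIntegrable (fun s => A s (w (projIcc a b hab s))) volume t₁ t := fun w =>
      (hI w).mono_set (uIcc_subset_uIcc (by rwa [uIcc_of_le hab])
        (by rw [uIcc_of_le hab]; exact t.2))
    have : S y t - S z t = - ∫ s in t₁..t, A s ((y - z) (projIcc a b hab s)) := by
      have : (fun s => A s ((y - z) (projIcc a b hab s))) = fun s =>
          A s (y (projIcc a b hab s)) - A s (z (projIcc a b hab s)) := by
        ext s; simp
      rw [this, intervalIntegral.integral_sub (hsub y) (hsub z)]
      simp only [S, ContinuousMap.coe_mk]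
      abel
    rw [dist_eq_norm, this, norm_neg]
    have hsubset : uIoc t₁ (t : ℝ) ⊆ Ioc a b := by
      exact Ioc_subset_Ioc (le_min ht₁.1 t.2.1) (max_le ht₁.2 t.2.2)
    have hAn : IntegrableOn (fun s => ‖A s‖ * dist y z) (Ioc a b) := by
      have := (intervalIntegrable_iff.1 hA).norm.mul_const (dist y z)
      rwa [uIoc_of_le hab] at this
    calc ‖∫ s in t₁..t, A s ((y - z) (projIcc a b hab s))‖
        ≤ ∫ s in uIoc t₁ t, ‖A s ((y - z) (projIcc a b hab s))‖ :=
          intervalIntegral.norm_integral_le_integral_norm_uIoc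
      _ ≤ ∫ s in uIoc t₁ t, ‖A s‖ * dist y z := by
          refine integral_mono_of_nonneg (Filter.Eventually.of_forall fun s => norm_nonneg _)
            (hAn.mono_set hsubset) (Filter.Eventually.of_forall fun s => ?_)
          rw [dist_eq_norm]
          exact (A s).le_opNorm_of_le ((y - z).norm_coe_le_norm _)
      _ ≤ ∫ s in Ioc a b, ‖A s‖ * dist y z :=
          setIntegral_mono_set hAn (Filter.Eventually.of_forall fun s => by positivity)
            hsubset.eventuallyLE
      _ = (∫ s in a..b, ‖A s‖) * dist y z := by
          rw [intervalIntegral.integral_of_le hab, integral_mul_const]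
      _ ≤ (1 / 2 : NNReal) * dist y z := by
          gcongr
          simpa using hsmall
  obtain ⟨y, hy, -⟩ := hS.exists_fixedPoint 0 (edist_ne_top _ _)
  set I : ℝ → F := fun s => A s (y (projIcc a b hab s))
  refine ⟨fun t => y₁ - ∫ s in t₁..t, I s, ?_, by simp, ?_⟩
  · refine AbsolutelyContinuousOnInterval.of_dist_le
      (absolutelyContinuousOnInterval_intervalIntegral (hI y) (c := t₁) (by rwa [uIcc_of_le hab]))
      1 fun s _ t _ => ?_
    rw [one_mul, dist_sub_left]
  · filter_upwards [(hI y).ae_hasDerivAt_integral] with t ht htm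
    have hyt : y (projIcc a b hab t) = y₁ - ∫ s in t₁..t, I s := by
      rw [uIcc_of_le hab] at htm
      rw [projIcc_of_mem hab htm]
      exact (DFunLike.congr_fun hy ⟨t, htm⟩).symm
    have := (ht htm t₁ (by rwa [uIcc_of_le hab])).const_sub y₁
    rwa [hyt] at this

end Normed

namespace BundleDistance

/-! ### Absolutely continuous curves in manifolds -/

/-- The curve `f` is absolutely continuous on the small subintervals of `[a, b]` near `t₀`. -/
def LocallyACAt {X : Type*} [PseudoMetricSpace X] (f : ℝ → X) (a b t₀ : ℝ) : Prop :=
  ∃ u ∈ 𝓝 t₀, ∀ c d, a ≤ c → c ≤ d → d ≤ b → Icc c d ⊆ u → AbsolutelyContinuousOnInterval f c d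

section LocallyAC

variable {X Y : Type*} [PseudoMetricSpace X] [PseudoMetricSpace Y] {f : ℝ → X} {a b c t₀ : ℝ}

theorem LocallyACAt.ac (hab : a ≤ b) (h : ∀ t ∈ Icc a b, LocallyACAt f a b t) :
    AbsolutelyContinuousOnInterval f a b :=
  AbsolutelyContinuousOnInterval.of_local hab h

theorem _root_.AbsolutelyContinuousOnInterval.locallyACAt
    (h : AbsolutelyContinuousOnInterval f a b) (t : ℝ) : LocallyACAt f a b t :=
  ⟨univ, Filter.univ_mem, fun c d hc hcd hd _ => h.mono (by
    rw [uIcc_of_le hcd, uIcc_of_le (hc.trans (hcd.trans hd))]; exact Icc_subset_Icc hc hd)⟩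

theorem LocallyACAt.mono {a' b' : ℝ} (h : LocallyACAt f a b t₀) (ha : a ≤ a') (hb : b' ≤ b) :
    LocallyACAt f a' b' t₀ := by
  obtain ⟨u, hu, H⟩ := h
  exact ⟨u, hu, fun c d hc hcd hd => H c d (ha.trans hc) hcd (hd.trans hb)⟩

theorem LocallyACAt.trans (hab : a ≤ b) (hbc : b ≤ c)
    (h₁ : t₀ ≤ b → LocallyACAt f a b t₀) (h₂ : b ≤ t₀ → LocallyACAt f b c t₀) :
    LocallyACAt f a c t₀ := by
  rcases lt_trichotomy t₀ b with h | rfl | h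
  · obtain ⟨u, hu, H⟩ := h₁ h.le
    refine ⟨u ∩ Iio b, Filter.inter_mem hu (Iio_mem_nhds h), fun s t hs hst _ hsub => ?_⟩
    exact H s t hs hst (hsub (right_mem_Icc.2 hst)).2.le (hsub.trans inter_subset_left)
  · obtain ⟨u, hu, H⟩ := h₁ le_rfl
    obtain ⟨v, hv, K⟩ := h₂ le_rfl
    refine ⟨u ∩ v, Filter.inter_mem hu hv, fun s t hs hst ht hsub => ?_⟩
    rcases le_total t t₀ with h3 | h3
    · exact H s t hs hst h3 (hsub.trans inter_subset_left)
    rcases le_total t₀ s with h4 | h4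
    · exact K s t h4 hst ht (hsub.trans inter_subset_right)
    · exact (H s t₀ hs h4 le_rfl ((Icc_subset_Icc le_rfl h3).trans
        (hsub.trans inter_subset_left))).trans h4 h3
        (K t₀ t le_rfl h3 ht ((Icc_subset_Icc h4 le_rfl).trans (hsub.trans inter_subset_right)))
  · obtain ⟨u, hu, H⟩ := h₂ h.le
    refine ⟨u ∩ Ioi b, Filter.inter_mem hu (Ioi_mem_nhds h), fun s t _ hst ht hsub => ?_⟩
    exact H s t (hsub (left_mem_Icc.2 hst)).2.le hst ht (hsub.trans inter_subset_left)

theorem LocallyACAt.congr {g : ℝ → X} (h : LocallyACAt f a b t₀)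
    (hfg : ∀ᶠ t in 𝓝 t₀, t ∈ Icc a b → g t = f t) : LocallyACAt g a b t₀ := by
  obtain ⟨u, hu, H⟩ := h
  refine ⟨u ∩ {t | t ∈ Icc a b → g t = f t}, Filter.inter_mem hu hfg, fun c d hc hcd hd hsub => ?_⟩
  refine (H c d hc hcd hd (hsub.trans inter_subset_left)).congr fun t ht => ?_
  rw [uIcc_of_le hcd] at ht
  exact (hsub ht).2 ⟨hc.trans ht.1, ht.2.trans hd⟩

theorem LocallyACAt.prodMk {g : ℝ → Y} (hf : LocallyACAt f a b t₀) (hg : LocallyACAt g a b t₀) :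
    LocallyACAt (fun t => (f t, g t)) a b t₀ := by
  obtain ⟨u, hu, H⟩ := hf
  obtain ⟨v, hv, K⟩ := hg
  exact ⟨u ∩ v, Filter.inter_mem hu hv, fun c d hc hcd hd hsub =>
    (H c d hc hcd hd (hsub.trans inter_subset_left)).prodMk
      (K c d hc hcd hd (hsub.trans inter_subset_right))⟩

theorem exists_Icc_subset_of_mem_nhds {u : Set ℝ} (hu : u ∈ 𝓝 t₀) (ht₀ : t₀ ∈ Icc a b) :
    ∃ c d, a ≤ c ∧ c ≤ d ∧ d ≤ b ∧ t₀ ∈ Icc c d ∧ Icc c d ⊆ u ∧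
      ∀ᶠ t in 𝓝 t₀, t ∈ Icc a b → t ∈ Icc c d := by
  obtain ⟨ε, hε, hball⟩ := Metric.mem_nhds_iff.1 hu
  refine ⟨max a (t₀ - ε / 2), min b (t₀ + ε / 2), le_max_left _ _, ?_, min_le_left _ _, ?_, ?_, ?_⟩
  · exact (max_le ht₀.1 (by linarith)).trans (le_min ht₀.2 (by linarith))
  · exact ⟨max_le ht₀.1 (by linarith), le_min ht₀.2 (by linarith)⟩
  · intro t ht
    have h1 := (le_max_right a _).trans ht.1
    have h2 := ht.2.trans (min_le_right _ _)
    refine hball ?_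
    rw [Metric.mem_ball, Real.dist_eq, abs_lt]
    constructor <;> linarith
  · filter_upwards [Ioo_mem_nhds (show t₀ - ε / 2 < t₀ by linarith)
      (show t₀ < t₀ + ε / 2 by linarith)] with t ht htab
    exact ⟨max_le htab.1 ht.1.le, le_min htab.2 ht.2.le⟩

theorem LocallyACAt.continuousWithinAt {F : Type*} [NormedAddCommGroup F] {f : ℝ → F}
    (h : LocallyACAt f a b t₀) (ht₀ : t₀ ∈ Icc a b) :
    ContinuousWithinAt f (Icc a b) t₀ := by
  obtain ⟨u, hu, hac⟩ := h
  obtain ⟨c, d, hc, hcd, hd, ht, hsub, hev⟩ := exists_Icc_subset_of_mem_nhds hu ht₀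
  have h1 : ContinuousOn f (Icc c d) := by
    have := (hac c d hc hcd hd hsub).continuousOn
    rwa [uIcc_of_le hcd] at this
  exact (h1 t₀ ht).mono_of_mem_nhdsWithin (eventually_nhdsWithin_iff.2 hev)

end LocallyAC

section Manifold

variable {E : Type*} [NormedAddCommGroup E] [NormedSpace ℝ E]
  {H : Type*} [TopologicalSpace H] {I : ModelWithCorners ℝ E H}
  {M : Type*} [TopologicalSpace M] [ChartedSpace H M]
  {E' : Type*} [NormedAddCommGroup E'] [NormedSpace ℝ E']
  {H' : Type*} [TopologicalSpace H'] {I' : ModelWithCorners ℝ E' H'}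
  {M' : Type*} [TopologicalSpace M'] [ChartedSpace H' M']
  {γ : ℝ → M} {a b c t₀ : ℝ}

theorem IsACOn.symm (h : IsACOn I γ a b) : IsACOn I γ b a := by
  simpa only [IsACOn, uIcc_comm a b] using h

theorem IsACOn.mono (h : IsACOn I γ a b) {c d : ℝ} (hsub : uIcc c d ⊆ uIcc a b) :
    IsACOn I γ c d :=
  ⟨h.1.mono hsub, fun x hx s hs t ht => h.2 x hx s (hsub hs) t (hsub ht)⟩

theorem IsACOn.congr (h : IsACOn I γ a b) {γ' : ℝ → M} (heq : EqOn γ' γ (uIcc a b)) :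
    IsACOn I γ' a b := by
  refine ⟨h.1.congr heq, fun x hx s hs t ht hmaps => ?_⟩
  have hst : uIcc s t ⊆ uIcc a b := uIcc_subset_uIcc hs ht
  refine (h.2 x hx s hs t ht (fun r hr => heq (hst hr) ▸ hmaps hr)).congr fun r hr => ?_
  simp only [heq (hst hr)]

theorem _root_.ContinuousOn.eventually_mem_of_Icc {X : Type*} [TopologicalSpace X] {γ : ℝ → X}
    (h : ContinuousOn γ (Icc a b)) (ht : t₀ ∈ Icc a b) {s : Set X} (hs : s ∈ 𝓝 (γ t₀)) :
    ∀ᶠ t in 𝓝 t₀, t ∈ Icc a b → γ t ∈ s :=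
  eventually_nhdsWithin_iff.1 ((h t₀ ht).eventually hs)

theorem IsACOn.locallyACAt_extChartAt [IsManifold I ∞ M] (hab : a ≤ b) (h : IsACOn I γ a b)
    (ht : t₀ ∈ Icc a b) {p : M} (hp : γ t₀ ∈ (extChartAt I p).source) :
    LocallyACAt (fun t => extChartAt I p (γ t)) a b t₀ := by
  have hcont := h.1
  rw [uIcc_of_le hab] at hcont
  rw [extChartAt_source] at hp
  refine ⟨_, ContinuousOn.eventually_mem_of_Icc hcont ht ((chartAt H p).open_source.mem_nhds hp),
    fun c d hc hcd hd hsub => ?_⟩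
  refine h.2 (chartAt H p) (IsManifold.chart_mem_maximalAtlas p) c ?_ d ?_ fun t ht => ?_
  · rw [uIcc_of_le hab]; exact ⟨hc, hcd.trans hd⟩
  · rw [uIcc_of_le hab]; exact ⟨hc.trans hcd, hd⟩
  · rw [uIcc_of_le hcd] at ht
    exact hsub ht ⟨hc.trans ht.1, ht.2.trans hd⟩

theorem LocallyACAt.comp_of_extChartAt [I.Boundaryless] [IsManifold I ∞ M]
    (hcont : ContinuousOn γ (Icc a b)) (ht : t₀ ∈ Icc a b) {p : M}
    (hp : γ t₀ ∈ (extChartAt I p).source)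
    (h : LocallyACAt (fun t => extChartAt I p (γ t)) a b t₀) {G : M → E'}
    (hG : ContMDiffAt I 𝓘(ℝ, E') 1 G (γ t₀)) : LocallyACAt (fun t => G (γ t)) a b t₀ := by
  have hsymm : ContMDiffAt 𝓘(ℝ, E) I 1 (extChartAt I p).symm (extChartAt I p (γ t₀)) :=
    (contMDiffOn_extChartAt_symm p).contMDiffAt
      ((isOpen_extChartAt_target p).mem_nhds ((extChartAt I p).map_source hp))
  have hcd : ContDiffAt ℝ 1 (G ∘ (extChartAt I p).symm) (extChartAt I p (γ t₀)) := by
    rw [← contMDiffAt_iff_contDiffAt]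
    refine ContMDiffAt.comp _ ?_ hsymm
    rwa [(extChartAt I p).left_inv hp]
  obtain ⟨K, s, hs, hK⟩ := hcd.exists_lipschitzOnWith
  obtain ⟨u, hu, hac⟩ := h
  have h1 := ContinuousOn.eventually_mem_of_Icc hcont ht (Filter.inter_mem
    ((isOpen_extChartAt_source p).mem_nhds hp) ((continuousAt_extChartAt' hp).preimage_mem_nhds hs))
  refine ⟨_, Filter.inter_mem hu h1, fun c d hc hcd hd hsub => ?_⟩
  have hmem : ∀ t ∈ uIcc c d, γ t ∈ (extChartAt I p).source ∧ extChartAt I p (γ t) ∈ s := by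
    intro t ht
    rw [uIcc_of_le hcd] at ht
    exact (hsub ht).2 ⟨hc.trans ht.1, ht.2.trans hd⟩
  refine ((hac c d hc hcd hd (hsub.trans inter_subset_left)).comp_lipschitzOnWith hK
    fun t ht => (hmem t ht).2).congr fun t ht => ?_
  show G (γ t) = G ((extChartAt I p).symm (extChartAt I p (γ t)))
  rw [(extChartAt I p).left_inv (hmem t ht).1]

/-- A continuous curve is absolutely continuous if near every time its expression in one of the
preferred charts is. -/
theorem isACOn_of_locallyACAt [I.Boundaryless] [IsManifold I ∞ M] (hab : a ≤ b)
    (hcont : ContinuousOn γ (Icc a b))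
    (h : ∀ t₀ ∈ Icc a b, ∃ p : M, γ t₀ ∈ (extChartAt I p).source ∧
      LocallyACAt (fun t => extChartAt I p (γ t)) a b t₀) : IsACOn I γ a b := by
  refine ⟨by rwa [uIcc_of_le hab], ?_⟩
  have key : ∀ x ∈ IsManifold.maximalAtlas I ∞ M, ∀ c d, a ≤ c → c ≤ d → d ≤ b →
      MapsTo γ (Icc c d) x.source →
      AbsolutelyContinuousOnInterval (fun t => x.extend I (γ t)) c d := by
    intro x hx c d hc hcd hd hmaps
    refine LocallyACAt.ac hcd fun t ht => ?_
    have htab : t ∈ Icc a b := ⟨hc.trans ht.1, ht.2.trans hd⟩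
    obtain ⟨p, hp, hac⟩ := h t htab
    have hG : ContMDiffAt I 𝓘(ℝ, E) 1 (x.extend I) (γ t) :=
      (x.contMDiffAt_extend hx (hmaps ht)).of_le (by simp)
    exact (hac.comp_of_extChartAt hcont htab hp hG).mono hc hd
  intro x hx c hc d hd hmaps
  rw [uIcc_of_le hab] at hc hd
  rcases le_total c d with hcd | hcd
  · rw [uIcc_of_le hcd] at hmaps
    exact key x hx c d hc.1 hcd hd.2 hmaps
  · rw [uIcc_of_ge hcd] at hmaps
    exact (key x hx d c hd.1 hcd hc.2 hmaps).symm

theorem IsACOn.locallyACAt_comp [I.Boundaryless] [IsManifold I ∞ M] (hab : a ≤ b)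
    (h : IsACOn I γ a b) (ht : t₀ ∈ Icc a b) {G : M → E'}
    (hG : ContMDiffAt I 𝓘(ℝ, E') 1 G (γ t₀)) : LocallyACAt (fun t => G (γ t)) a b t₀ := by
  have hcont := h.1
  rw [uIcc_of_le hab] at hcont
  exact (h.locallyACAt_extChartAt hab ht (mem_extChartAt_source (γ t₀))).comp_of_extChartAt
    hcont ht (mem_extChartAt_source _) hG

/-- The image of an absolutely continuous curve under a `C¹` map is absolutely continuous. -/
theorem IsACOn.comp [I.Boundaryless] [IsManifold I ∞ M] [I'.Boundaryless] [IsManifold I' ∞ M']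
    (h : IsACOn I γ a b) {G : M → M'} (hG : ∀ t ∈ uIcc a b, ContMDiffAt I I' 1 G (γ t)) :
    IsACOn I' (fun t => G (γ t)) a b := by
  wlog hab : a ≤ b generalizing a b
  · exact (this h.symm (by rwa [uIcc_comm]) (le_of_not_ge hab)).symm
  rw [uIcc_of_le hab] at hG
  have hcont := h.1
  rw [uIcc_of_le hab] at hcont
  refine isACOn_of_locallyACAt hab (fun t ht => ?_)
    fun t ht => ⟨G (γ t), mem_extChartAt_source _, ?_⟩
  · exact (hG t ht).continuousAt.comp_continuousWithinAt (hcont t ht)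
  · refine h.locallyACAt_comp hab ht (G := fun p => extChartAt I' (G (γ t)) (G p)) ?_
    exact (contMDiffAt_extChartAt (n := 1)).comp _ (hG t ht)

theorem IsACOn.comp_real [I.Boundaryless] [IsManifold I ∞ M]
    (h : IsACOn I γ a b) {G : M → E'} (hG : ∀ t ∈ uIcc a b, ContMDiffAt I 𝓘(ℝ, E') 1 G (γ t)) :
    AbsolutelyContinuousOnInterval (fun t => G (γ t)) a b := by
  wlog hab : a ≤ b generalizing a b
  · exact (this h.symm (by rwa [uIcc_comm]) (le_of_not_ge hab)).symm
  exact LocallyACAt.ac hab fun t ht =>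
    h.locallyACAt_comp hab ht (hG t (by rwa [uIcc_of_le hab]))

theorem IsACOn.trans [I.Boundaryless] [IsManifold I ∞ M] (hab : a ≤ b) (hbc : b ≤ c)
    (h₁ : IsACOn I γ a b) (h₂ : IsACOn I γ b c) : IsACOn I γ a c := by
  have hc₁ := h₁.1
  have hc₂ := h₂.1
  rw [uIcc_of_le hab] at hc₁
  rw [uIcc_of_le hbc] at hc₂
  refine isACOn_of_locallyACAt (hab.trans hbc) ?_ fun t ht => ⟨γ t, mem_extChartAt_source _, ?_⟩
  · rw [← Icc_union_Icc_eq_Icc hab hbc]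
    exact hc₁.union_of_isClosed hc₂ isClosed_Icc isClosed_Icc
  · exact LocallyACAt.trans hab hbc
      (fun h => h₁.locallyACAt_extChartAt hab ⟨ht.1, h⟩ (mem_extChartAt_source _))
      (fun h => h₂.locallyACAt_extChartAt hbc ⟨h, ht.2⟩ (mem_extChartAt_source _))

theorem isACOn_of_contMDiffAt [I.Boundaryless] [IsManifold I ∞ M]
    (h : ∀ t ∈ uIcc a b, ContMDiffAt 𝓘(ℝ, ℝ) I 1 γ t) : IsACOn I γ a b := by
  have hid : ∀ a b : ℝ, a ≤ b → IsACOn 𝓘(ℝ, ℝ) (fun t : ℝ => t) a b := fun a b hab =>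
    isACOn_of_locallyACAt hab continuousOn_id fun t _ => ⟨t, mem_extChartAt_source _,
      (LipschitzOnWith.absolutelyContinuousOnInterval
        (LipschitzWith.id.lipschitzOnWith (s := uIcc a b))).locallyACAt t⟩
  refine IsACOn.comp (I := 𝓘(ℝ, ℝ)) (γ := fun t : ℝ => t) (G := γ) ?_ h
  rcases le_total a b with hab | hab
  exacts [hid _ _ hab, (hid _ _ hab).symm]

/-- Absolutely continuous curves have a velocity at almost every time. -/
theorem IsACOn.ae_mdifferentiableAt [FiniteDimensional ℝ E] [I.Boundaryless] [IsManifold I ∞ M]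
    (h : IsACOn I γ a b) :
    ∀ᵐ t : ℝ, t ∈ uIcc a b → MDifferentiableAt 𝓘(ℝ, ℝ) I γ t := by
  wlog hab : a ≤ b generalizing a b
  · have := this h.symm (le_of_not_ge hab)
    rwa [uIcc_comm]
  have hcont := h.1
  rw [uIcc_of_le hab] at hcont ⊢
  refine interval_induction (P := fun c d => ∀ᵐ t : ℝ, t ∈ Icc c d →
    MDifferentiableAt 𝓘(ℝ, ℝ) I γ t) hab (fun t ht => ?_) ?_
  · obtain ⟨u, hu, H⟩ := h.locallyACAt_extChartAt hab ht (mem_extChartAt_source (γ t))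
    have h1 := ContinuousOn.eventually_mem_of_Icc hcont ht
      (extChartAt_source_mem_nhds (I := I) (γ t))
    refine ⟨_, Filter.inter_mem hu h1, fun c d hc hcd hd hsub => ?_⟩
    have hcd0 : ∀ᵐ s : ℝ, s ≠ c ∧ s ≠ d := by
      rw [Filter.eventually_and]
      constructor <;> simp [ae_iff, measure_singleton]
    filter_upwards [(H c d hc hcd hd (hsub.trans inter_subset_left)).ae_differentiableAt', hcd0]
      with s hs hne hsm
    have hs' := hs (by rwa [uIcc_of_le hcd])
    have hsab : Icc a b ∈ 𝓝 s := Icc_mem_nhds (hc.trans_lt (lt_of_le_of_ne hsm.1 hne.1.symm))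
      ((lt_of_le_of_ne hsm.2 hne.2).trans_le hd)
    have hsrc : γ s ∈ (extChartAt I (γ t)).source := (hsub hsm).2 (mem_of_mem_nhds hsab)
    rw [extChartAt_source] at hsrc
    rw [mdifferentiableAt_iff_target_of_mem_source hsrc]
    exact ⟨hcont.continuousAt hsab, hs'.mdifferentiableAt⟩
  · intro c d e _ hcd hde _ h1 h2
    filter_upwards [h1, h2] with s hs1 hs2 hs
    rcases le_total s d with hsd | hsd
    exacts [hs1 ⟨hs.1, hsd⟩, hs2 ⟨hsd, hs.2⟩]

end Manifold

section TotalSpace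

variable {E : Type*} [NormedAddCommGroup E] [NormedSpace ℝ E]
  {H : Type*} [TopologicalSpace H] {I : ModelWithCorners ℝ E H} [I.Boundaryless]
  {M : Type*} [TopologicalSpace M] [ChartedSpace H M] [IsManifold I ∞ M]
  {F : Type*} [NormedAddCommGroup F] [NormedSpace ℝ F]
  {V : M → Type*} [TopologicalSpace (TotalSpace F V)]
  [∀ x, NormedAddCommGroup (V x)] [∀ x, InnerProductSpace ℝ (V x)]
  [FiberBundle F V] [VectorBundle ℝ F V] [ContMDiffVectorBundle ∞ F V I]
  {ξ : ℝ → TotalSpace F V} {a b : ℝ}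

theorem IsACOn.proj (h : IsACOn (I.prod 𝓘(ℝ, F)) ξ a b) : IsACOn I (fun t => (ξ t).proj) a b :=
  h.comp fun _ _ => (contMDiff_proj V).contMDiffAt

theorem contMDiffAt_trivializationAt_snd {p : M} {e : TotalSpace F V}
    (he : e.proj ∈ (trivializationAt F V p).baseSet) :
    ContMDiffAt (I.prod 𝓘(ℝ, F)) 𝓘(ℝ, F) ∞
      (fun e' : TotalSpace F V => (trivializationAt F V p e').2) e :=
  (((trivializationAt F V p).contMDiffAt_iff ((trivializationAt F V p).mem_source.2 he)).1
    contMDiffAt_id).2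

theorem IsACOn.locallyACAt_trivializationAt (hab : a ≤ b) (h : IsACOn (I.prod 𝓘(ℝ, F)) ξ a b)
    {t₀ : ℝ} (ht : t₀ ∈ Icc a b) {p : M} (hp : (ξ t₀).proj ∈ (trivializationAt F V p).baseSet) :
    LocallyACAt (fun t => (trivializationAt F V p (ξ t)).2) a b t₀ :=
  h.locallyACAt_comp hab ht (G := fun e' => (trivializationAt F V p e').2)
    ((contMDiffAt_trivializationAt_snd hp).of_le (by simp))

/-- A curve in a vector bundle is absolutely continuous if its projection is and if near every time
its expression in one of the preferred trivializations is. -/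
theorem isACOn_totalSpace_of_locallyACAt (hab : a ≤ b) (h : IsACOn I (fun t => (ξ t).proj) a b)
    (htriv : ∀ t₀ ∈ Icc a b, ∃ p : M, (ξ t₀).proj ∈ (chartAt H p).source ∩
      (trivializationAt F V p).baseSet ∧
        LocallyACAt (fun t => (trivializationAt F V p (ξ t)).2) a b t₀) :
    IsACOn (I.prod 𝓘(ℝ, F)) ξ a b := by
  have hcont := h.1
  rw [uIcc_of_le hab] at hcont
  have hcontξ : ContinuousOn ξ (Icc a b) := by
    intro t ht
    obtain ⟨p, ⟨-, hp⟩, hac⟩ := htriv t ht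
    have hsrc : ξ t ∈ (trivializationAt F V p).source := (trivializationAt F V p).mem_source.2 hp
    have hev : ∀ᶠ s in 𝓝[Icc a b] t, ξ s ∈ (trivializationAt F V p).source := by
      filter_upwards [(hcont t ht).eventually
        ((trivializationAt F V p).open_baseSet.mem_nhds hp)] with s hs
      exact (trivializationAt F V p).mem_source.2 hs
    have hiff := (trivializationAt F V p).toOpenPartialHomeomorph
      |>.continuousWithinAt_iff_continuousWithinAt_comp_left hsrc hev
    refine hiff.2 ?_
    refine ((hcont t ht).prodMk (hac.continuousWithinAt ht)).congr_of_eventuallyEq ?_ ?_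
    · filter_upwards [hev] with s hs
      exact ((trivializationAt F V p).mk_proj_snd hs).symm
    · exact ((trivializationAt F V p).mk_proj_snd hsrc).symm
  refine isACOn_of_locallyACAt hab hcontξ fun t ht => ?_
  obtain ⟨p, ⟨hp1, hp2⟩, hac⟩ := htriv t ht
  have hsrc : ∀ {s}, (ξ s).proj ∈ (trivializationAt F V p).baseSet →
      ξ s ∈ (trivializationAt F V p).source := fun h => (trivializationAt F V p).mem_source.2 h
  refine ⟨⟨p, 0⟩, ?_, ?_⟩
  · rw [FiberBundle.extChartAt]
    simpa [hp2, hp1] using hsrc hp2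
  · rw [FiberBundle.extChartAt]
    have := (h.locallyACAt_extChartAt hab ht (p := p) (by simpa using hp1)).prodMk hac
    refine this.congr ?_
    filter_upwards [ContinuousOn.eventually_mem_of_Icc hcont ht
        ((trivializationAt F V p).open_baseSet.mem_nhds hp2)] with s hs hsab
    simp [(trivializationAt F V p).coe_fst (hsrc (hs hsab))]

end TotalSpace

/-! ### The connection map of a covariant derivative -/

section Derivatives

variable {E : Type*} [NormedAddCommGroup E] [NormedSpace ℝ E]
  {H : Type*} [TopologicalSpace H] {I : ModelWithCorners ℝ E H}
  {M : Type*} [TopologicalSpace M] [ChartedSpace H M]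
  {E' : Type*} [NormedAddCommGroup E'] [NormedSpace ℝ E']
  {H' : Type*} [TopologicalSpace H'] {I' : ModelWithCorners ℝ E' H'}
  {M' : Type*} [TopologicalSpace M'] [ChartedSpace H' M']
  {F : Type*} [NormedAddCommGroup F] [NormedSpace ℝ F]

theorem mvfderiv_comp_vector {g : M' → F} {f : M → M'} {x : M}
    (hg : MDifferentiableAt I' 𝓘(ℝ, F) g (f x)) (hf : MDifferentiableAt I I' f x)
    (v : TangentSpace I x) :
    mvfderiv I (fun x => g (f x)) x v = mvfderiv I' g (f x) (mfderiv I I' f x v) :=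
  mfderiv_comp_apply x hg hf v

theorem mvfderiv_clm_comp {G : Type*} [NormedAddCommGroup G] [NormedSpace ℝ G] (L : F →L[ℝ] G)
    {g : M → F} {x : M} (hg : MDifferentiableAt I 𝓘(ℝ, F) g x) (v : TangentSpace I x) :
    mvfderiv I (fun x => L (g x)) x v = L (mvfderiv I g x v) := by
  have := (L.hasMFDerivAt (x := g x)).comp x hg.hasMFDerivAt
  exact DFunLike.congr_fun this.mfderiv v

theorem hasDerivAt_comp_curve {g : M → F} {γ : ℝ → M} {t : ℝ}
    (hg : MDifferentiableAt I 𝓘(ℝ, F) g (γ t)) (hγ : MDifferentiableAt 𝓘(ℝ, ℝ) I γ t) :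
    HasDerivAt (fun t => g (γ t)) (mvfderiv I g (γ t) (velocity I γ t)) t := by
  have h : DifferentiableAt ℝ (fun t => g (γ t)) t :=
    mdifferentiableAt_iff_differentiableAt.1 (hg.comp t hγ)
  have h2 := h.hasDerivAt
  rw [← fderiv_apply_one_eq_deriv, ← mfderiv_eq_fderiv] at h2
  convert h2 using 1
  exact (mfderiv_comp_apply t hg hγ 1).symm

theorem velocity_comp {f : M → M'} {γ : ℝ → M} {t : ℝ}
    (hf : MDifferentiableAt I I' f (γ t)) (hγ : MDifferentiableAt 𝓘(ℝ, ℝ) I γ t) :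
    velocity I' (fun t => f (γ t)) t = mfderiv I I' f (γ t) (velocity I γ t) :=
  mfderiv_comp_apply t hf hγ 1

end Derivatives

section Connection

variable {E : Type*} [NormedAddCommGroup E] [NormedSpace ℝ E]
  {H : Type*} [TopologicalSpace H] {I : ModelWithCorners ℝ E H} [I.Boundaryless]
  {M : Type*} [TopologicalSpace M] [ChartedSpace H M] [IsManifold I ∞ M]
  {F : Type*} [NormedAddCommGroup F] [NormedSpace ℝ F]
  {V : M → Type*} [TopologicalSpace (TotalSpace F V)]
  [∀ x, NormedAddCommGroup (V x)] [∀ x, InnerProductSpace ℝ (V x)]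
  [FiberBundle F V] [VectorBundle ℝ F V] [ContMDiffVectorBundle ∞ F V I]

variable (F V) in
/-- The local section of a vector bundle which is constant, equal to `y`, in the preferred
trivialization at `p`. -/
def constSection (p : M) (y : F) (x : M) : V x := (trivializationAt F V p).symmL ℝ x y

theorem constSection_add (p : M) (y z : F) :
    constSection F V p (y + z) = constSection F V p y + constSection F V p z := by
  ext x
  simp [constSection]

theorem constSection_smul (p : M) (c : ℝ) (y : F) :
    constSection F V p (c • y) = c • constSection F V p y := by
  ext x
  simp [constSection]

theorem constSection_eq_symm {p x : M} (hx : x ∈ (trivializationAt F V p).baseSet) (y : F) :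
    constSection F V p y x = (trivializationAt F V p).symm x y :=
  (trivializationAt F V p).symmL_apply hx y

theorem trivializationAt_constSection {p x : M} (hx : x ∈ (trivializationAt F V p).baseSet)
    (y : F) : (trivializationAt F V p ⟨x, constSection F V p y x⟩).2 = y := by
  rw [constSection_eq_symm hx, (trivializationAt F V p).apply_mk_symm hx]

theorem constSection_trivializationAt {p : M} {e : TotalSpace F V}
    (hx : e.proj ∈ (trivializationAt F V p).baseSet) :
    constSection F V p (trivializationAt F V p e).2 e.proj = e.2 := by
  rw [constSection_eq_symm hx]
  exact (trivializationAt F V p).symm_proj_apply e hx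

theorem contMDiffAt_constSection {p x : M} (hx : x ∈ (trivializationAt F V p).baseSet) (y : F) :
    ContMDiffAt I (I.prod 𝓘(ℝ, F)) ∞
      (fun x => (⟨x, constSection F V p y x⟩ : TotalSpace F V)) x := by
  refine ((trivializationAt F V p).contMDiffAt_iff
    ((trivializationAt F V p).mem_source.2 hx)).2 ⟨contMDiffAt_id, ?_⟩
  refine (contMDiffAt_const (c := y)).congr_of_eventuallyEq ?_
  filter_upwards [(trivializationAt F V p).open_baseSet.mem_nhds hx] with x' hx'
  exact trivializationAt_constSection hx' y

theorem mdifferentiableAt_constSection {p x : M} (hx : x ∈ (trivializationAt F V p).baseSet)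
    (y : F) : MDifferentiableAt I (I.prod 𝓘(ℝ, F))
      (fun x => (⟨x, constSection F V p y x⟩ : TotalSpace F V)) x :=
  (contMDiffAt_constSection hx y).mdifferentiableAt (by simp)

theorem mdifferentiableAt_trivializationAt_snd {p : M} {e : TotalSpace F V}
    (he : e.proj ∈ (trivializationAt F V p).baseSet) :
    MDifferentiableAt (I.prod 𝓘(ℝ, F)) 𝓘(ℝ, F)
      (fun e' : TotalSpace F V => (trivializationAt F V p e').2) e :=
  (contMDiffAt_trivializationAt_snd he).mdifferentiableAt (by simp)

variable (I) in
/-- The component along the fiber of a tangent vector to the total space, in the preferred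
trivialization at `p`. -/
def trivDeriv (p : M) (e : TotalSpace F V) : TangentSpace (I.prod 𝓘(ℝ, F)) e →L[ℝ] F :=
  mvfderiv (I.prod 𝓘(ℝ, F)) (fun e' : TotalSpace F V => (trivializationAt F V p e').2) e

/-- A tangent vector to the total space is determined by its projection to the base and by its
component along the fiber in the preferred trivialization. -/
theorem eq_zero_of_projDeriv_eq_zero {e : TotalSpace F V} {w : TangentSpace (I.prod 𝓘(ℝ, F)) e}
    (h₁ : projDeriv I e w = 0)
    (h₂ : trivDeriv I e.proj e w = 0) : w = 0 := by
  set ψ := extChartAt (I.prod 𝓘(ℝ, F)) e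
  have hψ : MDifferentiableAt (I.prod 𝓘(ℝ, F)) 𝓘(ℝ, E × F) ψ e :=
    mdifferentiableAt_extChartAt (mem_chart_source _ e)
  have hinj := (isInvertible_mfderiv_extChartAt (I := I.prod 𝓘(ℝ, F))
    (mem_extChartAt_source (I := I.prod 𝓘(ℝ, F)) e)).injective
  have hb := FiberBundle.mem_baseSet_trivializationAt' (F := F) (E := V) e.proj
  have hfst : (fun e' => (ψ e').1) =ᶠ[𝓝 e] fun e' => extChartAt I e.proj e'.proj := by
    have : ∀ᶠ e' : TotalSpace F V in 𝓝 e, e'.proj ∈ (trivializationAt F V e.proj).baseSet :=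
      (FiberBundle.continuous_proj F V).continuousAt.eventually
        ((trivializationAt F V e.proj).open_baseSet.mem_nhds hb)
    filter_upwards [this] with e' he'
    simp only [ψ, FiberBundle.extChartAt]
    simp [(trivializationAt F V e.proj).coe_fst' he']
  have hsnd : (fun e' => (ψ e').2) = fun e' => (trivializationAt F V e.proj e').2 := by
    ext e'
    simp only [ψ, FiberBundle.extChartAt]
    simp
  have d1 : (mvfderiv (I.prod 𝓘(ℝ, F)) ψ e w).1 = 0 := by
    have a1 : mvfderiv (I.prod 𝓘(ℝ, F)) (fun e' => (ψ e').1) e w =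
        (mvfderiv (I.prod 𝓘(ℝ, F)) ψ e w).1 :=
      mvfderiv_clm_comp (ContinuousLinearMap.fst ℝ E F) hψ w
    rw [← a1]
    have a2 : mvfderiv (I.prod 𝓘(ℝ, F)) (fun e' => (ψ e').1) e =
      mvfderiv (I.prod 𝓘(ℝ, F)) (fun e' => extChartAt I e.proj e'.proj) e := hfst.mfderiv_eq
    rw [a2, mvfderiv_comp_vector (f := (TotalSpace.proj : TotalSpace F V → M)) (I' := I)
      (mdifferentiableAt_extChartAt (mem_chart_source _ e.proj)) (Bundle.mdifferentiableAt_proj V)]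
    change mvfderiv I (extChartAt I e.proj) e.proj (projDeriv I e w) = 0
    rw [h₁, map_zero]
  have d2 : (mvfderiv (I.prod 𝓘(ℝ, F)) ψ e w).2 = 0 := by
    have a2 : mvfderiv (I.prod 𝓘(ℝ, F)) (fun e' => (ψ e').2) e w =
        (mvfderiv (I.prod 𝓘(ℝ, F)) ψ e w).2 :=
      mvfderiv_clm_comp (ContinuousLinearMap.snd ℝ E F) hψ w
    rw [← a2, hsnd]
    exact h₂
  refine hinj ?_
  rw [map_zero]
  exact Prod.ext d1 d2

variable (cov : CovariantDerivative I F V)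

theorem projDeriv_add (e : TotalSpace F V) (w w' : TangentSpace (I.prod 𝓘(ℝ, F)) e) :
    projDeriv I e (w + w') = projDeriv I e w + projDeriv I e w' := map_add _ _ _

theorem projDeriv_sub (e : TotalSpace F V) (w w' : TangentSpace (I.prod 𝓘(ℝ, F)) e) :
    projDeriv I e (w - w') = projDeriv I e w - projDeriv I e w' := map_sub _ _ _

theorem connector_eq_trivDeriv (e : TotalSpace F V) (w : TangentSpace (I.prod 𝓘(ℝ, F)) e) :
    connector cov e w = (trivializationAt F V e.proj).symmL ℝ e.proj (trivDeriv I e.proj e w) +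
      cov (FiberBundle.extend F e.2) e.proj (projDeriv I e w) := by
  rw [(trivializationAt F V e.proj).symmL_apply
    (FiberBundle.mem_baseSet_trivializationAt' (F := F) (E := V) e.proj)]
  rfl

theorem connector_add (e : TotalSpace F V) (w w' : TangentSpace (I.prod 𝓘(ℝ, F)) e) :
    connector cov e (w + w') = connector cov e w + connector cov e w' := by
  simp only [connector_eq_trivDeriv, projDeriv_add, map_add]
  abel

theorem connector_zero (e : TotalSpace F V) :
    connector cov e (0 : TangentSpace (I.prod 𝓘(ℝ, F)) e) = 0 := by
  have := connector_add cov e (0 : TangentSpace (I.prod 𝓘(ℝ, F)) e) 0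
  rw [add_zero] at this
  simpa using this

theorem trivializationAt_snd_add_smul {p x : M} (hb : x ∈ (trivializationAt F V p).baseSet)
    (α u : V x) (t : ℝ) : (trivializationAt F V p ⟨x, α + t • u⟩).2 =
      (trivializationAt F V p ⟨x, α⟩).2 + t • (trivializationAt F V p ⟨x, u⟩).2 := by
  simp only [← (trivializationAt F V p).continuousLinearMapAt_apply_of_mem ℝ hb, map_add, map_smul]

theorem mdifferentiableAt_add_smul {x : M} (α u : V x) (t : ℝ) :
    MDifferentiableAt 𝓘(ℝ, ℝ) (I.prod 𝓘(ℝ, F))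
      (fun t : ℝ => (⟨x, α + t • u⟩ : TotalSpace F V)) t := by
  have hb := FiberBundle.mem_baseSet_trivializationAt' (F := F) (E := V) x
  refine ((trivializationAt F V x).mdifferentiableAt_totalSpace_iff I _
    ((trivializationAt F V x).mem_source.2 hb)).2 ⟨mdifferentiableAt_const, ?_⟩
  simp only [trivializationAt_snd_add_smul hb]
  apply DifferentiableAt.mdifferentiableAt
  fun_prop

/-- The derivative in the direction of a vertical tangent vector, computed along any curve in the
fiber which represents it. -/
theorem hasDerivAt_of_projDeriv_eq_zero {e : TotalSpace F V}
    {w : TangentSpace (I.prod 𝓘(ℝ, F)) e} (hw : projDeriv I e w = 0) {γ : ℝ → TotalSpace F V}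
    (hγ₀ : γ 0 = e) (hγ : MDifferentiableAt 𝓘(ℝ, ℝ) (I.prod 𝓘(ℝ, F)) γ 0)
    (hproj : ∀ t, (γ t).proj = e.proj)
    (htriv : HasDerivAt (fun t => (trivializationAt F V e.proj (γ t)).2) (trivDeriv I e.proj e w) 0)
    {G : Type*} [NormedAddCommGroup G] [NormedSpace ℝ G] {g : TotalSpace F V → G}
    (hg : MDifferentiableAt (I.prod 𝓘(ℝ, F)) 𝓘(ℝ, G) g e) :
    HasDerivAt (fun t => g (γ t)) (mvfderiv (I.prod 𝓘(ℝ, F)) g e w) 0 := by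
  subst hγ₀
  have hb := FiberBundle.mem_baseSet_trivializationAt' (F := F) (E := V) (γ 0).proj
  have h1 : projDeriv I (γ 0) (velocity (I.prod 𝓘(ℝ, F)) γ 0) = 0 := by
    have := velocity_comp (I' := I) (f := (TotalSpace.proj : TotalSpace F V → M))
      (Bundle.mdifferentiableAt_proj V) hγ
    rw [projDeriv, ← this, funext hproj, velocity, mfderiv_const]
    rfl
  have h2 : trivDeriv I (γ 0).proj (γ 0) (velocity (I.prod 𝓘(ℝ, F)) γ 0) =
      trivDeriv I (γ 0).proj (γ 0) w :=
    (hasDerivAt_comp_curve (mdifferentiableAt_trivializationAt_snd hb) hγ).unique htriv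
  have h3 : velocity (I.prod 𝓘(ℝ, F)) γ 0 - w = 0 := by
    refine eq_zero_of_projDeriv_eq_zero ?_ ?_
    · rw [projDeriv_sub, h1, hw, sub_zero]
    · rw [map_sub, h2, sub_self]
  rw [← sub_eq_zero.1 h3]
  exact hasDerivAt_comp_curve hg hγ

/-- The derivative in the direction of a vertical tangent vector of a function on the total space is
its derivative along a straight line in the fiber, whose direction is given by the connection
map. -/
theorem hasDerivAt_add_smul_connector {e : TotalSpace F V} {w : TangentSpace (I.prod 𝓘(ℝ, F)) e}
    (hw : projDeriv I e w = 0)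
    {G : Type*} [NormedAddCommGroup G] [NormedSpace ℝ G] {g : TotalSpace F V → G}
    (hg : MDifferentiableAt (I.prod 𝓘(ℝ, F)) 𝓘(ℝ, G) g e) :
    HasDerivAt (fun t : ℝ => g ⟨e.proj, e.2 + t • connector cov e w⟩)
      (mvfderiv (I.prod 𝓘(ℝ, F)) g e w) 0 := by
  have hb := FiberBundle.mem_baseSet_trivializationAt' (F := F) (E := V) e.proj
  refine hasDerivAt_of_projDeriv_eq_zero hw (γ := fun t => ⟨e.proj, e.2 + t • connector cov e w⟩)
    (by simp) (mdifferentiableAt_add_smul _ _ _) (fun _ => rfl) ?_ hg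
  have : (trivializationAt F V e.proj ⟨e.proj, connector cov e w⟩).2 = trivDeriv I e.proj e w := by
    rw [connector_eq_trivDeriv, hw, map_zero, add_zero]
    exact trivializationAt_constSection hb _
  simp only [trivializationAt_snd_add_smul hb, this]
  simpa using ((hasDerivAt_id (0 : ℝ)).smul_const (trivDeriv I e.proj e w)).const_add
    (trivializationAt F V e.proj ⟨e.proj, e.2⟩).2

theorem trivDeriv_of_projDeriv_eq_zero {e : TotalSpace F V} {w : TangentSpace (I.prod 𝓘(ℝ, F)) e}
    (hw : projDeriv I e w = 0) {p : M} (hp : e.proj ∈ (trivializationAt F V p).baseSet) :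
    trivDeriv I p e w = (trivializationAt F V p ⟨e.proj, connector cov e w⟩).2 := by
  have h1 := hasDerivAt_add_smul_connector cov hw
    (mdifferentiableAt_trivializationAt_snd (I := I) hp)
  refine h1.unique ?_
  simp only [trivializationAt_snd_add_smul hp]
  simpa using ((hasDerivAt_id (0 : ℝ)).smul_const
    (trivializationAt F V p ⟨e.proj, connector cov e w⟩).2).const_add
    (trivializationAt F V p ⟨e.proj, e.2⟩).2

variable [FiniteDimensional ℝ F]

/-- The covariant derivative of a section in terms of its expression in the preferred
trivialization. The difference of the covariant derivative and of the derivative of the expression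
in the trivialization is tensorial, hence may be computed on a section which is constant in the
trivialization. -/
theorem cov_eq {s : ∀ x, V x} {x : M}
    (hs : MDifferentiableAt I (I.prod 𝓘(ℝ, F)) (fun x => (⟨x, s x⟩ : TotalSpace F V)) x)
    (v : TangentSpace I x) :
    cov s x v = (trivializationAt F V x).symmL ℝ x
      (mvfderiv I (fun x' => (trivializationAt F V x ⟨x', s x'⟩).2) x v) +
        cov (FiberBundle.extend F (s x)) x v := by
  have hb := FiberBundle.mem_baseSet_trivializationAt' (F := F) (E := V) x
  set T := trivializationAt F V x
  have hT : ∀ {s : ∀ x, V x},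
      MDifferentiableAt I (I.prod 𝓘(ℝ, F)) (fun x => (⟨x, s x⟩ : TotalSpace F V)) x →
      MDifferentiableAt I 𝓘(ℝ, F) (fun x' => (T ⟨x', s x'⟩).2) x := fun h =>
    (T.mdifferentiableAt_section_iff I _ hb).1 h
  have hev : ∀ᶠ x' in 𝓝 x, x' ∈ T.baseSet := T.open_baseSet.mem_nhds hb
  have htens : TensorialAt I F (fun s : ∀ x, V x => cov s x -
      (T.symmL ℝ x).comp (mvfderiv I (fun x' => (T ⟨x', s x'⟩).2) x)) x := by
    refine ⟨fun {f s} hf hs => ?_, fun {s s'} hs hs' => ?_⟩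
    · have h1 : mvfderiv I (fun x' => (T ⟨x', (f • s) x'⟩).2) x =
          mvfderiv I (fun x' => f x' • (T ⟨x', s x'⟩).2) x := by
        refine Filter.EventuallyEq.mfderiv_eq ?_
        filter_upwards [hev] with x' hx'
        simp only [← T.continuousLinearMapAt_apply_of_mem ℝ hx', ← map_smul, Pi.smul_apply']
      ext v
      rw [cov.isCovariantDerivativeOnUniv.leibniz hs hf (mem_univ x), h1,
        mvfderiv_fun_smul hf (hT hs)]
      have h2 : T.symmL ℝ x (T ⟨x, s x⟩).2 = s x := by
        rw [T.symmL_apply hb]; exact T.symm_proj_apply ⟨x, s x⟩ hb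
      simp [h2, smul_sub]
    · have h1 : mvfderiv I (fun x' => (T ⟨x', (s + s') x'⟩).2) x =
          mvfderiv I (fun x' => (T ⟨x', s x'⟩).2 + (T ⟨x', s' x'⟩).2) x := by
        refine Filter.EventuallyEq.mfderiv_eq ?_
        filter_upwards [hev] with x' hx'
        simp only [← T.continuousLinearMapAt_apply_of_mem ℝ hx', ← map_add, Pi.add_apply]
      rw [cov.isCovariantDerivativeOnUniv.add hs hs' (mem_univ x), h1,
        mvfderiv_fun_add (hT hs) (hT hs')]
      ext v
      simp
      abel
  have key := htens.pointwise hs (FiberBundle.mdifferentiableAt_extend I F (s x)) (by simp)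
  have h3 : mvfderiv I (fun x' => (T ⟨x', FiberBundle.extend F (s x) x'⟩).2) x = 0 := by
    rw [← mvfderiv_const (I := I) (T ⟨x, s x⟩).2 (x := x)]
    refine Filter.EventuallyEq.mfderiv_eq ?_
    filter_upwards [hev] with x' hx'
    have h4 := congrArg Prod.snd (T.apply_mk_symm hx' (T ⟨x, s x⟩).2)
    exact h4
  have := DFunLike.congr_fun key v
  simp only [h3, ContinuousLinearMap.comp_zero, sub_zero] at this
  rw [← this]
  exact (add_sub_cancel _ _).symm

/-- The connection map sends the differential of a section to its covariant derivative. -/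
theorem connector_mfderiv_section {s : ∀ x, V x} {x : M}
    (hs : MDifferentiableAt I (I.prod 𝓘(ℝ, F)) (fun x => (⟨x, s x⟩ : TotalSpace F V)) x)
    (v : TangentSpace I x) :
    projDeriv I (⟨x, s x⟩ : TotalSpace F V)
      (mfderiv I (I.prod 𝓘(ℝ, F)) (fun x => (⟨x, s x⟩ : TotalSpace F V)) x v) = v ∧
    connector cov ⟨x, s x⟩ (mfderiv I (I.prod 𝓘(ℝ, F)) (fun x => (⟨x, s x⟩ : TotalSpace F V)) x v) =
      cov s x v := by
  have hb := FiberBundle.mem_baseSet_trivializationAt' (F := F) (E := V) x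
  have h1 : projDeriv I (⟨x, s x⟩ : TotalSpace F V)
      (mfderiv I (I.prod 𝓘(ℝ, F)) (fun x => (⟨x, s x⟩ : TotalSpace F V)) x v) = v := by
    have := mfderiv_comp_apply (I := I) (I' := I.prod 𝓘(ℝ, F)) (I'' := I) x
      (g := (TotalSpace.proj : TotalSpace F V → M)) (Bundle.mdifferentiableAt_proj V) hs v
    refine this.symm.trans ?_
    exact congrArg (fun L : TangentSpace I x →L[ℝ] TangentSpace I x => L v) (mfderiv_id (I := I))
  refine ⟨h1, ?_⟩
  rw [connector_eq_trivDeriv, h1, cov_eq cov hs v]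
  congr 2
  exact (mvfderiv_comp_vector (I' := I.prod 𝓘(ℝ, F)) (f := fun x => (⟨x, s x⟩ : TotalSpace F V))
    (mdifferentiableAt_trivializationAt_snd (e := ⟨x, s x⟩) hb) hs v).symm

/-- A tangent vector to the total space at a point of a section is the sum of a vector tangent to
the section and of a vertical vector. -/
theorem exists_eq_mfderiv_section_add {s : ∀ x, V x} {x : M}
    (hs : MDifferentiableAt I (I.prod 𝓘(ℝ, F)) (fun x => (⟨x, s x⟩ : TotalSpace F V)) x)
    (w : TangentSpace (I.prod 𝓘(ℝ, F)) (⟨x, s x⟩ : TotalSpace F V)) :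
    ∃ w₀ : TangentSpace (I.prod 𝓘(ℝ, F)) (⟨x, s x⟩ : TotalSpace F V),
      projDeriv I (⟨x, s x⟩ : TotalSpace F V) w₀ = 0 ∧
      w = mfderiv I (I.prod 𝓘(ℝ, F)) (fun x => (⟨x, s x⟩ : TotalSpace F V)) x
        (projDeriv I (⟨x, s x⟩ : TotalSpace F V) w) + w₀ ∧
      connector cov ⟨x, s x⟩ w = cov s x (projDeriv I (⟨x, s x⟩ : TotalSpace F V) w) +
        connector cov ⟨x, s x⟩ w₀ := by
  set v := projDeriv I (⟨x, s x⟩ : TotalSpace F V) w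
  obtain ⟨h1, h2⟩ := connector_mfderiv_section cov hs v
  refine ⟨w - mfderiv I (I.prod 𝓘(ℝ, F)) (fun x => (⟨x, s x⟩ : TotalSpace F V)) x v, ?_, ?_, ?_⟩
  · rw [projDeriv_sub, h1, sub_self]
  · exact (add_sub_cancel _ _).symm
  · rw [← h2, ← connector_add, add_sub_cancel]

/-- The connection map in the preferred trivialization at an arbitrary nearby point. -/
theorem connector_eq {e : TotalSpace F V} {p : M} (hp : e.proj ∈ (trivializationAt F V p).baseSet)
    (w : TangentSpace (I.prod 𝓘(ℝ, F)) e) :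
    connector cov e w = (trivializationAt F V p).symmL ℝ e.proj (trivDeriv I p e w) +
      cov (constSection F V p (trivializationAt F V p e).2) e.proj (projDeriv I e w) := by
  obtain ⟨x, α⟩ := e
  obtain ⟨y, rfl⟩ : ∃ y, constSection F V p y x = α :=
    ⟨_, constSection_trivializationAt (e := ⟨x, α⟩) hp⟩
  have hs := mdifferentiableAt_constSection (I := I) hp y
  obtain ⟨w₀, hw₀, hw, hc⟩ := exists_eq_mfderiv_section_add cov hs w
  have h1 : trivDeriv I p (⟨x, constSection F V p y x⟩ : TotalSpace F V)
      (mfderiv I (I.prod 𝓘(ℝ, F)) (fun x => (⟨x, constSection F V p y x⟩ : TotalSpace F V)) x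
        (projDeriv I (⟨x, constSection F V p y x⟩ : TotalSpace F V) w)) = 0 := by
    refine (mvfderiv_comp_vector (I' := I.prod 𝓘(ℝ, F))
      (f := fun x => (⟨x, constSection F V p y x⟩ : TotalSpace F V))
      (mdifferentiableAt_trivializationAt_snd hp) hs _).symm.trans ?_
    have : mvfderiv I (fun x => (trivializationAt F V p ⟨x, constSection F V p y x⟩).2) x = 0 := by
      rw [← mvfderiv_const (I := I) y (x := x)]
      refine Filter.EventuallyEq.mfderiv_eq ?_
      filter_upwards [(trivializationAt F V p).open_baseSet.mem_nhds hp] with x' hx'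
      exact trivializationAt_constSection hx' y
    rw [this]; rfl
  have h2 : trivDeriv I p (⟨x, constSection F V p y x⟩ : TotalSpace F V) w =
      (trivializationAt F V p ⟨x, connector cov ⟨x, constSection F V p y x⟩ w₀⟩).2 := by
    rw [hw, map_add, h1, zero_add]
    exact trivDeriv_of_projDeriv_eq_zero cov hw₀ hp
  rw [hc, h2, trivializationAt_constSection hp, add_comm]
  congr 1
  exact (constSection_trivializationAt
    (e := ⟨x, connector cov ⟨x, constSection F V p y x⟩ w₀⟩) hp).symm

variable [IsContMDiffRiemannianBundle I ∞ F V]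

theorem contMDiff_inner_self :
    ContMDiff (I.prod 𝓘(ℝ, F)) 𝓘(ℝ, ℝ) ∞ (fun e : TotalSpace F V => (inner ℝ e.2 e.2 : ℝ)) :=
  ContMDiff.inner_bundle (b := (TotalSpace.proj : TotalSpace F V → M)) (v := fun e => e.2)
    (w := fun e => e.2) contMDiff_id contMDiff_id

/-- For a metric covariant derivative, the differential of the squared norm on the total space is
given by the connection map. -/
theorem mvfderiv_inner_self (hcov : cov.IsMetricCompatible) (e : TotalSpace F V)
    (w : TangentSpace (I.prod 𝓘(ℝ, F)) e) :
    mvfderiv (I.prod 𝓘(ℝ, F)) (fun e : TotalSpace F V => (inner ℝ e.2 e.2 : ℝ)) e w =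
      2 * inner ℝ e.2 (connector cov e w) := by
  obtain ⟨x, α⟩ := e
  have hp := FiberBundle.mem_baseSet_trivializationAt' (F := F) (E := V) x
  obtain ⟨y, rfl⟩ : ∃ y, constSection F V x y x = α :=
    ⟨_, constSection_trivializationAt (e := ⟨x, α⟩) hp⟩
  have hs := mdifferentiableAt_constSection (I := I) hp y
  obtain ⟨w₀, hw₀, hw, hc⟩ := exists_eq_mfderiv_section_add cov hs w
  have hN : MDifferentiableAt (I.prod 𝓘(ℝ, F)) 𝓘(ℝ, ℝ)
      (fun e : TotalSpace F V => (inner ℝ e.2 e.2 : ℝ)) ⟨x, constSection F V x y x⟩ :=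
    contMDiff_inner_self.mdifferentiableAt (by simp)
  have h1 (v : TangentSpace I x) :
      mvfderiv (I.prod 𝓘(ℝ, F)) (fun e : TotalSpace F V => (inner ℝ e.2 e.2 : ℝ))
        ⟨x, constSection F V x y x⟩ (mfderiv I (I.prod 𝓘(ℝ, F))
          (fun x' => (⟨x', constSection F V x y x'⟩ : TotalSpace F V)) x v) =
      2 * inner ℝ (constSection F V x y x) (cov (constSection F V x y) x v) := by
    classical
    refine (mvfderiv_comp_vector (I' := I.prod 𝓘(ℝ, F))
      (f := fun x' => (⟨x', constSection F V x y x'⟩ : TotalSpace F V)) hN hs v).symm.trans ?_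
    have := hcov.mvfderiv_inner_eq (Function.update (fun _ => 0) x v) hs hs
    simp only [Function.update_self] at this
    rw [this, real_inner_comm]
    ring
  have h2 : mvfderiv (I.prod 𝓘(ℝ, F)) (fun e : TotalSpace F V => (inner ℝ e.2 e.2 : ℝ))
      ⟨x, constSection F V x y x⟩ w₀ =
      2 * inner ℝ (constSection F V x y x) (connector cov ⟨x, constSection F V x y x⟩ w₀) := by
    refine (hasDerivAt_add_smul_connector cov hw₀ hN).unique ?_
    have hline := ((hasDerivAt_id (0 : ℝ)).smul_const
      (connector cov ⟨x, constSection F V x y x⟩ w₀)).const_add (constSection F V x y x)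
    have := hline.inner ℝ hline
    simp only [id_eq, zero_smul, add_zero, one_smul] at this
    rw [real_inner_comm (connector cov ⟨x, constSection F V x y x⟩ w₀), ← two_mul] at this
    rw [real_inner_comm]
    exact this
  rw [hc, inner_add_right, mul_add, ← h1, ← h2, ← map_add, ← hw]

end Connection

/-! ### Christoffel maps and compactly supported sections -/

section Christoffel

variable {E : Type*} [NormedAddCommGroup E] [NormedSpace ℝ E] [FiniteDimensional ℝ E]
  {H : Type*} [TopologicalSpace H] {I : ModelWithCorners ℝ E H} [I.Boundaryless]
  {M : Type*} [TopologicalSpace M] [ChartedSpace H M] [IsManifold I ∞ M]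
  {F : Type*} [NormedAddCommGroup F] [NormedSpace ℝ F] [FiniteDimensional ℝ F]
  {V : M → Type*} [TopologicalSpace (TotalSpace F V)]
  [∀ x, NormedAddCommGroup (V x)] [∀ x, InnerProductSpace ℝ (V x)]
  [FiberBundle F V] [VectorBundle ℝ F V] [ContMDiffVectorBundle ∞ F V I]
  (cov : CovariantDerivative I F V)

/-- The Christoffel map at `x` of a covariant derivative, in the preferred chart and the preferred
trivialization at `p`. -/
def christoffel (p x : M) : E →L[ℝ] F →L[ℝ] F :=
  ∑ i, (ContinuousLinearMap.smulRightL ℝ F F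
    (LinearMap.toContinuousLinearMap ((Module.finBasis ℝ F).coord i))).comp
      (ContinuousLinearMap.inCoordinates E (TangentSpace I : M → Type _) F V p x p x
        (cov (constSection F V p (Module.finBasis ℝ F i)) x))

theorem cov_constSection_add {p x : M} (hx : x ∈ (trivializationAt F V p).baseSet) (y z : F) :
    cov (constSection F V p (y + z)) x =
      cov (constSection F V p y) x + cov (constSection F V p z) x := by
  rw [constSection_add]
  exact cov.isCovariantDerivativeOnUniv.add (mdifferentiableAt_constSection hx y)
    (mdifferentiableAt_constSection hx z) (mem_univ x)

theorem cov_constSection_smul {p x : M} (hx : x ∈ (trivializationAt F V p).baseSet) (c : ℝ)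
    (y : F) : cov (constSection F V p (c • y)) x = c • cov (constSection F V p y) x := by
  rw [constSection_smul]
  exact cov.isCovariantDerivativeOnUniv.smul_const c (mdifferentiableAt_constSection hx y)
    (mem_univ x)

theorem christoffel_apply {p x : M} (hx : x ∈ (chartAt H p).source)
    (hx' : x ∈ (trivializationAt F V p).baseSet) (v : TangentSpace I x) (y : F) :
    christoffel cov p x (mvfderiv I (extChartAt I p) x v) y =
      (trivializationAt F V p ⟨x, cov (constSection F V p y) x v⟩).2 := by
  let L : F →ₗ[ℝ] (TangentSpace I x →L[ℝ] V x) :=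
    { toFun := fun y => cov (constSection F V p y) x
      map_add' := cov_constSection_add cov hx'
      map_smul' := cov_constSection_smul cov hx' }
  have hy : cov (constSection F V p y) x =
      ∑ i, (Module.finBasis ℝ F).repr y i • cov (constSection F V p (Module.finBasis ℝ F i)) x := by
    have := congrArg L ((Module.finBasis ℝ F).sum_repr y)
    rw [map_sum] at this
    simp only [map_smul] at this
    exact this.symm
  have hv : (trivializationAt E (TangentSpace I) p).symmL ℝ x
      (mvfderiv I (extChartAt I p) x v : E) = v := by
    have h1 := TangentBundle.continuousLinearMapAt_trivializationAt (𝕜 := ℝ) (I := I) hx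
    have h2 := (trivializationAt E (TangentSpace I : M → Type _) p).symmL_continuousLinearMapAt
      (R := ℝ) (b := x) (by simpa using hx) v
    rw [h1] at h2
    exact h2
  rw [← (trivializationAt F V p).continuousLinearMapAt_apply_of_mem ℝ hx', hy]
  simp only [christoffel, sum_apply, ContinuousLinearMap.comp_apply,
    ContinuousLinearMap.inCoordinates, hv, map_sum, map_smul, smul_apply]
  rfl

variable [T2Space M] [cov.ContMDiffCovariantDerivative ∞]

/-- A local section which is constant in a trivialization extends to a smooth section of compact
support. -/
theorem exists_smooth_section (p : M) (y : F) : ∃ s : ∀ x, V x,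
    ContMDiff I (I.prod 𝓘(ℝ, F)) ∞ (fun x => (⟨x, s x⟩ : TotalSpace F V)) ∧
    HasCompactSupport (fun x => ‖s x‖) ∧ ∀ᶠ x in 𝓝 p, s x = constSection F V p y x := by
  have hb := (trivializationAt F V p).open_baseSet.mem_nhds
    (FiberBundle.mem_baseSet_trivializationAt' (F := F) (E := V) p)
  obtain ⟨f, hf⟩ := (SmoothBumpFunction.nhds_basis_support (I := I) hb).ex_mem
  refine ⟨fun x => f x • constSection F V p y x, ?_, ?_, ?_⟩
  · refine ContMDiffOn.smul_section_of_tsupport (V := V) (F := F) (ψ := f) f.contMDiff.contMDiffOn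
      (trivializationAt F V p).open_baseSet hf fun x hx => ?_
    exact (contMDiffAt_constSection hx y).contMDiffWithinAt
  · refine f.hasCompactSupport.mono fun x hx => ?_
    contrapose! hx
    simp only [Function.mem_support, not_not] at hx ⊢
    rw [hx, zero_smul, norm_zero]
  · filter_upwards [f.eventuallyEq_one] with x hx
    rw [hx]
    simp

theorem eventually_continuousAt_christoffel (p : M) :
    ∀ᶠ x in 𝓝 p, ContinuousAt (christoffel cov p) x := by
  have key : ∀ y : F, ∀ᶠ x in 𝓝 p, ContinuousAt (fun x =>
      ContinuousLinearMap.inCoordinates E (TangentSpace I : M → Type _) F V p x p x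
        (cov (constSection F V p y) x)) x := by
    intro y
    obtain ⟨s, hs, -, heq⟩ := exists_smooth_section (I := I) (V := V) p y
    have h1 : ContMDiffAt I (I.prod 𝓘(ℝ, E →L[ℝ] F)) ∞ (fun x => (⟨x, cov s x⟩ :
        TotalSpace (E →L[ℝ] F) (fun x => TangentSpace I x →L[ℝ] V x))) p :=
      (CovariantDerivative.ContMDiffCovariantDerivative.contMDiff (cov := cov) (k := ∞)).contMDiff
        (by simpa using hs.contMDiffOn) |>.contMDiffAt Filter.univ_mem
    have h2 := ((contMDiffAt_hom_bundle _).1 (h1.of_le (m := 1) (by simp))).2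
    have h3 := (contMDiffAt_iff_contMDiffAt_nhds (by simp)).1 h2
    filter_upwards [h3, heq.eventually_nhds, heq.eventually_nhds.eventually_nhds,
      ((trivializationAt F V p).open_baseSet.eventually_mem
        (FiberBundle.mem_baseSet_trivializationAt' (F := F) (E := V) p)).eventually_nhds]
      with x hx heqx heqx' hbx
    refine hx.continuousAt.congr ?_
    filter_upwards [heqx', hbx] with x' h4 h5
    congr 1
    exact cov.isCovariantDerivativeOnUniv.congr_of_eventuallyEq
      (hs.mdifferentiable (by simp) x') (mdifferentiableAt_constSection h5 y) Filter.univ_mem h4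
  have := Filter.eventually_all.2 fun i => key (Module.finBasis ℝ F i)
  filter_upwards [this] with x hx
  change Filter.Tendsto (fun x => christoffel cov p x) _ _
  exact tendsto_finsetSum _ fun i _ => continuousAt_const.clm_comp (hx i)

end Christoffel

/-! ### The covariant derivative along a curve -/

/-- A bound on the difference of two numbers follows from the same bound for their smooth
regularizations. -/
theorem ofReal_le_add_of_forall_sqrt {x y : ℝ} {L : ℝ≥0∞} (hy : 0 ≤ y)
    (h : ∀ ε > (0 : ℝ), ‖√(x ^ 2 + ε) - √(y ^ 2 + ε)‖ₑ ≤ L) :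
    ENNReal.ofReal x ≤ ENNReal.ofReal y + L := by
  have h1 : ∀ ε > (0 : ℝ), ENNReal.ofReal x ≤ ENNReal.ofReal (√(y ^ 2 + ε)) + L := by
    intro ε hε
    calc ENNReal.ofReal x ≤ ENNReal.ofReal (√(x ^ 2 + ε)) := by
          refine ENNReal.ofReal_le_ofReal (Real.le_sqrt_of_sq_le (by linarith))
      _ ≤ ENNReal.ofReal (√(y ^ 2 + ε) + ‖√(x ^ 2 + ε) - √(y ^ 2 + ε)‖) := by
          refine ENNReal.ofReal_le_ofReal ?_
          have := Real.le_norm_self (√(x ^ 2 + ε) - √(y ^ 2 + ε))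
          linarith
      _ ≤ _ := by
          rw [ENNReal.ofReal_add (by positivity) (by positivity), ofReal_norm]
          gcongr
          exact h ε hε
  have h2 : Filter.Tendsto (fun ε : ℝ => ENNReal.ofReal (√(y ^ 2 + ε)) + L) (𝓝[>] 0)
      (𝓝 (ENNReal.ofReal y + L)) := by
    refine Filter.Tendsto.add ?_ tendsto_const_nhds
    refine (ENNReal.continuous_ofReal.tendsto _).comp ?_
    have : Continuous fun ε : ℝ => √(y ^ 2 + ε) := by fun_prop
    have h3 := this.tendsto 0
    simp only [add_zero, Real.sqrt_sq hy] at h3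
    exact h3.mono_left nhdsWithin_le_nhds
  exact ge_of_tendsto h2 (by filter_upwards [self_mem_nhdsWithin] with ε hε using h1 ε hε)

section CovAlong

variable {E : Type*} [NormedAddCommGroup E] [NormedSpace ℝ E] [FiniteDimensional ℝ E]
  {H : Type*} [TopologicalSpace H] {I : ModelWithCorners ℝ E H} [I.Boundaryless]
  {M : Type*} [TopologicalSpace M] [ChartedSpace H M] [IsManifold I ∞ M]
  {F : Type*} [NormedAddCommGroup F] [NormedSpace ℝ F] [FiniteDimensional ℝ F]
  {V : M → Type*} [TopologicalSpace (TotalSpace F V)]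
  [∀ x, NormedAddCommGroup (V x)] [∀ x, InnerProductSpace ℝ (V x)]
  [FiberBundle F V] [VectorBundle ℝ F V] [ContMDiffVectorBundle ∞ F V I]
  (cov : CovariantDerivative I F V)
  {σ : ℝ → M} {η ζ : ∀ t, V (σ t)} {ξ : ℝ → TotalSpace F V} {a b t : ℝ}

variable (F) in
/-- A section along a curve `σ`, as a curve in the total space. -/
abbrev sectionCurve (σ : ℝ → M) (η : ∀ t, V (σ t)) (t : ℝ) : TotalSpace F V := ⟨σ t, η t⟩

theorem velocity_proj (h : MDifferentiableAt 𝓘(ℝ, ℝ) (I.prod 𝓘(ℝ, F)) ξ t) :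
    projDeriv I (ξ t) (velocity (I.prod 𝓘(ℝ, F)) ξ t) = velocity I (fun t => (ξ t).proj) t :=
  (velocity_comp (I' := I) (f := (TotalSpace.proj : TotalSpace F V → M))
      (Bundle.mdifferentiableAt_proj V) h).symm

theorem mdifferentiableAt_proj_curve (h : MDifferentiableAt 𝓘(ℝ, ℝ) (I.prod 𝓘(ℝ, F)) ξ t) :
    MDifferentiableAt 𝓘(ℝ, ℝ) I (fun t => (ξ t).proj) t :=
  (Bundle.mdifferentiableAt_proj V).comp t h

theorem mdifferentiableAt_sectionCurve_iff {p : M}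
    (hp : σ t ∈ (trivializationAt F V p).baseSet) :
    MDifferentiableAt 𝓘(ℝ, ℝ) (I.prod 𝓘(ℝ, F)) (sectionCurve F σ η) t ↔
      MDifferentiableAt 𝓘(ℝ, ℝ) I σ t ∧
        DifferentiableAt ℝ (fun s => (trivializationAt F V p ⟨σ s, η s⟩).2) t := by
  rw [(trivializationAt F V p).mdifferentiableAt_totalSpace_iff I _
    ((trivializationAt F V p).mem_source.2 hp), mdifferentiableAt_iff_differentiableAt]

theorem differentiableAt_trivializationAt {p : M}
    (h : MDifferentiableAt 𝓘(ℝ, ℝ) (I.prod 𝓘(ℝ, F)) ξ t)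
    (hp : (ξ t).proj ∈ (trivializationAt F V p).baseSet) :
    DifferentiableAt ℝ (fun s => (trivializationAt F V p (ξ s)).2) t :=
  ((mdifferentiableAt_sectionCurve_iff (σ := fun s => (ξ s).proj) (η := fun s => (ξ s).2) hp).1 h).2

/-- The covariant derivative along a curve in coordinates. -/
theorem trivializationAt_covAlong (h : MDifferentiableAt 𝓘(ℝ, ℝ) (I.prod 𝓘(ℝ, F)) ξ t) {p : M}
    (hp : (ξ t).proj ∈ (chartAt H p).source)
    (hp' : (ξ t).proj ∈ (trivializationAt F V p).baseSet) :
    (trivializationAt F V p ⟨(ξ t).proj, covAlong cov ξ t⟩).2 =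
      deriv (fun s => (trivializationAt F V p (ξ s)).2) t +
        christoffel cov p (ξ t).proj (deriv (fun s => extChartAt I p (ξ s).proj) t)
          (trivializationAt F V p (ξ t)).2 := by
  have h1 := (hasDerivAt_comp_curve (mdifferentiableAt_trivializationAt_snd (I := I) hp') h).deriv
  have h2 := (hasDerivAt_comp_curve (mdifferentiableAt_extChartAt hp)
    (mdifferentiableAt_proj_curve h)).deriv
  rw [h1, h2, christoffel_apply cov hp hp', covAlong, connector_eq cov hp', velocity_proj h]
  simp only [← (trivializationAt F V p).continuousLinearMapAt_apply_of_mem ℝ hp', map_add]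
  congr 1
  exact (trivializationAt F V p).continuousLinearMapAt_symmL hp' _

theorem eq_of_trivializationAt_eq {p x : M} (hp : x ∈ (trivializationAt F V p).baseSet) {u v : V x}
    (h : (trivializationAt F V p ⟨x, u⟩).2 = (trivializationAt F V p ⟨x, v⟩).2) : u = v := by
  have h1 := constSection_trivializationAt (e := (⟨x, u⟩ : TotalSpace F V)) hp
  rw [h] at h1
  exact h1.symm.trans (constSection_trivializationAt (e := (⟨x, v⟩ : TotalSpace F V)) hp)

theorem eventually_mem_baseSet {p : M} (h : MDifferentiableAt 𝓘(ℝ, ℝ) I σ t)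
    (hp : σ t ∈ (trivializationAt F V p).baseSet) :
    ∀ᶠ s in 𝓝 t, σ s ∈ (trivializationAt F V p).baseSet :=
  h.continuousAt.eventually ((trivializationAt F V p).open_baseSet.mem_nhds hp)

/-- The Leibniz rule for the covariant derivative along a curve. -/
theorem covAlong_smul_add_smul
    (hη : MDifferentiableAt 𝓘(ℝ, ℝ) (I.prod 𝓘(ℝ, F)) (sectionCurve F σ η) t)
    (hζ : MDifferentiableAt 𝓘(ℝ, ℝ) (I.prod 𝓘(ℝ, F)) (sectionCurve F σ ζ) t)
    {g h : ℝ → ℝ} {g' h' : ℝ} (hg : HasDerivAt g g' t) (hh : HasDerivAt h h' t) :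
    MDifferentiableAt 𝓘(ℝ, ℝ) (I.prod 𝓘(ℝ, F))
      (sectionCurve F σ (fun s => g s • η s + h s • ζ s)) t ∧
    (covAlong cov (sectionCurve F σ (fun s => g s • η s + h s • ζ s)) t : V (σ t)) =
      (g' • η t + g t • (covAlong cov (sectionCurve F σ η) t : V (σ t))) +
      (h' • ζ t + h t • (covAlong cov (sectionCurve F σ ζ) t : V (σ t))) := by
  have hb := FiberBundle.mem_baseSet_trivializationAt' (F := F) (E := V) (σ t)
  have hσ : MDifferentiableAt 𝓘(ℝ, ℝ) I σ t := mdifferentiableAt_proj_curve hη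
  have hη' := differentiableAt_trivializationAt hη hb
  have hζ' := differentiableAt_trivializationAt hζ hb
  have hev : (fun s => (trivializationAt F V (σ t) ⟨σ s, g s • η s + h s • ζ s⟩).2) =ᶠ[𝓝 t]
      fun s => g s • (trivializationAt F V (σ t) ⟨σ s, η s⟩).2 +
        h s • (trivializationAt F V (σ t) ⟨σ s, ζ s⟩).2 := by
    filter_upwards [eventually_mem_baseSet hσ hb] with s hs
    simp only [← (trivializationAt F V (σ t)).continuousLinearMapAt_apply_of_mem ℝ hs, map_add,
      map_smul]
  have hd := (hg.smul hη'.hasDerivAt).add (hh.smul hζ'.hasDerivAt)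
  have hd' := hd.congr_of_eventuallyEq hev
  have hm : MDifferentiableAt 𝓘(ℝ, ℝ) (I.prod 𝓘(ℝ, F))
      (sectionCurve F σ (fun s => g s • η s + h s • ζ s)) t :=
    (mdifferentiableAt_sectionCurve_iff hb).2 ⟨hσ, hd'.differentiableAt⟩
  refine ⟨hm, eq_of_trivializationAt_eq hb ?_⟩
  have hc := mem_chart_source H (σ t)
  have e1 := trivializationAt_covAlong cov hm hc hb
  have e2 := trivializationAt_covAlong cov hη hc hb
  have e3 := trivializationAt_covAlong cov hζ hc hb
  rw [hd'.deriv] at e1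
  refine e1.trans ?_
  simp only [← (trivializationAt F V (σ t)).continuousLinearMapAt_apply_of_mem ℝ hb, map_add,
    map_smul] at e2 e3 ⊢
  rw [e2, e3]
  simp only [smul_add]
  abel

theorem isACOn_smul_add_smul (hab : a ≤ b)
    (hη : IsACOn (I.prod 𝓘(ℝ, F)) (sectionCurve F σ η) a b)
    (hζ : IsACOn (I.prod 𝓘(ℝ, F)) (sectionCurve F σ ζ) a b)
    {g h : ℝ → ℝ} (hg : AbsolutelyContinuousOnInterval g a b)
    (hh : AbsolutelyContinuousOnInterval h a b) :
    IsACOn (I.prod 𝓘(ℝ, F)) (sectionCurve F σ (fun s => g s • η s + h s • ζ s)) a b := by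
  have hσ : IsACOn I σ a b := hη.proj
  refine isACOn_totalSpace_of_locallyACAt hab hσ fun t ht => ⟨σ t, ⟨mem_chart_source H _, ?_⟩, ?_⟩
  · exact FiberBundle.mem_baseSet_trivializationAt' (F := F) (E := V) (σ t)
  have hb := FiberBundle.mem_baseSet_trivializationAt' (F := F) (E := V) (σ t)
  obtain ⟨u, hu, h1⟩ := hη.locallyACAt_trivializationAt hab ht hb
  obtain ⟨v, hv, h2⟩ := hζ.locallyACAt_trivializationAt hab ht hb
  have hcont := hσ.1
  rw [uIcc_of_le hab] at hcont
  have hev := ContinuousOn.eventually_mem_of_Icc hcont ht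
    ((trivializationAt F V (σ t)).open_baseSet.mem_nhds hb)
  have : LocallyACAt (fun s => g s • (trivializationAt F V (σ t) ⟨σ s, η s⟩).2 +
        h s • (trivializationAt F V (σ t) ⟨σ s, ζ s⟩).2) a b t := by
    refine ⟨u ∩ v, Filter.inter_mem hu hv, fun c d hc hcd hd hsub => ?_⟩
    have hm : uIcc c d ⊆ uIcc a b := by
      rw [uIcc_of_le hcd, uIcc_of_le hab]
      exact Icc_subset_Icc hc hd
    exact ((hg.mono hm).smul (h1 c d hc hcd hd (hsub.trans inter_subset_left))).add
      ((hh.mono hm).smul (h2 c d hc hcd hd (hsub.trans inter_subset_right)))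
  refine this.congr ?_
  filter_upwards [hev] with s hs hsab
  simp only [← (trivializationAt F V (σ t)).continuousLinearMapAt_apply_of_mem ℝ (hs hsab), map_add,
    map_smul]

theorem isACOn_sub (hab : a ≤ b)
    (hη : IsACOn (I.prod 𝓘(ℝ, F)) (sectionCurve F σ η) a b)
    (hζ : IsACOn (I.prod 𝓘(ℝ, F)) (sectionCurve F σ ζ) a b) :
    IsACOn (I.prod 𝓘(ℝ, F)) (sectionCurve F σ (fun s => η s - ζ s)) a b := by
  have hconst : ∀ c : ℝ, AbsolutelyContinuousOnInterval (fun _ : ℝ => c) a b := fun c =>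
    (LipschitzOnWith.absolutelyContinuousOnInterval
      ((LipschitzWith.const c).lipschitzOnWith (s := uIcc a b)))
  have := isACOn_smul_add_smul hab hη hζ (hconst 1) (hconst (-1))
  simpa [sub_eq_add_neg] using this

theorem covAlong_sub
    (hη : MDifferentiableAt 𝓘(ℝ, ℝ) (I.prod 𝓘(ℝ, F)) (sectionCurve F σ η) t)
    (hζ : MDifferentiableAt 𝓘(ℝ, ℝ) (I.prod 𝓘(ℝ, F)) (sectionCurve F σ ζ) t) :
    MDifferentiableAt 𝓘(ℝ, ℝ) (I.prod 𝓘(ℝ, F)) (sectionCurve F σ fun s => η s - ζ s) t ∧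
    (covAlong cov (sectionCurve F σ (fun s => η s - ζ s)) t : V (σ t)) =
      (covAlong cov (sectionCurve F σ η) t : V (σ t)) -
        (covAlong cov (sectionCurve F σ ζ) t : V (σ t)) := by
  have h1 : (fun s => η s - ζ s) = fun s => (1 : ℝ) • η s + (-1 : ℝ) • ζ s := by
    ext s; simp [sub_eq_add_neg]
  have := (covAlong_smul_add_smul cov hη hζ (hasDerivAt_const t 1) (hasDerivAt_const t (-1)))
  rw [h1]
  refine ⟨this.1, this.2.trans ?_⟩
  simp [sub_eq_add_neg]

theorem covAlong_congr (h : ∀ᶠ s in 𝓝 t, η s = ζ s) :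
    (covAlong cov (sectionCurve F σ η) t : V (σ t)) = covAlong cov (sectionCurve F σ ζ) t := by
  have h1 : η t = ζ t := h.self_of_nhds
  have h2 : (velocity (I.prod 𝓘(ℝ, F)) (sectionCurve F σ η) t : E × F) =
      velocity (I.prod 𝓘(ℝ, F)) (sectionCurve F σ ζ) t := by
    have h3 : sectionCurve F σ η =ᶠ[𝓝 t] sectionCurve F σ ζ := by
      filter_upwards [h] with s hs
      simp only [sectionCurve, hs]
    exact congrArg (fun L : ℝ →L[ℝ] E × F => L 1) h3.mfderiv_eq
  change connector cov (⟨σ t, η t⟩ : TotalSpace F V)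
      (velocity (I.prod 𝓘(ℝ, F)) (sectionCurve F σ η) t : E × F) =
    connector cov (⟨σ t, ζ t⟩ : TotalSpace F V)
      (velocity (I.prod 𝓘(ℝ, F)) (sectionCurve F σ ζ) t : E × F)
  rw [h2]
  generalize (velocity (I.prod 𝓘(ℝ, F)) (sectionCurve F σ ζ) t : E × F) = w
  rw [h1]

variable [IsContMDiffRiemannianBundle I ∞ F V]

/-- The norm along a curve in a vector bundle with a metric covariant derivative changes by at most
the integral of the norm of the covariant derivative. -/
theorem enorm_le_add_lintegral_covAlong (hcov : cov.IsMetricCompatible) (hab : a ≤ b)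
    (hξ : IsACOn (I.prod 𝓘(ℝ, F)) ξ a b) :
    ‖(ξ b).2‖ₑ ≤ ‖(ξ a).2‖ₑ + ∫⁻ t in Icc a b, ‖covAlong cov ξ t‖ₑ ∧
    ‖(ξ a).2‖ₑ ≤ ‖(ξ b).2‖ₑ + ∫⁻ t in Icc a b, ‖covAlong cov ξ t‖ₑ := by
  -- The norm is not differentiable on the zero section, whereas `√(|e| ^ 2 + ε)` is smooth.
  have key : ∀ ε > (0 : ℝ), ‖√(‖(ξ b).2‖ ^ 2 + ε) - √(‖(ξ a).2‖ ^ 2 + ε)‖ₑ ≤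
      ∫⁻ t in Icc a b, ‖covAlong cov ξ t‖ₑ := by
    intro ε hε
    have hpos : ∀ e : TotalSpace F V, 0 < inner ℝ e.2 e.2 + ε := fun e => by
      rw [real_inner_self_eq_norm_sq]; positivity
    have hsm : ContMDiff (I.prod 𝓘(ℝ, F)) 𝓘(ℝ, ℝ) 1
        (fun e : TotalSpace F V => √(inner ℝ e.2 e.2 + ε)) := by
      intro e
      have h1 : ContDiffAt ℝ 1 (fun x : ℝ => √(x + ε)) (inner ℝ e.2 e.2) :=
        (contDiffAt_id.add contDiffAt_const).sqrt (hpos e).ne'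
      exact h1.contMDiffAt.comp (g := fun x : ℝ => √(x + ε)) e
        ((contMDiff_inner_self (I := I)).of_le (m := 1) (by simp)).contMDiffAt
    have hac := hξ.comp_real (G := fun e : TotalSpace F V => √(inner ℝ e.2 e.2 + ε))
      fun t _ => hsm.contMDiffAt
    have h2 := enorm_sub_le_lintegral_deriv hab hac
    simp only [real_inner_self_eq_norm_sq] at h2
    refine h2.trans (setLIntegral_mono_ae' measurableSet_Icc ?_)
    rw [← uIcc_of_le hab]
    filter_upwards [hξ.ae_mdifferentiableAt] with t ht htab
    have hd := hasDerivAt_comp_curve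
      ((contMDiff_inner_self (I := I) (V := V)).mdifferentiable (by simp) (ξ t)) (ht htab)
    rw [mvfderiv_inner_self cov hcov] at hd
    have hd' := ((hd.add_const ε).sqrt (hpos _).ne').deriv
    simp only [real_inner_self_eq_norm_sq] at hd'
    rw [hd', mul_div_mul_left _ _ two_ne_zero, enorm_le_iff_norm_le, Real.norm_eq_abs, abs_div,
      abs_of_pos (Real.sqrt_pos.2 (show (0 : ℝ) < ‖(ξ t).2‖ ^ 2 + ε by positivity)),
      div_le_iff₀ (Real.sqrt_pos.2 (by positivity)), mul_comm]
    refine (abs_real_inner_le_norm _ _).trans ?_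
    exact mul_le_mul_of_nonneg_right (Real.le_sqrt_of_sq_le (by linarith)) (norm_nonneg _)
  constructor
  · have := ofReal_le_add_of_forall_sqrt (norm_nonneg _) key
    simpa only [ofReal_norm] using this
  · have := ofReal_le_add_of_forall_sqrt (norm_nonneg _) fun ε hε => by
      rw [← enorm_neg, neg_sub]; exact key ε hε
    simpa only [ofReal_norm] using this

end CovAlong

/-! ### Parallel sections along absolutely continuous curves -/

section Parallel

variable {E : Type*} [NormedAddCommGroup E] [NormedSpace ℝ E] [FiniteDimensional ℝ E]
  {H : Type*} [TopologicalSpace H] {I : ModelWithCorners ℝ E H} [I.Boundaryless]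
  {M : Type*} [TopologicalSpace M] [ChartedSpace H M] [IsManifold I ∞ M]
  {F : Type*} [NormedAddCommGroup F] [NormedSpace ℝ F] [FiniteDimensional ℝ F]
  {V : M → Type*} [TopologicalSpace (TotalSpace F V)]
  [∀ x, NormedAddCommGroup (V x)] [∀ x, InnerProductSpace ℝ (V x)]
  [FiberBundle F V] [VectorBundle ℝ F V] [ContMDiffVectorBundle ∞ F V I]
  (cov : CovariantDerivative I F V)
  {σ : ℝ → M} {η ζ : ∀ t, V (σ t)} {ξ : ℝ → TotalSpace F V} {a b c t₀ : ℝ}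

theorem IsParallelOn.symm (h : IsParallelOn cov σ η a b) : IsParallelOn cov σ η b a :=
  ⟨h.1.symm, by simpa only [uIcc_comm a b] using h.2⟩

theorem IsParallelOn.mono (h : IsParallelOn cov σ η a b) {a' b' : ℝ}
    (hsub : uIcc a' b' ⊆ uIcc a b) : IsParallelOn cov σ η a' b' :=
  ⟨h.1.mono hsub, h.2.mono fun _ ht hm => ht (hsub hm)⟩

theorem ae_ne_and_ne (a b : ℝ) : ∀ᵐ t : ℝ, t ≠ a ∧ t ≠ b := by
  rw [Filter.eventually_and]
  constructor <;> simp [ae_iff, measure_singleton]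

theorem IsParallelOn.congr (h : IsParallelOn cov σ η a b) (hab : a ≤ b)
    (heq : ∀ t ∈ Icc a b, ζ t = η t) : IsParallelOn cov σ ζ a b := by
  rw [← uIcc_of_le hab] at heq
  refine ⟨h.1.congr fun t ht => ?_, ?_⟩
  · simp only [heq t ht]
  · filter_upwards [h.2, ae_ne_and_ne a b] with t ht hne htm
    rw [uIcc_of_le hab] at heq htm
    refine (covAlong_congr (η := ζ) (ζ := η) cov ?_).trans (ht (by rwa [uIcc_of_le hab]))
    filter_upwards [Icc_mem_nhds (lt_of_le_of_ne htm.1 hne.1.symm) (lt_of_le_of_ne htm.2 hne.2)]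
      with s hs using heq s hs

theorem IsParallelOn.trans (hab : a ≤ b) (hbc : b ≤ c) (h₁ : IsParallelOn cov σ η a b)
    (h₂ : IsParallelOn cov σ η b c) : IsParallelOn cov σ η a c := by
  refine ⟨h₁.1.trans hab hbc h₂.1, ?_⟩
  filter_upwards [h₁.2, h₂.2] with t ht1 ht2 ht
  rw [uIcc_of_le (hab.trans hbc)] at ht
  rcases le_total t b with h | h
  · exact ht1 (by rw [uIcc_of_le hab]; exact ⟨ht.1, h⟩)
  · exact ht2 (by rw [uIcc_of_le hbc]; exact ⟨h, ht.2⟩)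

theorem exists_isParallelOn_glue (hab : a ≤ b) (hbc : b ≤ c) (h₁ : IsParallelOn cov σ η a b)
    (h₂ : IsParallelOn cov σ ζ b c) (heq : η b = ζ b) :
    ∃ θ : ∀ t, V (σ t), IsParallelOn cov σ θ a c ∧ (∀ t ∈ Icc a b, θ t = η t) ∧
      ∀ t ∈ Icc b c, θ t = ζ t := by
  classical
  have e1 : ∀ t ∈ Icc a b, (if t ≤ b then η t else ζ t) = η t := fun t ht => if_pos ht.2
  have e2 : ∀ t ∈ Icc b c, (if t ≤ b then η t else ζ t) = ζ t := by
    intro t ht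
    rcases ht.1.eq_or_lt with rfl | h
    · rw [if_pos le_rfl, heq]
    · exact if_neg h.not_ge
  exact ⟨fun t => if t ≤ b then η t else ζ t,
    (h₁.congr cov hab e1).trans cov hab hbc (h₂.congr cov hbc e2), e1, e2⟩

variable [T2Space M] [cov.ContMDiffCovariantDerivative ∞]

/-- Local existence of parallel sections: in a trivialization, the equation is linear, with an
integrable coefficient. -/
theorem exists_isParallelOn_nhds (hab : a ≤ b) (hσ : IsACOn I σ a b) (ht₀ : t₀ ∈ Icc a b) :
    ∃ u ∈ 𝓝 t₀, ∀ c d, a ≤ c → c ≤ d → d ≤ b → Icc c d ⊆ u → ∀ t₁ ∈ Icc c d, ∀ e : V (σ t₁),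
      ∃ η : ∀ t, V (σ t), IsParallelOn cov σ η c d ∧ η t₁ = e := by
  set p := σ t₀ with hp
  have hcont := hσ.1
  rw [uIcc_of_le hab] at hcont
  have hev : ∀ᶠ x in 𝓝 p, ContinuousAt (christoffel cov p) x ∧ x ∈ (chartAt H p).source ∧
      x ∈ (trivializationAt F V p).baseSet :=
    (eventually_continuousAt_christoffel cov p).and
      (((chartAt H p).open_source.eventually_mem (mem_chart_source H p)).and
        ((trivializationAt F V p).open_baseSet.eventually_mem
          (FiberBundle.mem_baseSet_trivializationAt' (F := F) (E := V) p)))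
  have hev' := ContinuousOn.eventually_mem_of_Icc hcont ht₀ hev
  obtain ⟨u₁, hu₁, hac⟩ := hσ.locallyACAt_extChartAt hab ht₀ (mem_extChartAt_source p)
  obtain ⟨c₀, d₀, hac₀, hc₀d₀, hd₀b, ht₀', hsub, hnear⟩ :=
    exists_Icc_subset_of_mem_nhds (Filter.inter_mem hu₁ hev') ht₀
  have hu := hac c₀ d₀ hac₀ hc₀d₀ hd₀b (hsub.trans inter_subset_left)
  have hgood : ∀ t ∈ Icc c₀ d₀, ContinuousAt (christoffel cov p) (σ t) ∧
      σ t ∈ (chartAt H p).source ∧ σ t ∈ (trivializationAt F V p).baseSet := fun t ht =>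
    (hsub ht).2 ⟨hac₀.trans ht.1, ht.2.trans hd₀b⟩
  have hsub₀ : Icc c₀ d₀ ⊆ Icc a b := Icc_subset_Icc hac₀ hd₀b
  -- The coefficient of the equation of parallel sections in the trivialization at `p`.
  set A : ℝ → F →L[ℝ] F := fun t =>
    christoffel cov p (σ t) (deriv (fun s => extChartAt I p (σ s)) t)
  have hΓ : ContinuousOn (fun t => christoffel cov p (σ t)) (Icc c₀ d₀) := fun t ht =>
    (hgood t ht).1.comp_continuousWithinAt ((hcont t (hsub₀ ht)).mono hsub₀)
  have hA : IntegrableOn A (Icc c₀ d₀) := by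
    have hu' := hu.intervalIntegrable_deriv'
    rw [intervalIntegrable_iff_integrableOn_Icc_of_le hc₀d₀] at hu'
    exact IntegrableOn.clm_apply_of_continuousOn hΓ hu'
  have hprim : ContinuousWithinAt (fun t => ∫ s in c₀..t, ‖A s‖) (Icc c₀ d₀) t₀ := by
    have := intervalIntegral.continuousOn_primitive_interval (f := fun s => ‖A s‖)
      (a := c₀) (b := d₀) (by rw [uIcc_of_le hc₀d₀]; exact hA.norm)
    rw [uIcc_of_le hc₀d₀] at this
    exact this t₀ ht₀'
  have hsmall : ∀ᶠ t in 𝓝 t₀, t ∈ Icc c₀ d₀ →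
      |(∫ s in c₀..t, ‖A s‖) - ∫ s in c₀..t₀, ‖A s‖| < 1 / 4 := by
    have := Metric.continuousWithinAt_iff'.1 hprim (1 / 4) (by norm_num)
    exact eventually_nhdsWithin_iff.1 this
  refine ⟨_, Filter.inter_mem hnear hsmall, fun c d hc hcd hd hsubcd t₁ ht₁ e => ?_⟩
  have hmem : ∀ t ∈ Icc c d, t ∈ Icc c₀ d₀ := fun t ht =>
    (hsubcd ht).1 ⟨hc.trans ht.1, ht.2.trans hd⟩
  have hc' := hmem c (left_mem_Icc.2 hcd)
  have hd' := hmem d (right_mem_Icc.2 hcd)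
  have hAi : ∀ s ∈ Icc c₀ d₀, ∀ t ∈ Icc c₀ d₀, IntervalIntegrable A volume s t := fun s hs t ht =>
    (hA.mono_set (uIcc_subset_Icc hs ht)).intervalIntegrable
  have hhalf : ∫ t in c..d, ‖A t‖ ≤ 1 / 2 := by
    have h1 := abs_lt.1 ((hsubcd (left_mem_Icc.2 hcd)).2 hc')
    have h2 := abs_lt.1 ((hsubcd (right_mem_Icc.2 hcd)).2 hd')
    have h3 := intervalIntegral.integral_add_adjacent_intervals
      (hAi c₀ (left_mem_Icc.2 hc₀d₀) c hc').norm (hAi c hc' d hd').norm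
    linarith [h1.1, h2.2]
  obtain ⟨y, hy, hyt₁, hyd⟩ := exists_linear_ode_solution hcd (hAi c hc' d hd') hhalf ht₁
    (trivializationAt F V p ⟨σ t₁, e⟩).2
  have hσcd : IsACOn I σ c d := hσ.mono (by
    rw [uIcc_of_le hcd, uIcc_of_le hab]; exact Icc_subset_Icc hc hd)
  have hcontcd := hσcd.1
  rw [uIcc_of_le hcd] at hcontcd
  refine ⟨fun t => constSection F V p (y t) (σ t), ⟨?_, ?_⟩, ?_⟩
  · refine isACOn_totalSpace_of_locallyACAt hcd hσcd fun t ht => ⟨p, (hgood t (hmem t ht)).2, ?_⟩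
    refine (hy.locallyACAt t).congr ?_
    filter_upwards [ContinuousOn.eventually_mem_of_Icc hcontcd ht
      ((trivializationAt F V p).open_baseSet.mem_nhds (hgood t (hmem t ht)).2.2)] with s hs hsm
    exact trivializationAt_constSection (hs hsm) _
  · filter_upwards [hyd, hσcd.ae_mdifferentiableAt] with t h1 h2 ht
    obtain ⟨-, hg1, hg2⟩ := hgood t (hmem t (by rwa [uIcc_of_le hcd] at ht))
    have hev2 : (fun s => (trivializationAt F V p ⟨σ s, constSection F V p (y s) (σ s)⟩).2)
        =ᶠ[𝓝 t] y := by
      filter_upwards [eventually_mem_baseSet (h2 ht) hg2] with s hs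
      exact trivializationAt_constSection hs _
    have hder := (h1 ht).congr_of_eventuallyEq hev2
    have hm : MDifferentiableAt 𝓘(ℝ, ℝ) (I.prod 𝓘(ℝ, F))
        (sectionCurve F σ fun s => constSection F V p (y s) (σ s)) t :=
      (mdifferentiableAt_sectionCurve_iff hg2).2 ⟨h2 ht, hder.differentiableAt⟩
    refine eq_of_trivializationAt_eq hg2 ?_
    refine (trivializationAt_covAlong cov hm hg1 hg2).trans ?_
    rw [hder.deriv, trivializationAt_constSection hg2,
      ← (trivializationAt F V p).continuousLinearMapAt_apply_of_mem ℝ hg2, map_zero]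
    exact neg_add_cancel _
  · simp only [hyt₁]
    exact constSection_trivializationAt (e := (⟨σ t₁, e⟩ : TotalSpace F V))
      (hgood t₁ (hmem t₁ ht₁)).2.2

/-- Existence of parallel sections along absolutely continuous curves. -/
theorem exists_isParallelOn (hab : a ≤ b) (hσ : IsACOn I σ a b) {t₁ : ℝ} (ht₁ : t₁ ∈ Icc a b)
    (e : V (σ t₁)) : ∃ η : ∀ t, V (σ t), IsParallelOn cov σ η a b ∧ η t₁ = e := by
  refine interval_induction (P := fun c d => ∀ t₁ ∈ Icc c d, ∀ e : V (σ t₁),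
      ∃ η : ∀ t, V (σ t), IsParallelOn cov σ η c d ∧ η t₁ = e) hab
    (fun t ht => exists_isParallelOn_nhds cov hab hσ ht) ?_ t₁ ht₁ e
  intro c d e _ hcd hde _ h1 h2 t₁ ht₁ v
  rcases le_total t₁ d with h | h
  · obtain ⟨η, hη, rfl⟩ := h1 t₁ ⟨ht₁.1, h⟩ v
    obtain ⟨ζ, hζ, hζd⟩ := h2 d (left_mem_Icc.2 hde) (η d)
    obtain ⟨θ, hθ, e1, -⟩ := exists_isParallelOn_glue cov hcd hde hη hζ hζd.symm
    exact ⟨θ, hθ, e1 t₁ ⟨ht₁.1, h⟩⟩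
  · obtain ⟨ζ, hζ, rfl⟩ := h2 t₁ ⟨h, ht₁.2⟩ v
    obtain ⟨η, hη, hηd⟩ := h1 d (right_mem_Icc.2 hcd) (ζ d)
    obtain ⟨θ, hθ, -, e2⟩ := exists_isParallelOn_glue cov hcd hde hη hζ hηd
    exact ⟨θ, hθ, e2 t₁ ⟨h, ht₁.2⟩⟩

end Parallel

section Transport

variable {E : Type*} [NormedAddCommGroup E] [NormedSpace ℝ E] [FiniteDimensional ℝ E]
  {H : Type*} [TopologicalSpace H] {I : ModelWithCorners ℝ E H} [I.Boundaryless]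
  {M : Type*} [TopologicalSpace M] [ChartedSpace H M] [IsManifold I ∞ M]
  {F : Type*} [NormedAddCommGroup F] [NormedSpace ℝ F] [FiniteDimensional ℝ F]
  {V : M → Type*} [TopologicalSpace (TotalSpace F V)]
  [∀ x, NormedAddCommGroup (V x)] [∀ x, InnerProductSpace ℝ (V x)]
  [FiberBundle F V] [VectorBundle ℝ F V] [ContMDiffVectorBundle ∞ F V I]
  (cov : CovariantDerivative I F V)
  [IsContMDiffRiemannianBundle I ∞ F V]
  {σ : ℝ → M} {η ζ : ∀ t, V (σ t)} {ξ : ℝ → TotalSpace F V} {a b c t₀ : ℝ}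

/-- The distance between a section along a curve and a parallel section changes by at most the
integral of the norm of the covariant derivative. -/
theorem enorm_sub_le_add_lintegral_covAlong (hcov : cov.IsMetricCompatible) (hab : a ≤ b)
    (hη : IsParallelOn cov σ η a b) (hζ : IsACOn (I.prod 𝓘(ℝ, F)) (sectionCurve F σ ζ) a b) :
    ‖ζ b - η b‖ₑ ≤ ‖ζ a - η a‖ₑ +
      ∫⁻ t in Icc a b, ‖(covAlong cov (sectionCurve F σ ζ) t : V (σ t))‖ₑ ∧
    ‖ζ a - η a‖ₑ ≤ ‖ζ b - η b‖ₑ +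
      ∫⁻ t in Icc a b, ‖(covAlong cov (sectionCurve F σ ζ) t : V (σ t))‖ₑ := by
  have hac := isACOn_sub hab hζ hη.1
  have h := enorm_le_add_lintegral_covAlong cov hcov hab hac
  have hle : ∫⁻ t in Icc a b,
      ‖(covAlong cov (sectionCurve F σ (fun s => ζ s - η s)) t : V (σ t))‖ₑ ≤
        ∫⁻ t in Icc a b, ‖(covAlong cov (sectionCurve F σ ζ) t : V (σ t))‖ₑ := by
    refine setLIntegral_mono_ae' measurableSet_Icc ?_
    rw [← uIcc_of_le hab]
    filter_upwards [hζ.ae_mdifferentiableAt, hη.1.ae_mdifferentiableAt, hη.2] with t h1 h2 h3 ht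
    have h4 : (covAlong cov (sectionCurve F σ η) t : V (σ t)) = 0 := h3 ht
    rw [(covAlong_sub cov (h1 ht) (h2 ht)).2, h4, sub_zero]
  exact ⟨h.1.trans (add_le_add_right hle _), h.2.trans (add_le_add_right hle _)⟩

theorem lintegral_covAlong_eq_zero (hab : a ≤ b) (hη : IsParallelOn cov σ η a b) :
    ∫⁻ t in Icc a b, ‖(covAlong cov (sectionCurve F σ η) t : V (σ t))‖ₑ = 0 := by
  rw [← nonpos_iff_eq_zero, ← lintegral_zero (μ := volume.restrict (Icc a b))]
  refine setLIntegral_mono_ae' measurableSet_Icc ?_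
  rw [← uIcc_of_le hab]
  filter_upwards [hη.2] with t h3 ht
  have h4 : (covAlong cov (sectionCurve F σ η) t : V (σ t)) = 0 := h3 ht
  rw [h4, enorm_zero]

/-- Parallel translation is isometric. -/
theorem IsParallelOn.enorm_sub_eq (hcov : cov.IsMetricCompatible)
    (hη : IsParallelOn cov σ η a b) (hζ : IsParallelOn cov σ ζ a b) :
    ‖ζ a - η a‖ₑ = ‖ζ b - η b‖ₑ := by
  wlog hab : a ≤ b generalizing a b
  · exact (this hη.symm hζ.symm (le_of_not_ge hab)).symm
  have h := enorm_sub_le_add_lintegral_covAlong cov hcov hab hη hζ.1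
  rw [lintegral_covAlong_eq_zero cov hab hζ, add_zero, add_zero] at h
  exact le_antisymm h.2 h.1

theorem IsParallelOn.enorm_eq (hcov : cov.IsMetricCompatible)
    (hη : IsParallelOn cov σ η a b) : ‖η a‖ₑ = ‖η b‖ₑ := by
  wlog hab : a ≤ b generalizing a b
  · exact (this hη.symm (le_of_not_ge hab)).symm
  have h := enorm_le_add_lintegral_covAlong cov hcov hab hη.1
  rw [lintegral_covAlong_eq_zero cov hab hη, add_zero, add_zero] at h
  exact le_antisymm h.2 h.1

theorem IsParallelOn.parallelTransport_eq (hcov : cov.IsMetricCompatible)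
    (hη : IsParallelOn cov σ η a b) : parallelTransport cov σ a b (η a) = η b := by
  have hex : ∃ θ : ∀ t, V (σ t), IsParallelOn cov σ θ a b ∧ θ a = η a := ⟨η, hη, rfl⟩
  rw [parallelTransport, dif_pos hex]
  have h := IsParallelOn.enorm_sub_eq cov hcov hη hex.choose_spec.1
  rw [hex.choose_spec.2, sub_self, enorm_zero] at h
  exact sub_eq_zero.1 (enorm_eq_zero.1 h.symm)

end Transport

/-! ### Lengths of curves in the base -/

theorem isContinuousRiemannianBundle {E : Type*} [NormedAddCommGroup E] [NormedSpace ℝ E]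
    {H : Type*} [TopologicalSpace H] {I : ModelWithCorners ℝ E H}
    {M : Type*} [TopologicalSpace M] [ChartedSpace H M]
    (F : Type*) [NormedAddCommGroup F] [NormedSpace ℝ F]
    (V : M → Type*) [TopologicalSpace (TotalSpace F V)]
    [∀ x, NormedAddCommGroup (V x)] [∀ x, InnerProductSpace ℝ (V x)]
    [FiberBundle F V] [VectorBundle ℝ F V] [IsContMDiffRiemannianBundle I ∞ F V] :
    IsContinuousRiemannianBundle F V := by
  obtain ⟨g, hg, h⟩ := IsContMDiffRiemannianBundle.exists_contMDiff (IB := I) (n := ∞) (F := F)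
    (E := V)
  exact ⟨g, hg.continuous, h⟩

section

variable {E : Type*} [NormedAddCommGroup E] [NormedSpace ℝ E] {H : Type*} [TopologicalSpace H]
  {M : Type*} [TopologicalSpace M] [ChartedSpace H M]
  {F : Type*} [NormedAddCommGroup F] [NormedSpace ℝ F] [FiniteDimensional ℝ F]
  {V : M → Type*} [TopologicalSpace (TotalSpace F V)]
  [∀ x, NormedAddCommGroup (V x)] [∀ x, InnerProductSpace ℝ (V x)]
  [FiberBundle F V] [VectorBundle ℝ F V]

theorem continuousAt_inner_constSection (I : ModelWithCorners ℝ E H) [I.Boundaryless]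
    [IsManifold I ∞ M] [ContMDiffVectorBundle ∞ F V I] [IsContMDiffRiemannianBundle I ∞ F V]
    {p x : M} (hx : x ∈ (trivializationAt F V p).baseSet)
    (y z : F) : ContinuousAt
      (fun x => (inner ℝ (constSection F V p y x) (constSection F V p z x) : ℝ)) x := by
  have : ContMDiffAt I 𝓘(ℝ, ℝ) 1
      (fun x => (inner ℝ (constSection F V p y x) (constSection F V p z x) : ℝ)) x :=
    ((contMDiffAt_constSection (I := I) hx y).of_le (by simp)).inner_bundle
      ((contMDiffAt_constSection hx z).of_le (by simp))
  exact this.continuousAt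

end

section BaseLength

variable {E : Type*} [NormedAddCommGroup E] [NormedSpace ℝ E] [FiniteDimensional ℝ E]
  {H : Type*} [TopologicalSpace H] {I : ModelWithCorners ℝ E H} [I.Boundaryless]
  {M : Type*} [TopologicalSpace M] [ChartedSpace H M] [IsManifold I ∞ M]
  [RiemannianBundle (fun x : M => TangentSpace I x)]
  [IsContMDiffRiemannianBundle I ∞ E (fun x : M => TangentSpace I x)]
  {σ : ℝ → M} {a b : ℝ}

theorem velocity_eq_constSection {p : M} {t : ℝ} (hσ : MDifferentiableAt 𝓘(ℝ, ℝ) I σ t)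
    (hp : σ t ∈ (chartAt H p).source) :
    velocity I σ t = constSection E (fun x : M => TangentSpace I x) p
      (deriv (fun s => extChartAt I p (σ s)) t) (σ t) := by
  rw [(hasDerivAt_comp_curve (mdifferentiableAt_extChartAt hp) hσ).deriv]
  have h1 := TangentBundle.continuousLinearMapAt_trivializationAt (𝕜 := ℝ) (I := I) hp
  have h2 := (trivializationAt E (TangentSpace I : M → Type _) p).symmL_continuousLinearMapAt
    (R := ℝ) (b := σ t) (by simpa using hp) (velocity I σ t)
  rw [h1] at h2
  exact h2.symm

/-- The squared norm in coordinates; the coefficients of this quadratic form depend continuously on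
the point, which makes the speed of a curve measurable. -/
theorem norm_sq_constSection (p x : M) (w : E) :
    ‖constSection E (fun x : M => TangentSpace I x) p w x‖ ^ 2 =
      ∑ i, ∑ j, (Module.finBasis ℝ E).coord i w * ((Module.finBasis ℝ E).coord j w *
        inner ℝ (constSection E (fun x : M => TangentSpace I x) p (Module.finBasis ℝ E i) x)
          (constSection E (fun x : M => TangentSpace I x) p (Module.finBasis ℝ E j) x)) := by
  have h : constSection E (fun x : M => TangentSpace I x) p w x = ∑ i,
      (Module.finBasis ℝ E).coord i w •
        constSection E (fun x : M => TangentSpace I x) p (Module.finBasis ℝ E i) x := by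
    conv_lhs => rw [← (Module.finBasis ℝ E).sum_repr w]
    simp only [constSection, map_sum, map_smul]
    rfl
  rw [← real_inner_self_eq_norm_sq, h, sum_inner]
  simp only [inner_sum, real_inner_smul_left, real_inner_smul_right]
  exact Finset.sum_congr rfl fun i _ => Finset.sum_congr rfl fun j _ => by ring

theorem integrableOn_norm_velocity (hab : a ≤ b) (hσ : IsACOn I σ a b) :
    IntegrableOn (fun t => ‖velocity I σ t‖) (Icc a b) := by
  have hcont := hσ.1
  rw [uIcc_of_le hab] at hcont
  refine interval_induction (P := fun c d => IntegrableOn (fun t => ‖velocity I σ t‖) (Icc c d)) hab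
    (fun t₀ ht₀ => ?_) fun c d e _ hcd hde _ h1 h2 => ?_
  swap
  · rw [← Icc_union_Icc_eq_Icc hcd hde]
    exact h1.union h2
  set p := σ t₀
  have := isContinuousRiemannianBundle (I := I) E (fun x : M => TangentSpace I x)
  obtain ⟨K, hK, hKev⟩ := eventually_norm_symmL_trivializationAt_lt E
    (fun x : M => TangentSpace I x) p
  have hev' := ContinuousOn.eventually_mem_of_Icc hcont ht₀
    (hKev.and ((chartAt H p).open_source.eventually_mem (mem_chart_source H p)))
  obtain ⟨u₁, hu₁, hac⟩ := hσ.locallyACAt_extChartAt hab ht₀ (mem_extChartAt_source p)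
  refine ⟨_, Filter.inter_mem hu₁ hev', fun c d hc hcd hd hsub => ?_⟩
  have hgood : ∀ t ∈ Icc c d,
      ‖(trivializationAt E (fun x : M => TangentSpace I x) p).symmL ℝ (σ t)‖ < K ∧
      σ t ∈ (chartAt H p).source := fun t ht => (hsub ht).2 ⟨hc.trans ht.1, ht.2.trans hd⟩
  have hcd' : Icc c d ⊆ Icc a b := Icc_subset_Icc hc hd
  have hu' := (hac c d hc hcd hd (hsub.trans inter_subset_left)).intervalIntegrable_deriv'
  rw [intervalIntegrable_iff_integrableOn_Icc_of_le hcd] at hu'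
  have hσcd : IsACOn I σ c d := hσ.mono (by rwa [uIcc_of_le hcd, uIcc_of_le hab])
  have hae : ∀ᵐ t ∂(volume.restrict (Icc c d)), velocity I σ t =
      constSection E (fun x : M => TangentSpace I x) p
        (deriv (fun s => extChartAt I p (σ s)) t) (σ t) := by
    rw [ae_restrict_iff' measurableSet_Icc, ← uIcc_of_le hcd]
    filter_upwards [hσcd.ae_mdifferentiableAt] with t ht htm
    exact velocity_eq_constSection (ht htm) (hgood t (by rwa [uIcc_of_le hcd] at htm)).2
  refine Integrable.mono' (hu'.norm.const_mul K) ?_ ?_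
  · have h1 : AEStronglyMeasurable (fun t => √(∑ i, ∑ j,
        (Module.finBasis ℝ E).coord i (deriv (fun s => extChartAt I p (σ s)) t) *
        ((Module.finBasis ℝ E).coord j (deriv (fun s => extChartAt I p (σ s)) t) *
        inner ℝ (constSection E (fun x : M => TangentSpace I x) p (Module.finBasis ℝ E i) (σ t))
          (constSection E (fun x : M => TangentSpace I x) p (Module.finBasis ℝ E j) (σ t)))))
        (volume.restrict (Icc c d)) := by
      refine Real.continuous_sqrt.comp_aestronglyMeasurable ?_
      have hcoord : ∀ i, AEStronglyMeasurable (fun t => (Module.finBasis ℝ E).coord i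
          (deriv (fun s => extChartAt I p (σ s)) t)) (volume.restrict (Icc c d)) := fun i =>
        (LinearMap.continuous_of_finiteDimensional
          ((Module.finBasis ℝ E).coord i)).comp_aestronglyMeasurable hu'.aestronglyMeasurable
      refine Finset.aestronglyMeasurable_fun_sum _ fun i _ =>
        Finset.aestronglyMeasurable_fun_sum _ fun j _ => (hcoord i).mul ((hcoord j).mul ?_)
      refine ContinuousOn.aestronglyMeasurable (fun t ht => ?_) measurableSet_Icc
      have hb : σ t ∈ (trivializationAt E (fun x : M => TangentSpace I x) p).baseSet := by
        simpa using (hgood t ht).2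
      have hin := fun hb => continuousAt_inner_constSection I (V := fun x : M => TangentSpace I x)
        (p := p) (x := σ t) hb (Module.finBasis ℝ E i) (Module.finBasis ℝ E j)
      exact (hin hb).comp_continuousWithinAt ((hcont t (hcd' ht)).mono hcd')
    refine h1.congr ?_
    filter_upwards [hae] with t ht
    rw [← norm_sq_constSection, ← ht, Real.sqrt_sq (norm_nonneg _)]
  · filter_upwards [hae, ae_restrict_mem measurableSet_Icc] with t ht htm
    rw [norm_norm, ht]
    exact ContinuousLinearMap.le_of_opNorm_le _ (hgood t htm).1.le _

theorem baseLength_eq (hσ : IsACOn I σ 0 1) :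
    baseLength I σ = ENNReal.ofReal (∫ t in Icc (0 : ℝ) 1, ‖velocity I σ t‖) := by
  rw [baseLength, ofReal_integral_eq_lintegral_ofReal
    (integrableOn_norm_velocity zero_le_one hσ)
    (Filter.Eventually.of_forall fun t => norm_nonneg _)]
  simp only [ofReal_norm]

end BaseLength

/-! ### Lengths of curves in the total space -/

theorem ofReal_sq_add_sq_rpow {x y : ℝ} (hx : 0 ≤ x) (hy : 0 ≤ y) :
    (ENNReal.ofReal x ^ 2 + ENNReal.ofReal y ^ 2) ^ (1 / 2 : ℝ) =
      ENNReal.ofReal √(x ^ 2 + y ^ 2) := by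
  rw [← ENNReal.ofReal_pow hx, ← ENNReal.ofReal_pow hy, ← ENNReal.ofReal_add (by positivity)
    (by positivity), ENNReal.ofReal_rpow_of_nonneg (by positivity) (by norm_num), Real.sqrt_eq_rpow]

/-- Minkowski's integral inequality in the plane. -/
theorem sqrt_lintegral_sq_add_sq_le {α : Type*} [MeasurableSpace α] {μ : Measure α} {f g : α → ℝ}
    (hf : AEMeasurable f μ) (hf0 : ∀ x, 0 ≤ f x) {a b : ℝ} (ha : 0 ≤ a) (hb : 0 ≤ b)
    (hfa : ENNReal.ofReal a ≤ ∫⁻ x, ENNReal.ofReal (f x) ∂μ)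
    (hgb : ENNReal.ofReal b ≤ ∫⁻ x, ENNReal.ofReal (g x) ∂μ) :
    ENNReal.ofReal √(a ^ 2 + b ^ 2) ≤ ∫⁻ x, ENNReal.ofReal √(f x ^ 2 + g x ^ 2) ∂μ := by
  rcases (Real.sqrt_nonneg (a ^ 2 + b ^ 2)).eq_or_lt with h0 | hpos
  · rw [← h0, ENNReal.ofReal_zero]
    exact zero_le
  set r := √(a ^ 2 + b ^ 2)
  have hr : r ^ 2 = a ^ 2 + b ^ 2 := Real.sq_sqrt (by positivity)
  have h1 : (a / r) * a + (b / r) * b = r := by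
    field_simp
    linarith
  calc ENNReal.ofReal r = ENNReal.ofReal (a / r) * ENNReal.ofReal a +
        ENNReal.ofReal (b / r) * ENNReal.ofReal b := by
        rw [← ENNReal.ofReal_mul (by positivity), ← ENNReal.ofReal_mul (by positivity),
          ← ENNReal.ofReal_add (by positivity) (by positivity), h1]
    _ ≤ ENNReal.ofReal (a / r) * ∫⁻ x, ENNReal.ofReal (f x) ∂μ +
        ENNReal.ofReal (b / r) * ∫⁻ x, ENNReal.ofReal (g x) ∂μ := by gcongr
    _ = ∫⁻ x, (ENNReal.ofReal (a / r) * ENNReal.ofReal (f x) +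
        ENNReal.ofReal (b / r) * ENNReal.ofReal (g x)) ∂μ := by
        rw [lintegral_add_left' (hf.ennreal_ofReal.const_mul _),
          lintegral_const_mul' _ _ ENNReal.ofReal_ne_top,
          lintegral_const_mul' _ _ ENNReal.ofReal_ne_top]
    _ ≤ ∫⁻ x, ENNReal.ofReal √(f x ^ 2 + g x ^ 2) ∂μ := by
        refine lintegral_mono fun x => ?_
        rw [← ENNReal.ofReal_mul (by positivity), ← ENNReal.ofReal_mul (by positivity)]
        have h3 : (a / r) ^ 2 + (b / r) ^ 2 = 1 := by
          rw [div_pow, div_pow, ← add_div, ← hr, div_self (by positivity)]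
        have h2 : a / r * f x + b / r * |g x| ≤ √(f x ^ 2 + g x ^ 2) := by
          refine Real.le_sqrt_of_sq_le ?_
          rw [← sq_abs (g x)]
          nlinarith [sq_nonneg (a / r * |g x| - b / r * f x)]
        refine (add_le_add_right (ENNReal.ofReal_le_ofReal
          (mul_le_mul_of_nonneg_left (le_abs_self (g x)) (by positivity))) _).trans ?_
        rw [← ENNReal.ofReal_add (mul_nonneg (by positivity) (hf0 x)) (by positivity)]
        exact ENNReal.ofReal_le_ofReal h2

section Length

variable {E : Type*} [NormedAddCommGroup E] [NormedSpace ℝ E] [FiniteDimensional ℝ E]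
  {H : Type*} [TopologicalSpace H] {I : ModelWithCorners ℝ E H} [I.Boundaryless]
  {M : Type*} [TopologicalSpace M] [ChartedSpace H M] [IsManifold I ∞ M]
  [RiemannianBundle (fun x : M => TangentSpace I x)]
  [IsContMDiffRiemannianBundle I ∞ E (fun x : M => TangentSpace I x)]
  {F : Type*} [NormedAddCommGroup F] [NormedSpace ℝ F] [FiniteDimensional ℝ F]
  {V : M → Type*} [TopologicalSpace (TotalSpace F V)]
  [∀ x, NormedAddCommGroup (V x)] [∀ x, InnerProductSpace ℝ (V x)]
  [FiberBundle F V] [VectorBundle ℝ F V] [ContMDiffVectorBundle ∞ F V I]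
  [IsContMDiffRiemannianBundle I ∞ F V]
  (cov : CovariantDerivative I F V)
  {σ : ℝ → M} {ξ : ℝ → TotalSpace F V}

theorem totalLength_eq (hξ : IsACOn (I.prod 𝓘(ℝ, F)) ξ 0 1) :
    totalLength cov ξ = ∫⁻ t in Icc (0 : ℝ) 1,
      ENNReal.ofReal √(‖velocity I (fun t => (ξ t).proj) t‖ ^ 2 + ‖covAlong cov ξ t‖ ^ 2) := by
  refine lintegral_congr_ae ((ae_restrict_iff' measurableSet_Icc).2 ?_)
  rw [← uIcc_of_le zero_le_one]
  filter_upwards [hξ.ae_mdifferentiableAt] with t ht htm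
  rw [totalInner, real_inner_self_eq_norm_sq, real_inner_self_eq_norm_sq, velocity_proj (ht htm)]
  rfl

variable [T2Space M] [cov.ContMDiffCovariantDerivative ∞]

theorem pathDist_eq_ofReal (hσ : IsACOn I σ 0 1) (e : V (σ 0)) (e' : V (σ 1)) :
    pathDist cov σ e e' = ENNReal.ofReal √((∫ t in Icc (0 : ℝ) 1, ‖velocity I σ t‖) ^ 2 +
      ‖parallelTransport cov σ 1 0 e' - e‖ ^ 2) := by
  rw [pathDist, baseLength_eq hσ, ← ofReal_norm, ofReal_sq_add_sq_rpow
    (integral_nonneg fun t => norm_nonneg _) (norm_nonneg _)]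

/-- The length of a curve in the total space is bounded below in terms of its projection to the
base. -/
theorem pathDist_le_totalLength (hcov : cov.IsMetricCompatible)
    (hξ : IsACOn (I.prod 𝓘(ℝ, F)) ξ 0 1) :
    pathDist cov (fun t => (ξ t).proj) (ξ 0).2 (ξ 1).2 ≤ totalLength cov ξ := by
  have hσ := hξ.proj
  have hint := integrableOn_norm_velocity zero_le_one hσ
  rw [pathDist_eq_ofReal cov hσ, totalLength_eq cov hξ]
  obtain ⟨η, hη, hη1⟩ :=
    exists_isParallelOn cov zero_le_one hσ (right_mem_Icc.2 zero_le_one) (ξ 1).2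
  refine sqrt_lintegral_sq_add_sq_le hint.aestronglyMeasurable.aemeasurable
    (fun t => norm_nonneg _) (integral_nonneg fun t => norm_nonneg _) (norm_nonneg _) ?_ ?_
  · rw [ofReal_integral_eq_lintegral_ofReal hint
      (Filter.Eventually.of_forall fun t => norm_nonneg _)]
  · have h := (enorm_sub_le_add_lintegral_covAlong (ζ := fun t => (ξ t).2) cov hcov zero_le_one
      hη hξ).2
    rw [← hη1, IsParallelOn.parallelTransport_eq cov hcov hη.symm]
    simp only [ofReal_norm]
    rw [hη1, sub_self, enorm_zero, zero_add, ← neg_sub, enorm_neg] at h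
    exact h

/-- A curve in the total space over a curve `σ`, whose fiber component interpolates between two
parallel sections. -/
theorem totalDist_le_pathDist (hcov : cov.IsMetricCompatible) (hσ : IsACOn I σ 0 1) (e : V (σ 0))
    (e' : V (σ 1)) : totalDist cov ⟨σ 0, e⟩ ⟨σ 1, e'⟩ ≤ pathDist cov σ e e' := by
  have hint := integrableOn_norm_velocity zero_le_one hσ
  obtain ⟨η, hη, rfl⟩ := exists_isParallelOn cov zero_le_one hσ (left_mem_Icc.2 zero_le_one) e
  obtain ⟨ζ, hζ, rfl⟩ := exists_isParallelOn cov zero_le_one hσ (right_mem_Icc.2 zero_le_one) e'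
  rw [pathDist_eq_ofReal cov hσ, IsParallelOn.parallelTransport_eq cov hcov hζ.symm]
  set l := ∫ t in Icc (0 : ℝ) 1, ‖velocity I σ t‖
  set n := ‖ζ 0 - η 0‖
  have hl : 0 ≤ l := integral_nonneg fun t => norm_nonneg _
  have hn : ∀ t ∈ Icc (0 : ℝ) 1, ‖ζ t - η t‖ = n := by
    intro t ht
    have hsub : uIcc 0 t ⊆ uIcc (0 : ℝ) 1 := by
      rw [uIcc_of_le ht.1, uIcc_of_le zero_le_one]; exact Icc_subset_Icc le_rfl ht.2
    have := IsParallelOn.enorm_sub_eq cov hcov (hη.mono cov hsub) (hζ.mono cov hsub)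
    rw [← toReal_enorm, ← this, toReal_enorm]
  -- The interpolation parameter has speed proportional to `|σ'| + δ`, so that the ratio of the
  -- vertical and horizontal speeds is almost constant; `δ > 0` avoids a division by zero if `σ` has
  -- length zero.
  have key : ∀ δ > (0 : ℝ), totalDist cov ⟨σ 0, η 0⟩ ⟨σ 1, ζ 1⟩ ≤
      ENNReal.ofReal √((l + δ) ^ 2 + n ^ 2) := by
    intro δ hδ
    have hL : 0 < l + δ := by positivity
    set φ : ℝ → ℝ := fun t => (‖velocity I σ t‖ + δ) / (l + δ) with hφ
    have hφi : IntegrableOn φ (Icc 0 1) :=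
      (hint.add (integrableOn_const (by simp) (by simp))).div_const _
    have hφi' : IntervalIntegrable φ volume 0 1 :=
      (intervalIntegrable_iff_integrableOn_Icc_of_le zero_le_one).2 hφi
    have hφ1 : ∫ t in (0 : ℝ)..1, φ t = 1 := by
      rw [intervalIntegral.integral_of_le zero_le_one, ← integral_Icc_eq_integral_Ioc, hφ,
        integral_div, integral_add hint (integrableOn_const (by simp) (by simp))]
      simp only [integral_const, MeasurableSet.univ, measureReal_restrict_apply, univ_inter]
      simp only [Real.volume_real_Icc, sub_zero, zero_le_one, max_eq_left, smul_eq_mul, one_mul]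
      exact div_self hL.ne'
    set s : ℝ → ℝ := fun t => ∫ r in (0 : ℝ)..t, φ r
    have hs : AbsolutelyContinuousOnInterval s 0 1 :=
      absolutelyContinuousOnInterval_intervalIntegral hφi' left_mem_uIcc
    have hs' : AbsolutelyContinuousOnInterval (fun t => 1 - s t) 0 1 :=
      AbsolutelyContinuousOnInterval.of_dist_le hs 1 fun x _ y _ => by rw [one_mul, dist_sub_left]
    set ξ : ℝ → TotalSpace F V := sectionCurve F σ (fun t => (1 - s t) • η t + s t • ζ t) with hξd
    have hξ : IsACOn (I.prod 𝓘(ℝ, F)) ξ 0 1 := isACOn_smul_add_smul zero_le_one hη.1 hζ.1 hs' hs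
    have hξ0 : ξ 0 = ⟨σ 0, η 0⟩ := by simp [ξ, s]
    have hξ1 : ξ 1 = ⟨σ 1, ζ 1⟩ := by simp [ξ, s, hφ1]
    refine (iInf₂_le_of_le ξ hξ (iInf₂_le hξ0 hξ1)).trans ?_
    rw [totalLength_eq cov hξ]
    calc ∫⁻ t in Icc (0 : ℝ) 1,
        ENNReal.ofReal √(‖velocity I (fun t => (ξ t).proj) t‖ ^ 2 + ‖covAlong cov ξ t‖ ^ 2)
        ≤ ∫⁻ t in Icc (0 : ℝ) 1, ENNReal.ofReal (φ t * √((l + δ) ^ 2 + n ^ 2)) := by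
          refine setLIntegral_mono_ae' measurableSet_Icc ?_
          rw [← uIcc_of_le zero_le_one]
          filter_upwards [hη.1.ae_mdifferentiableAt, hζ.1.ae_mdifferentiableAt, hη.2, hζ.2,
            hφi'.ae_hasDerivAt_integral] with t h1 h2 h3 h4 h5 ht
          have h6 : HasDerivAt s (φ t) t := h5 ht 0 left_mem_uIcc
          have h7 := (covAlong_smul_add_smul cov (h1 ht) (h2 ht) (h6.const_sub 1) h6).2
          have h8 : (covAlong cov (sectionCurve F σ η) t : V (σ t)) = 0 := h3 ht
          have h9 : (covAlong cov (sectionCurve F σ ζ) t : V (σ t)) = 0 := h4 ht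
          have h10 : (covAlong cov ξ t : V (σ t)) = φ t • (ζ t - η t) := by
            rw [h8, h9] at h7
            refine h7.trans ?_
            rw [smul_sub, smul_zero, smul_zero, neg_smul, add_zero, add_zero, neg_add_eq_sub]
          have hφ0 : 0 ≤ φ t := by positivity
          have h11 : ‖covAlong cov ξ t‖ = φ t * n := by
            refine (congrArg norm h10).trans ?_
            rw [norm_smul, Real.norm_of_nonneg hφ0, hn t (by rwa [uIcc_of_le zero_le_one] at ht)]
          refine ENNReal.ofReal_le_ofReal ?_
          rw [h11, ← Real.sqrt_sq hφ0, ← Real.sqrt_mul (by positivity), Real.sqrt_sq hφ0, mul_add,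
            mul_pow]
          refine Real.sqrt_le_sqrt (add_le_add_left ?_ _)
          rw [← mul_pow]
          refine pow_le_pow_left₀ (norm_nonneg _) ?_ 2
          rw [hφ, div_mul_cancel₀ _ hL.ne']
          exact le_add_of_nonneg_right hδ.le
      _ = ENNReal.ofReal √((l + δ) ^ 2 + n ^ 2) := by
          have hφ0 : ∀ t, 0 ≤ φ t := fun t => by positivity
          rw [← ofReal_integral_eq_lintegral_ofReal (hφi.mul_const _)
            (Filter.Eventually.of_forall fun t => mul_nonneg (hφ0 t) (Real.sqrt_nonneg _)),
            integral_mul_const, integral_Icc_eq_integral_Ioc,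
            ← intervalIntegral.integral_of_le zero_le_one, hφ1, one_mul]
  have hlim : Filter.Tendsto (fun δ : ℝ => ENNReal.ofReal √((l + δ) ^ 2 + n ^ 2)) (𝓝[>] 0)
      (𝓝 (ENNReal.ofReal √(l ^ 2 + n ^ 2))) := by
    have h1 : Continuous fun δ : ℝ => ENNReal.ofReal √((l + δ) ^ 2 + n ^ 2) :=
      ENNReal.continuous_ofReal.comp (by fun_prop)
    have h2 := h1.tendsto 0
    simp only [add_zero] at h2
    exact h2.mono_left nhdsWithin_le_nhds
  exact ge_of_tendsto hlim (by filter_upwards [self_mem_nhdsWithin] with δ hδ using key δ hδ)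

end Length

/-! ### Parallel sections along continuously differentiable curves -/

section CovDerivMap

variable {E : Type*} [NormedAddCommGroup E] [NormedSpace ℝ E] [FiniteDimensional ℝ E]
  {H : Type*} [TopologicalSpace H] {I : ModelWithCorners ℝ E H} [I.Boundaryless]
  {M : Type*} [TopologicalSpace M] [ChartedSpace H M] [IsManifold I ∞ M]
  {F : Type*} [NormedAddCommGroup F] [NormedSpace ℝ F] [FiniteDimensional ℝ F]
  {V : M → Type*} [TopologicalSpace (TotalSpace F V)]
  [∀ x, NormedAddCommGroup (V x)] [∀ x, InnerProductSpace ℝ (V x)]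
  [FiberBundle F V] [VectorBundle ℝ F V] [ContMDiffVectorBundle ∞ F V I]
  [IsContMDiffRiemannianBundle I ∞ F V]
  (cov : CovariantDerivative I F V)
  {γ : ℝ → M} {η ζ P : ∀ t, V (γ t)} {ξ : ℝ → TotalSpace F V} {a b t ε : ℝ}

theorem exists_isACOn_of_contMDiffAt (hγ : ContMDiffAt 𝓘(ℝ, ℝ) I 1 γ 0) :
    ∃ ε > 0, (∀ t ∈ Icc (-ε) ε, ContMDiffAt 𝓘(ℝ, ℝ) I 1 γ t) ∧ IsACOn I γ (-ε) ε := by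
  have h := (contMDiffAt_iff_contMDiffAt_nhds (by simp)).1 hγ
  obtain ⟨ε, hε, hball⟩ := Metric.nhds_basis_closedBall.eventually_iff.1 h
  have h1 : ∀ t ∈ Icc (-ε) ε, ContMDiffAt 𝓘(ℝ, ℝ) I 1 γ t := fun t ht =>
    hball (by rw [mem_closedBall_zero_iff, Real.norm_eq_abs]; exact abs_le.2 ht)
  refine ⟨ε, hε, h1, isACOn_of_contMDiffAt fun t ht => h1 t ?_⟩
  rwa [uIcc_of_le (by linarith)] at ht

theorem uIcc_zero_subset (ht : t ∈ Icc (-ε) ε) : uIcc 0 t ⊆ uIcc (-ε) ε := by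
  have hε : -ε ≤ ε := ht.1.trans ht.2
  rw [uIcc_of_le hε]
  exact uIcc_subset_Icc ⟨by linarith, by linarith⟩ ht

theorem IsParallelOn.add_smul (hab : a ≤ b) (hη : IsParallelOn cov γ η a b)
    (hζ : IsParallelOn cov γ ζ a b) (c : ℝ) :
    IsParallelOn cov γ (fun t => η t + c • ζ t) a b := by
  have hconst : ∀ c : ℝ, AbsolutelyContinuousOnInterval (fun _ : ℝ => c) a b := fun c =>
    (LipschitzOnWith.absolutelyContinuousOnInterval
      ((LipschitzWith.const c).lipschitzOnWith (s := uIcc a b)))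
  have h1 : (fun t => η t + c • ζ t) = fun t => (1 : ℝ) • η t + c • ζ t := by
    ext t; rw [one_smul]
  rw [h1]
  refine ⟨isACOn_smul_add_smul hab hη.1 hζ.1 (hconst 1) (hconst c), ?_⟩
  filter_upwards [hη.1.ae_mdifferentiableAt, hζ.1.ae_mdifferentiableAt, hη.2, hζ.2]
    with t h2 h3 h4 h5 ht
  have h6 : (covAlong cov (sectionCurve F γ η) t : V (γ t)) = 0 := h4 ht
  have h7 : (covAlong cov (sectionCurve F γ ζ) t : V (γ t)) = 0 := h5 ht
  refine (covAlong_smul_add_smul cov (h2 ht) (h3 ht) (hasDerivAt_const t 1)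
    (hasDerivAt_const t c)).2.trans ?_
  rw [h6, h7]
  simp

variable [T2Space M] [cov.ContMDiffCovariantDerivative ∞]

/-- Along a `C¹` curve, a parallel section is differentiable with vanishing covariant derivative at
every time, and not only at almost every one. It is compared with a section which is affine in a
trivialization, and whose covariant derivative is small near the given time. -/
theorem IsParallelOn.covAlong_eq_zero (hcov : cov.IsMetricCompatible)
    (hγ : ContMDiffAt 𝓘(ℝ, ℝ) I 1 γ 0) (hε : 0 < ε) (hP : IsParallelOn cov γ P (-ε) ε) :
    MDifferentiableAt 𝓘(ℝ, ℝ) (I.prod 𝓘(ℝ, F)) (sectionCurve F γ P) 0 ∧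
      (covAlong cov (sectionCurve F γ P) 0 : V (γ 0)) = 0 := by
  have := isContinuousRiemannianBundle (I := I) F V
  set p := γ 0 with hp
  have hb := FiberBundle.mem_baseSet_trivializationAt' (F := F) (E := V) p
  have hγd : MDifferentiableAt 𝓘(ℝ, ℝ) I γ 0 := hγ.mdifferentiableAt (by simp)
  set A : ℝ → F →L[ℝ] F := fun t =>
    christoffel cov p (γ t) (deriv (fun s => extChartAt I p (γ s)) t) with hA
  have hAc : ContinuousAt A 0 := by
    have hu : ContDiffAt ℝ 1 (fun s => extChartAt I p (γ s)) 0 := by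
      rw [← contMDiffAt_iff_contDiffAt]
      exact ContMDiffAt.comp 0 (contMDiffAt_extChartAt (n := 1)) hγ
    have hu' : ContinuousAt (fun t => deriv (fun s => extChartAt I p (γ s)) t) 0 := by
      simp only [← fderiv_apply_one_eq_deriv]
      exact (hu.continuousAt_fderiv (by simp)).clm_apply continuousAt_const
    exact ((eventually_continuousAt_christoffel cov p).self_of_nhds.comp hγ.continuousAt).clm_apply
      hu'
  -- `ψ'` is the affine approximation at time `0` of the parallel section in the trivialization, and
  -- `q` is the covariant derivative of the corresponding section along the curve.
  set y₀ := (trivializationAt F V p ⟨p, P 0⟩).2 with hy₀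
  set ψ' : ℝ → F := fun s => y₀ - s • A 0 y₀ with hψ'
  set ψ : ∀ s, V (γ s) := fun s => constSection F V p (ψ' s) (γ s) with hψ
  set q : ℝ → F := fun s => -(A 0 y₀) + A s (ψ' s) with hq
  have hψ'd : ∀ s, HasDerivAt ψ' (-(A 0 y₀)) s := fun s => by
    simpa using ((hasDerivAt_id s).smul_const (A 0 y₀)).const_sub y₀
  have hqc : ContinuousAt q 0 :=
    continuousAt_const.add (hAc.clm_apply (hψ'd 0).continuousAt)
  have hq0 : q 0 = 0 := by simp [hq, hψ']
  obtain ⟨C, hC, hCev⟩ := eventually_norm_symmL_trivializationAt_lt F V p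
  obtain ⟨C', hC', hCev'⟩ := eventually_norm_trivializationAt_lt F V p
  have hev : ∀ᶠ s in 𝓝 (0 : ℝ), ContMDiffAt 𝓘(ℝ, ℝ) I 1 γ s ∧ γ s ∈ (chartAt H p).source ∧
      γ s ∈ (trivializationAt F V p).baseSet ∧
      ‖(trivializationAt F V p).symmL ℝ (γ s)‖ < C ∧
      ‖(trivializationAt F V p).continuousLinearMapAt ℝ (γ s)‖ < C' ∧ s ∈ Icc (-ε) ε :=
    ((contMDiffAt_iff_contMDiffAt_nhds (by simp)).1 hγ).and <|
    (hγ.continuousAt.eventually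
      ((chartAt H p).open_source.eventually_mem (mem_chart_source H p))).and <|
    (hγ.continuousAt.eventually ((trivializationAt F V p).open_baseSet.eventually_mem hb)).and <|
    (hγ.continuousAt.eventually hCev).and <| (hγ.continuousAt.eventually hCev').and <|
    Icc_mem_nhds (by linarith) hε
  have hcoord : ∀ {s}, γ s ∈ (trivializationAt F V p).baseSet →
      (trivializationAt F V p ⟨γ s, ψ s⟩).2 = ψ' s := fun h => trivializationAt_constSection h _
  have hlo : HasDerivAt (fun s => (trivializationAt F V p ⟨γ s, P s⟩).2) (-(A 0 y₀)) 0 := by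
    rw [hasDerivAt_iff_isLittleO]
    refine Asymptotics.isLittleO_iff.2 fun c hc => ?_
    have hqs : ∀ᶠ s in 𝓝 (0 : ℝ), ‖q s‖ ≤ c / (C * C') := by
      have := hqc.norm
      rw [ContinuousAt, hq0, norm_zero] at this
      exact this.eventually_le_const (by positivity)
    obtain ⟨δ, hδ, hball⟩ := Metric.nhds_basis_ball.eventually_iff.1
      ((hev.and hqs).and hev.eventually_nhds)
    filter_upwards [Metric.ball_mem_nhds (0 : ℝ) hδ] with t ht
    have hmem : ∀ s ∈ uIcc 0 t, s ∈ Metric.ball (0 : ℝ) δ := by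
      have : uIcc 0 t ⊆ Metric.ball (0 : ℝ) δ :=
        (convex_ball (0 : ℝ) δ).ordConnected.uIcc_subset (Metric.mem_ball_self hδ) ht
      exact fun s hs => this hs
    have hψAC : IsACOn (I.prod 𝓘(ℝ, F)) (sectionCurve F γ ψ) 0 t := by
      refine isACOn_of_contMDiffAt fun s hs => ?_
      obtain ⟨⟨⟨h1, h2, h3, -⟩, -⟩, h4⟩ := hball (hmem s hs)
      refine ((trivializationAt F V p).contMDiffAt_iff
        ((trivializationAt F V p).mem_source.2 h3)).2 ⟨h1, ?_⟩
      have h5 : ContDiff ℝ 1 ψ' := by fun_prop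
      refine h5.contMDiff.contMDiffAt.congr_of_eventuallyEq ?_
      filter_upwards [h4] with s' hs'
      exact hcoord hs'.2.2.1
    have hψcov : ∀ s ∈ uIcc 0 t, ‖(covAlong cov (sectionCurve F γ ψ) s : V (γ s))‖ₑ ≤
        ENNReal.ofReal (C * (c / (C * C'))) := by
      intro s hs
      obtain ⟨⟨⟨h1, h2, h3, h4, -⟩, h5⟩, h6⟩ := hball (hmem s hs)
      have hev2 : (fun s => (trivializationAt F V p ⟨γ s, ψ s⟩).2) =ᶠ[𝓝 s] ψ' := by
        filter_upwards [h6] with s' hs'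
        exact hcoord hs'.2.2.1
      have hder := (hψ'd s).congr_of_eventuallyEq hev2
      have hm : MDifferentiableAt 𝓘(ℝ, ℝ) (I.prod 𝓘(ℝ, F)) (sectionCurve F γ ψ) s :=
        (mdifferentiableAt_sectionCurve_iff h3).2
          ⟨h1.mdifferentiableAt (by simp), hder.differentiableAt⟩
      have h7 := trivializationAt_covAlong cov hm h2 h3
      rw [hder.deriv] at h7
      have h8 : (trivializationAt F V p ⟨γ s, covAlong cov (sectionCurve F γ ψ) s⟩).2 = q s := by
        refine h7.trans ?_
        rw [hcoord h3]
      have h9 : (covAlong cov (sectionCurve F γ ψ) s : V (γ s)) =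
          (trivializationAt F V p).symmL ℝ (γ s) (q s) := by
        rw [← h8]
        exact (constSection_trivializationAt
          (e := (⟨γ s, covAlong cov (sectionCurve F γ ψ) s⟩ : TotalSpace F V)) h3).symm
      rw [h9, ← ofReal_norm]
      refine ENNReal.ofReal_le_ofReal ?_
      refine (ContinuousLinearMap.le_of_opNorm_le _ h4.le _).trans ?_
      gcongr
    have hint : ∀ a b : ℝ, a ≤ b → Icc a b = uIcc 0 t →
        ∫⁻ s in Icc a b, ‖(covAlong cov (sectionCurve F γ ψ) s : V (γ s))‖ₑ ≤
          ENNReal.ofReal (C * (c / (C * C')) * |t|) := by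
      intro a b hab heq
      refine (setLIntegral_mono' measurableSet_Icc fun s hs => hψcov s (heq ▸ hs)).trans ?_
      rw [setLIntegral_const, heq, uIcc, Real.volume_Icc,
        ENNReal.ofReal_mul (p := C * (c / (C * C'))) (by positivity),
        max_sub_min_eq_abs, sub_zero]
    have hψ0 : ψ 0 = P 0 := by
      have h0 : ψ' 0 = y₀ := by simp [hψ']
      change constSection F V p (ψ' 0) (γ 0) = P 0
      rw [h0]
      exact constSection_trivializationAt (e := (⟨p, P 0⟩ : TotalSpace F V)) hb
    have hkey : ‖ψ t - P t‖ₑ ≤ ENNReal.ofReal (C * (c / (C * C')) * |t|) := by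
      have htε := (hball ht).1.1.2.2.2.2.2
      have hPt := hP.mono cov (uIcc_zero_subset htε)
      rcases le_total 0 t with h0 | h0
      · have := (enorm_sub_le_add_lintegral_covAlong cov hcov h0 hPt hψAC).1
        rw [hψ0, sub_self, enorm_zero, zero_add] at this
        exact this.trans (hint 0 t h0 (uIcc_of_le h0).symm)
      · have := (enorm_sub_le_add_lintegral_covAlong cov hcov h0 hPt.symm hψAC.symm).2
        rw [hψ0, sub_self, enorm_zero, zero_add] at this
        exact this.trans (hint t 0 h0 (uIcc_of_ge h0).symm)
    rw [← ofReal_norm, ENNReal.ofReal_le_ofReal_iff (by positivity)] at hkey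
    obtain ⟨⟨⟨-, -, h3, -, h4, -⟩, -⟩, -⟩ := hball ht
    have hfin : (trivializationAt F V p ⟨γ t, P t⟩).2 - (trivializationAt F V p ⟨γ 0, P 0⟩).2 -
        (t - 0) • -(A 0 y₀) =
          -((trivializationAt F V p).continuousLinearMapAt ℝ (γ t) (ψ t - P t)) := by
      rw [map_sub, (trivializationAt F V p).continuousLinearMapAt_apply_of_mem ℝ h3,
        (trivializationAt F V p).continuousLinearMapAt_apply_of_mem ℝ h3, hcoord h3]
      simp only [hψ', hy₀, sub_zero, smul_neg]
      abel
    rw [hfin, norm_neg, sub_zero]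
    refine (ContinuousLinearMap.le_of_opNorm_le _ h4.le _).trans ?_
    calc C' * ‖ψ t - P t‖ ≤ C' * (C * (c / (C * C')) * |t|) := by gcongr
      _ = c * ‖t‖ := by rw [Real.norm_eq_abs]; field_simp
  have hm : MDifferentiableAt 𝓘(ℝ, ℝ) (I.prod 𝓘(ℝ, F)) (sectionCurve F γ P) 0 :=
    (mdifferentiableAt_sectionCurve_iff hb).2 ⟨hγd, hlo.differentiableAt⟩
  refine ⟨hm, eq_of_trivializationAt_eq hb ?_⟩
  refine (trivializationAt_covAlong cov hm (mem_chart_source H p) hb).trans ?_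
  have h0 : (trivializationAt F V p ⟨p, (0 : V p)⟩).2 = 0 := by
    rw [← (trivializationAt F V p).continuousLinearMapAt_apply_of_mem ℝ hb, map_zero]
  rw [hlo.deriv]
  exact (neg_add_cancel _).trans h0.symm

end CovDerivMap

/-! ### The covariant derivative of a bundle map -/

section CovDerivMap

variable {E : Type*} [NormedAddCommGroup E] [NormedSpace ℝ E] [FiniteDimensional ℝ E]
  {H : Type*} [TopologicalSpace H] {I : ModelWithCorners ℝ E H} [I.Boundaryless]
  {M : Type*} [TopologicalSpace M] [ChartedSpace H M] [IsManifold I ∞ M]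
  {F : Type*} [NormedAddCommGroup F] [NormedSpace ℝ F] [FiniteDimensional ℝ F]
  {V : M → Type*} [TopologicalSpace (TotalSpace F V)]
  [∀ x, NormedAddCommGroup (V x)] [∀ x, InnerProductSpace ℝ (V x)]
  [FiberBundle F V] [VectorBundle ℝ F V] [ContMDiffVectorBundle ∞ F V I]
  [IsContMDiffRiemannianBundle I ∞ F V]
  (cov : CovariantDerivative I F V)
  {γ : ℝ → M} {η ζ P θ : ∀ t, V (γ t)} {ξ : ℝ → TotalSpace F V} {a b t ε : ℝ}

theorem connector_smul (e : TotalSpace F V) (k : ℝ) (w : TangentSpace (I.prod 𝓘(ℝ, F)) e) :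
    connector cov e (k • w) = k • connector cov e w := by
  have h : projDeriv I e (k • w) = k • projDeriv I e w := map_smul _ _ _
  simp only [connector_eq_trivDeriv, h, map_smul, smul_add]

/-- A tangent vector to the total space is determined by its horizontal and vertical components. -/
theorem eq_of_projDeriv_eq_of_connector_eq {e : TotalSpace F V}
    {w w' : TangentSpace (I.prod 𝓘(ℝ, F)) e} (h₁ : projDeriv I e w = projDeriv I e w')
    (h₂ : connector cov e w = connector cov e w') : w = w' := by
  have h3 : projDeriv I e (w - w') = 0 := by rw [projDeriv_sub, h₁, sub_self]
  have h4 : connector cov e (w - w') = 0 := by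
    have := connector_add cov e (w - w') w'
    rw [sub_add_cancel, h₂] at this
    exact right_eq_add.1 this
  refine sub_eq_zero.1 (eq_zero_of_projDeriv_eq_zero h3 ?_)
  rw [connector_eq_trivDeriv, h3, map_zero, add_zero] at h4
  have hb := FiberBundle.mem_baseSet_trivializationAt' (F := F) (E := V) e.proj
  rw [← (trivializationAt F V e.proj).continuousLinearMapAt_symmL (R := ℝ) hb
    (trivDeriv I e.proj e (w - w')), h4, map_zero]

theorem covAlong_const_smul (hη : MDifferentiableAt 𝓘(ℝ, ℝ) (I.prod 𝓘(ℝ, F)) (sectionCurve F γ η) t)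
    (r : ℝ) :
    MDifferentiableAt 𝓘(ℝ, ℝ) (I.prod 𝓘(ℝ, F)) (sectionCurve F γ (fun s => r • η s)) t ∧
    (covAlong cov (sectionCurve F γ (fun s => r • η s)) t : V (γ t)) =
      r • (covAlong cov (sectionCurve F γ η) t : V (γ t)) := by
  have h := covAlong_smul_add_smul cov hη hη (hasDerivAt_const t r) (hasDerivAt_const t 0)
  have h1 : (fun s => r • η s + (0 : ℝ) • η s) = fun s => r • η s := by ext s; simp
  rw [h1] at h
  refine ⟨h.1, h.2.trans ?_⟩
  simp

/-- A section along a curve which vanishes together with its covariant derivative at time `0` is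
`o(t)`. -/
theorem eventually_norm_le_of_covAlong_eq_zero
    (hθ : MDifferentiableAt 𝓘(ℝ, ℝ) (I.prod 𝓘(ℝ, F)) (sectionCurve F γ θ) 0) (h0 : θ 0 = 0)
    (hcov0 : (covAlong cov (sectionCurve F γ θ) 0 : V (γ 0)) = 0) {c : ℝ} (hc : 0 < c) :
    ∀ᶠ t in 𝓝 (0 : ℝ), ‖θ t‖ ≤ c * |t| := by
  have := isContinuousRiemannianBundle (I := I) F V
  have hb := FiberBundle.mem_baseSet_trivializationAt' (F := F) (E := V) (γ 0)
  have hγ : MDifferentiableAt 𝓘(ℝ, ℝ) I γ 0 := mdifferentiableAt_proj_curve hθ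
  have hz : (trivializationAt F V (γ 0) ⟨γ 0, (0 : V (γ 0))⟩).2 = 0 := by
    rw [← (trivializationAt F V (γ 0)).continuousLinearMapAt_apply_of_mem ℝ hb, map_zero]
  have h1 := trivializationAt_covAlong cov hθ (mem_chart_source H _) hb
  have h2 : (trivializationAt F V (γ 0) (sectionCurve F γ θ 0)).2 = 0 := by
    simp only [sectionCurve, h0, hz]
  have h3 : deriv (fun s => (trivializationAt F V (γ 0) (sectionCurve F γ θ s)).2) 0 = 0 := by
    rw [h2, map_zero, add_zero] at h1
    rw [← h1]
    refine Eq.trans ?_ hz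
    rw [← hcov0]
  have h4 := (differentiableAt_trivializationAt hθ hb).hasDerivAt
  rw [h3, hasDerivAt_iff_isLittleO] at h4
  obtain ⟨C, hC, hCev⟩ := eventually_norm_symmL_trivializationAt_lt F V (γ 0)
  filter_upwards [Asymptotics.isLittleO_iff.1 h4 (show 0 < c / C by positivity),
    eventually_mem_baseSet hγ hb, hγ.continuousAt.eventually hCev] with t h5 h6 h7
  rw [h2, smul_zero, sub_zero, sub_zero, sub_zero, Real.norm_eq_abs] at h5
  have h8 : θ t = (trivializationAt F V (γ 0)).symmL ℝ (γ t)
      (trivializationAt F V (γ 0) (sectionCurve F γ θ t)).2 :=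
    (constSection_trivializationAt (e := (⟨γ t, θ t⟩ : TotalSpace F V)) h6).symm
  rw [h8]
  calc _ ≤ C * ‖(trivializationAt F V (γ 0) (sectionCurve F γ θ t)).2‖ :=
        ContinuousLinearMap.le_of_opNorm_le _ h7.le _
    _ ≤ C * (c / C * |t|) := by gcongr
    _ = c * |t| := by field_simp

variable [T2Space M] [cov.ContMDiffCovariantDerivative ∞]

/-- The covariant derivative along a curve as the derivative of the section transported back to the
initial point. -/
theorem hasDerivAt_parallelTransport (hcov : cov.IsMetricCompatible)
    (hγ : ContMDiffAt 𝓘(ℝ, ℝ) I 1 γ 0)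
    (hζ : MDifferentiableAt 𝓘(ℝ, ℝ) (I.prod 𝓘(ℝ, F)) (sectionCurve F γ ζ) 0) :
    HasDerivAt (fun t => parallelTransport cov γ t 0 (ζ t))
      (covAlong cov (sectionCurve F γ ζ) 0 : V (γ 0)) 0 := by
  obtain ⟨ε, hε, -, hac⟩ := exists_isACOn_of_contMDiffAt hγ
  have hεε : -ε ≤ ε := by linarith
  have hmem : (0 : ℝ) ∈ Icc (-ε) ε := ⟨by linarith, hε.le⟩
  obtain ⟨P, hP, hP0⟩ := exists_isParallelOn cov hεε hac hmem (ζ 0)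
  obtain ⟨Q, hQ, hQ0⟩ := exists_isParallelOn cov hεε hac hmem
    (covAlong cov (sectionCurve F γ ζ) 0 : V (γ 0))
  obtain ⟨hPm, hPc⟩ := hP.covAlong_eq_zero cov hcov hγ hε
  obtain ⟨hQm, hQc⟩ := hQ.covAlong_eq_zero cov hcov hγ hε
  -- The difference between the section and its affine approximation by parallel sections.
  set S : ∀ t, V (γ t) := fun t => (1 : ℝ) • P t + t • Q t with hS
  have hS' := covAlong_smul_add_smul cov hPm hQm (hasDerivAt_const 0 1) (hasDerivAt_id' 0)
  have hSm : MDifferentiableAt 𝓘(ℝ, ℝ) (I.prod 𝓘(ℝ, F)) (sectionCurve F γ S) 0 := hS'.1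
  have hSc' : (covAlong cov (sectionCurve F γ S) 0 : V (γ 0)) =
      covAlong cov (sectionCurve F γ ζ) 0 := by
    refine hS'.2.trans ?_
    rw [hPc, hQc, hQ0]
    simp
  obtain ⟨hθm, hθc⟩ := covAlong_sub cov hζ hSm
  rw [hSc', sub_self] at hθc
  have hS0 : S 0 = ζ 0 := by simp [hS, hP0]
  rw [hasDerivAt_iff_isLittleO]
  refine Asymptotics.isLittleO_iff.2 fun c hc => ?_
  have hself : parallelTransport cov γ 0 0 (ζ 0) = ζ 0 := by
    rw [← hP0]
    exact IsParallelOn.parallelTransport_eq cov hcov (hP.mono cov (uIcc_zero_subset hmem))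
  filter_upwards [eventually_norm_le_of_covAlong_eq_zero cov hθm (by simp [hS0]) hθc hc,
    Icc_mem_nhds (show -ε < 0 by linarith) hε] with t ht htε
  have hsub := uIcc_zero_subset htε
  obtain ⟨R, hR, hRt⟩ := exists_isParallelOn cov hεε hac htε (ζ t)
  have hR' := (hR.mono cov hsub).symm
  have hSp : IsParallelOn cov γ (fun s => P s + t • Q s) (-ε) ε := hP.add_smul cov hεε hQ t
  have h1 := IsParallelOn.enorm_sub_eq cov hcov (hSp.mono cov hsub).symm hR'
  rw [hself, ← hRt, hR'.parallelTransport_eq cov hcov, sub_zero, Real.norm_eq_abs]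
  refine le_trans (le_of_eq ?_) ht
  have h2 : R 0 - ζ 0 - t • (covAlong cov (sectionCurve F γ ζ) 0 : V (γ 0)) =
      R 0 - (P 0 + t • Q 0) := by rw [hP0, hQ0, sub_sub]
  rw [h2, ← toReal_enorm, ← h1, toReal_enorm, hRt, hS]
  simp only [one_smul]

variable (F) in
/-- The map of total spaces given by a family of maps of the fibers. -/
abbrev totalMap (f : M → M) (Φ : ∀ m, V m →L[ℝ] V (f m)) (e : TotalSpace F V) : TotalSpace F V :=
  ⟨f e.proj, Φ e.proj e.2⟩

variable {f : M → M} {Φ : ∀ m, V m →L[ℝ] V (f m)}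

/-- `(∇_v Φ) e` as the covariant derivative of the image under `Φ` of a parallel section. -/
theorem covDerivMap_eq (hcov : cov.IsMetricCompatible) (hf : ContMDiff I I 1 f)
    (hΦ : ContMDiff (I.prod 𝓘(ℝ, F)) (I.prod 𝓘(ℝ, F)) 1 (totalMap F f Φ))
    (hγ : ContMDiffAt 𝓘(ℝ, ℝ) I 1 γ 0) (hε : 0 < ε) (hP : IsParallelOn cov γ P (-ε) ε) :
    covDerivMap cov f (fun m => Φ m) γ (P 0) =
      covAlong cov (sectionCurve F (fun t => f (γ t)) fun t => Φ (γ t) (P t)) 0 := by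
  have hζ : MDifferentiableAt 𝓘(ℝ, ℝ) (I.prod 𝓘(ℝ, F))
      (sectionCurve F (fun t => f (γ t)) fun t => Φ (γ t) (P t)) 0 :=
    (hΦ.mdifferentiable (by simp) _).comp (0 : ℝ) (hP.covAlong_eq_zero cov hcov hγ hε).1
  have hfγ : ContMDiffAt 𝓘(ℝ, ℝ) I 1 (fun t => f (γ t)) 0 := hf.contMDiffAt.comp 0 hγ
  rw [← (hasDerivAt_parallelTransport cov hcov hfγ hζ).deriv]
  refine Filter.EventuallyEq.deriv_eq ?_
  filter_upwards [Icc_mem_nhds (show -ε < 0 by linarith) hε] with t ht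
  rw [(hP.mono cov (uIcc_zero_subset ht)).parallelTransport_eq cov hcov]

/-- On horizontal vectors, the vertical component of the differential of a bundle map is given by the
covariant derivative of the bundle map. -/
theorem connector_mfderiv_totalMap (hcov : cov.IsMetricCompatible) (hf : ContMDiff I I 1 f)
    (hΦ : ContMDiff (I.prod 𝓘(ℝ, F)) (I.prod 𝓘(ℝ, F)) 1 (totalMap F f Φ))
    (hγ : ContMDiffAt 𝓘(ℝ, ℝ) I 1 γ 0) (u : V (γ 0)) (r k : ℝ)
    (w : TangentSpace (I.prod 𝓘(ℝ, F)) (⟨γ 0, r • u⟩ : TotalSpace F V))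
    (hw : connector cov ⟨γ 0, r • u⟩ w = 0)
    (hk : projDeriv I (⟨γ 0, r • u⟩ : TotalSpace F V) w = k • velocity I γ 0) :
    (connector cov (totalMap F f Φ ⟨γ 0, r • u⟩)
      (mfderiv (I.prod 𝓘(ℝ, F)) (I.prod 𝓘(ℝ, F)) (totalMap F f Φ) ⟨γ 0, r • u⟩ w) : V (f (γ 0))) =
        (k * r) • covDerivMap cov f (fun m => Φ m) γ u := by
  obtain ⟨ε, hε, -, hac⟩ := exists_isACOn_of_contMDiffAt hγ
  obtain ⟨P, hP, rfl⟩ := exists_isParallelOn cov (by linarith) hac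
    (show (0 : ℝ) ∈ Icc (-ε) ε from ⟨by linarith, hε.le⟩) u
  obtain ⟨hPm, hPc⟩ := hP.covAlong_eq_zero cov hcov hγ hε
  obtain ⟨hSm, hSc⟩ := covAlong_const_smul cov hPm r
  set S := sectionCurve F γ (fun s => r • P s) with hS
  have hw' : w = k • velocity (I.prod 𝓘(ℝ, F)) S 0 := by
    refine eq_of_projDeriv_eq_of_connector_eq cov ?_ ?_
    · rw [hk]
      have h1 := velocity_proj hSm
      refine (congrArg (fun v : TangentSpace I (γ 0) => k • v) h1.symm).trans ?_
      exact (map_smul (mfderiv (I.prod 𝓘(ℝ, F)) I (TotalSpace.proj : TotalSpace F V → M)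
        ⟨γ 0, r • P 0⟩) k _).symm
    · rw [hw, connector_smul]
      have h2 : connector cov (⟨γ 0, r • P 0⟩ : TotalSpace F V)
        (velocity (I.prod 𝓘(ℝ, F)) S 0) = 0 := hSc.trans (by rw [hPc, smul_zero])
      rw [h2, smul_zero]
  have hZ : MDifferentiableAt (I.prod 𝓘(ℝ, F)) (I.prod 𝓘(ℝ, F)) (totalMap F f Φ)
    ⟨γ 0, r • P 0⟩ := hΦ.mdifferentiable (by simp) _
  have h3 : mfderiv (I.prod 𝓘(ℝ, F)) (I.prod 𝓘(ℝ, F)) (totalMap F f Φ) ⟨γ 0, r • P 0⟩ w =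
      k • velocity (I.prod 𝓘(ℝ, F)) (fun t => totalMap F f Φ (S t)) 0 := by
    rw [hw', map_smul]
    exact congrArg (fun v => k • v) (velocity_comp (γ := S) hZ hSm).symm
  rw [h3, connector_smul, covDerivMap_eq cov hcov hf hΦ hγ hε hP, mul_smul]
  congr 1
  have hζ : MDifferentiableAt 𝓘(ℝ, ℝ) (I.prod 𝓘(ℝ, F))
      (sectionCurve F (fun t => f (γ t)) fun t => Φ (γ t) (P t)) 0 :=
    (hΦ.mdifferentiable (by simp) _).comp (0 : ℝ) hPm
  rw [← (covAlong_const_smul cov hζ r).2]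
  exact covAlong_congr cov (σ := fun t => f (γ t)) (η := fun t => Φ (γ t) (r • P t))
    (ζ := fun t => r • Φ (γ t) (P t)) (Filter.Eventually.of_forall fun t => map_smul _ _ _)

end CovDerivMap

section CovDerivNorm

variable {E : Type*} [NormedAddCommGroup E] [NormedSpace ℝ E] [FiniteDimensional ℝ E]
  {H : Type*} [TopologicalSpace H] {I : ModelWithCorners ℝ E H} [I.Boundaryless]
  {M : Type*} [TopologicalSpace M] [ChartedSpace H M] [IsManifold I ∞ M]
  [RiemannianBundle (fun x : M => TangentSpace I x)]
  [IsContMDiffRiemannianBundle I ∞ E (fun x : M => TangentSpace I x)]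
  {F : Type*} [NormedAddCommGroup F] [NormedSpace ℝ F] [FiniteDimensional ℝ F]
  {V : M → Type*} [TopologicalSpace (TotalSpace F V)]
  [∀ x, NormedAddCommGroup (V x)] [∀ x, InnerProductSpace ℝ (V x)]
  [FiberBundle F V] [VectorBundle ℝ F V] [ContMDiffVectorBundle ∞ F V I]
  [IsContMDiffRiemannianBundle I ∞ F V]
  (cov : CovariantDerivative I F V)
  [T2Space M] [cov.ContMDiffCovariantDerivative ∞]
  {f : M → M} {Φ : ∀ m, V m →L[ℝ] V (f m)} {a b : ℝ}

theorem exists_curve_velocity_eq {E : Type*} [NormedAddCommGroup E] [NormedSpace ℝ E]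
    {H : Type*} [TopologicalSpace H] {I : ModelWithCorners ℝ E H} [I.Boundaryless]
    {M : Type*} [TopologicalSpace M] [ChartedSpace H M] [IsManifold I ∞ M]
    (x : M) (v : TangentSpace I x) : ∃ γ : ℝ → M, ContMDiffAt 𝓘(ℝ, ℝ) I 1 γ 0 ∧ γ 0 = x ∧
      (velocity I γ 0 : E) = v := by
  set v' : E := mvfderiv I (extChartAt I x) x v with hv'
  set γ : ℝ → M := fun t => (extChartAt I x).symm (extChartAt I x x + t • v') with hγ
  have h0 : γ 0 = x := by simp [hγ]
  have hsm : ContMDiffAt 𝓘(ℝ, ℝ) I 1 γ 0 := by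
    have h1 : ContMDiffAt 𝓘(ℝ, E) I 1 (extChartAt I x).symm (extChartAt I x x + (0 : ℝ) • v') :=
      (contMDiffOn_extChartAt_symm x).contMDiffAt
        ((isOpen_extChartAt_target x).mem_nhds (by simp))
    have h2 : ContDiff ℝ 1 fun t : ℝ => extChartAt I x x + t • v' := by fun_prop
    exact ContMDiffAt.comp (0 : ℝ) h1 h2.contMDiff.contMDiffAt
  refine ⟨γ, hsm, h0, ?_⟩
  have h3 : mvfderiv I (extChartAt I x) (γ 0) (velocity I γ 0) = v' := by
    have h4 := hasDerivAt_comp_curve (g := extChartAt I x) (γ := γ)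
      (mdifferentiableAt_extChartAt (by rw [h0]; exact mem_chart_source H x))
      (hsm.mdifferentiableAt (by simp))
    have h5 : (fun t => extChartAt I x (γ t)) =ᶠ[𝓝 0] fun t => extChartAt I x x + t • v' := by
      have h6 : ContinuousAt (fun t : ℝ => extChartAt I x x + t • v') 0 := by fun_prop
      have hm : extChartAt I x x + (0 : ℝ) • v' ∈ (extChartAt I x).target := by simp
      filter_upwards [h6.eventually ((isOpen_extChartAt_target (I := I) x).mem_nhds hm)] with t ht
      exact (extChartAt I x).right_inv ht
    have h7 : HasDerivAt (fun t : ℝ => extChartAt I x x + t • v') v' 0 := by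
      simpa using ((hasDerivAt_id (0 : ℝ)).smul_const v').const_add (extChartAt I x x)
    exact h4.unique (h7.congr_of_eventuallyEq h5)
  have key : ∀ y : M, y = x → ∀ u : TangentSpace I y, mvfderiv I (extChartAt I x) y u = v' →
      (u : E) = v := by
    rintro y rfl u hu
    exact (isInvertible_mfderiv_extChartAt (I := I) (mem_extChartAt_source (I := I) y)).injective
      (hu.trans hv')
  exact key (γ 0) h0 _ h3

/-- The supremum defining `|∇Φ|` bounds the covariant derivative of the image under `Φ` of a curve,
at a time when the covariant derivative of the curve vanishes. -/
theorem enorm_connector_mfderiv_totalMap_le (hcov : cov.IsMetricCompatible) (hf : ContMDiff I I 1 f)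
    (hΦ : ContMDiff (I.prod 𝓘(ℝ, F)) (I.prod 𝓘(ℝ, F)) 1 (totalMap F f Φ))
    {e : TotalSpace F V} {w : TangentSpace (I.prod 𝓘(ℝ, F)) e} (hw : connector cov e w = 0) :
    ‖(connector cov (totalMap F f Φ e)
      (mfderiv (I.prod 𝓘(ℝ, F)) (I.prod 𝓘(ℝ, F)) (totalMap F f Φ) e w) : V (f e.proj))‖ₑ ≤
        covDerivNorm cov f (fun m => Φ m) e.proj * ‖e.2‖ₑ * ‖projDeriv I e w‖ₑ := by
  by_cases hv : projDeriv I e w = 0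
  · have h0 : w = 0 := eq_of_projDeriv_eq_of_connector_eq cov
      (hv.trans (map_zero _).symm) (hw.trans (connector_zero cov e).symm)
    rw [h0, map_zero, connector_zero, enorm_zero]
    exact zero_le
  obtain ⟨x, e⟩ := e
  obtain ⟨γ, hγ, rfl, hvel⟩ := exists_curve_velocity_eq x
    (‖projDeriv I (⟨x, e⟩ : TotalSpace F V) w‖⁻¹ • projDeriv I (⟨x, e⟩ : TotalSpace F V) w)
  obtain ⟨r, u, hr, hru, rfl⟩ : ∃ (r : ℝ) (u : V (γ 0)), 0 ≤ r ∧ (r = 0 ∨ ‖u‖ = 1) ∧ r • u = e := by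
    rcases eq_or_ne e 0 with rfl | he
    · exact ⟨0, 0, le_rfl, Or.inl rfl, by simp⟩
    · refine ⟨‖e‖, ‖e‖⁻¹ • e, norm_nonneg _, Or.inr ?_, ?_⟩
      · rw [norm_smul, norm_inv, norm_norm, inv_mul_cancel₀ (norm_ne_zero_iff.2 he)]
      · rw [smul_inv_smul₀ (norm_ne_zero_iff.2 he)]
  set k := ‖projDeriv I (⟨γ 0, r • u⟩ : TotalSpace F V) w‖ with hk
  have hk0 : k ≠ 0 := norm_ne_zero_iff.2 hv
  have hvel' : velocity I γ 0 = k⁻¹ • projDeriv I (⟨γ 0, r • u⟩ : TotalSpace F V) w := hvel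
  have hproj : projDeriv I (⟨γ 0, r • u⟩ : TotalSpace F V) w = k • velocity I γ 0 := by
    rw [hvel', smul_inv_smul₀ hk0]
  have hunit : ‖velocity I γ 0‖ = 1 := by
    rw [hvel', norm_smul, norm_inv, hk, norm_norm, inv_mul_cancel₀ hk0]
  rw [connector_mfderiv_totalMap cov hcov hf hΦ hγ u r k w hw hproj, enorm_smul]
  rcases hru with rfl | hu
  · simp
  · have h1 : ‖covDerivMap cov f (fun m => Φ m) γ u‖ₑ ≤ covDerivNorm cov f (fun m => Φ m) (γ 0) :=
      le_iSup₂_of_le γ hγ (le_iSup₂_of_le rfl hunit (le_iSup₂_of_le u hu le_rfl))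
    have h2 : ‖r • u‖ₑ = ‖r‖ₑ := by
      rw [enorm_smul, ← ofReal_norm u, hu, ENNReal.ofReal_one, mul_one]
    have h3 : ‖projDeriv I (⟨γ 0, r • u⟩ : TotalSpace F V) w‖ₑ = ‖k‖ₑ := by
      rw [hk, enorm_norm]
    rw [h2, h3, enorm_mul]
    calc ‖k‖ₑ * ‖r‖ₑ * ‖covDerivMap cov f (fun m => Φ m) γ u‖ₑ
        ≤ ‖k‖ₑ * ‖r‖ₑ * covDerivNorm cov f (fun m => Φ m) (γ 0) := by gcongr
      _ = _ := by ring

/-- The covariant derivative along a curve of the image of a parallel section. -/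
theorem ae_enorm_covAlong_totalMap_le (hcov : cov.IsMetricCompatible) (hf : ContMDiff I I 1 f)
    (hΦ : ContMDiff (I.prod 𝓘(ℝ, F)) (I.prod 𝓘(ℝ, F)) 1 (totalMap F f Φ))
    {σ : ℝ → M} {η : ∀ t, V (σ t)} (hη : IsParallelOn cov σ η a b) :
    ∀ᵐ t : ℝ, t ∈ uIcc a b → ‖(covAlong cov (sectionCurve F (fun t => f (σ t))
      (fun t => Φ (σ t) (η t))) t : V (f (σ t)))‖ₑ ≤
        covDerivNorm cov f (fun m => Φ m) (σ t) * ‖η t‖ₑ * ‖velocity I σ t‖ₑ := by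
  filter_upwards [hη.2, hη.1.ae_mdifferentiableAt] with t h1 h2 ht
  have h3 := enorm_connector_mfderiv_totalMap_le cov hcov hf hΦ (e := ⟨σ t, η t⟩)
    (w := velocity (I.prod 𝓘(ℝ, F)) (sectionCurve F σ η) t) (h1 ht)
  have h4 := velocity_proj (h2 ht)
  rw [h4] at h3
  have h5 := velocity_comp (γ := sectionCurve F σ η) (hΦ.mdifferentiable (by simp) _) (h2 ht)
  rw [← h5] at h3
  exact h3

end CovDerivNorm

/-! ### The effect of a bundle map on the distance along a path -/

/-- The elementary inequality behind the estimate along a path. -/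
theorem _root_.ENNReal.sqrt_sq_add_sq_le {A C l w : ℝ≥0∞} :
    ((A * l) ^ 2 + (A * w + C * l) ^ 2) ^ (1 / 2 : ℝ) ≤
      (A + C) * (l ^ 2 + w ^ 2) ^ (1 / 2 : ℝ) := by
  have h1 : ((A + C) ^ 2) ^ (1 / 2 : ℝ) = A + C := by
    rw [← ENNReal.rpow_natCast, ← ENNReal.rpow_mul]
    norm_num
  rw [← h1, ← ENNReal.mul_rpow_of_nonneg _ _ (by norm_num)]
  refine ENNReal.rpow_le_rpow ?_ (by norm_num)
  have h2 : 2 * l * w ≤ l ^ 2 + w ^ 2 := by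
    rcases eq_or_ne l ⊤ with rfl | hl
    · simp
    rcases eq_or_ne w ⊤ with rfl | hw
    · simp
    lift l to NNReal using hl
    lift w to NNReal using hw
    exact_mod_cast two_mul_le_add_sq l w
  calc (A * l) ^ 2 + (A * w + C * l) ^ 2
      = A ^ 2 * (l ^ 2 + w ^ 2) + A * C * (2 * l * w) + C ^ 2 * l ^ 2 := by ring
    _ ≤ A ^ 2 * (l ^ 2 + w ^ 2) + 2 * (A * C * (l ^ 2 + w ^ 2)) + C ^ 2 * (l ^ 2 + w ^ 2) := by
        refine add_le_add (add_le_add le_rfl ?_) (mul_le_mul_right le_self_add _)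
        refine (mul_le_mul_right h2 _).trans ?_
        rw [two_mul]
        exact le_self_add
    _ = (A + C) ^ 2 * (l ^ 2 + w ^ 2) := by ring

theorem enorm_le_fiberNorm_mul {M : Type*} {V : M → Type*} [∀ x, NormedAddCommGroup (V x)]
    [∀ x, NormedSpace ℝ (V x)] {f : M → M} (Φ : ∀ m, V m →ₗ[ℝ] V (f m)) (m : M) (e : V m) :
    ‖Φ m e‖ₑ ≤ fiberNorm (fun m => Φ m) m * ‖e‖ₑ := by
  rcases eq_or_ne e 0 with rfl | he
  · simp
  have he' : ‖e‖ ≠ 0 := norm_ne_zero_iff.2 he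
  have h1 : ‖Φ m (‖e‖⁻¹ • e)‖ₑ ≤ fiberNorm (fun m => Φ m) m :=
    le_iSup₂_of_le (‖e‖⁻¹ • e) (by rw [norm_smul, norm_inv, norm_norm, inv_mul_cancel₀ he']) le_rfl
  have h2 : Φ m e = ‖e‖ • Φ m (‖e‖⁻¹ • e) := by rw [← map_smul, smul_inv_smul₀ he']
  rw [h2, enorm_smul, enorm_norm, mul_comm]
  gcongr

theorem le_supAlong {M : Type*} (ρ : M → ℝ≥0∞) (σ : ℝ → M) {t : ℝ} (ht : t ∈ Icc (0 : ℝ) 1) :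
    ρ (σ t) ≤ supAlong ρ σ :=
  le_iSup₂_of_le (f := fun t (_ : t ∈ Icc (0 : ℝ) 1) => ρ (σ t)) t ht le_rfl

section Path

variable {E : Type*} [NormedAddCommGroup E] [NormedSpace ℝ E] [FiniteDimensional ℝ E]
  {H : Type*} [TopologicalSpace H] {I : ModelWithCorners ℝ E H} [I.Boundaryless]
  {M : Type*} [TopologicalSpace M] [ChartedSpace H M] [IsManifold I ∞ M]
  [RiemannianBundle (fun x : M => TangentSpace I x)]
  [IsContMDiffRiemannianBundle I ∞ E (fun x : M => TangentSpace I x)]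
  {F : Type*} [NormedAddCommGroup F] [NormedSpace ℝ F] [FiniteDimensional ℝ F]
  {V : M → Type*} [TopologicalSpace (TotalSpace F V)]
  [∀ x, NormedAddCommGroup (V x)] [∀ x, InnerProductSpace ℝ (V x)]
  [FiberBundle F V] [VectorBundle ℝ F V] [ContMDiffVectorBundle ∞ F V I]
  [IsContMDiffRiemannianBundle I ∞ F V]
  (cov : CovariantDerivative I F V)
  {f : M → M} {Φ : ∀ m, V m →L[ℝ] V (f m)} {σ : ℝ → M}

theorem aemeasurable_enorm_velocity (hσ : IsACOn I σ 0 1) :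
    AEMeasurable (fun t => ‖velocity I σ t‖ₑ) (volume.restrict (Icc (0 : ℝ) 1)) := by
  have := (integrableOn_norm_velocity zero_le_one hσ).aestronglyMeasurable
  simpa only [ofReal_norm] using this.aemeasurable.ennreal_ofReal

theorem baseLength_comp_le (hf : ContMDiff I I 1 f) (hσ : IsACOn I σ 0 1) :
    baseLength I (fun t => f (σ t)) ≤ supAlong (fiberNorm (V := fun x : M => TangentSpace I x)
      (fun m => mfderiv I I f m)) σ * baseLength I σ := by
  rw [baseLength, baseLength, ← lintegral_const_mul'' _ (aemeasurable_enorm_velocity hσ)]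
  refine setLIntegral_mono_ae' measurableSet_Icc ?_
  have h := hσ.ae_mdifferentiableAt
  rw [uIcc_of_le zero_le_one] at h
  filter_upwards [h] with t h1 ht
  rw [velocity_comp (hf.mdifferentiable (by simp) _) (h1 ht)]
  refine (enorm_le_fiberNorm_mul (V := fun x : M => TangentSpace I x)
    (fun m => (mfderiv I I f m : TangentSpace I m →ₗ[ℝ] TangentSpace I (f m))) (σ t) _).trans ?_
  gcongr
  exact le_supAlong (fiberNorm (V := fun x : M => TangentSpace I x)
      (fun m => mfderiv I I f m)) σ ht

variable [T2Space M] [cov.ContMDiffCovariantDerivative ∞]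

/-- The image of a parallel section `η` along `σ` is nearly parallel along `f ∘ σ`, with error
controlled by `|∇Φ|`, which bounds the change of the fiber part of the distance. -/
theorem pathDist_totalMap_le (hcov : cov.IsMetricCompatible) (hf : ContMDiff I I 1 f)
    (hΦ : ContMDiff (I.prod 𝓘(ℝ, F)) (I.prod 𝓘(ℝ, F)) 1 (totalMap F f Φ))
    (hσ : IsACOn I σ 0 1) (e : V (σ 0)) (e' : V (σ 1)) :
    pathDist cov (fun t => f (σ t)) (Φ (σ 0) e) (Φ (σ 1) e') ≤
      (max (supAlong (fiberNorm (V := fun x : M => TangentSpace I x)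
            (fun m => mfderiv I I f m)) σ)
          (fiberNorm (fun m => Φ m) (σ 0))
        + supAlong (covDerivNorm cov f (fun m => Φ m)) σ * ‖e'‖ₑ) * pathDist cov σ e e' := by
  set A := max (supAlong (fiberNorm (V := fun x : M => TangentSpace I x)
    (fun m => mfderiv I I f m)) σ) (fiberNorm (fun m => Φ m) (σ 0))
  set B := supAlong (covDerivNorm cov f (fun m => Φ m)) σ
  have hfσ : IsACOn I (fun t => f (σ t)) 0 1 := hσ.comp fun t _ => hf.contMDiffAt
  obtain ⟨η, hη, rfl⟩ := exists_isParallelOn cov zero_le_one hσ (right_mem_Icc.2 zero_le_one) e'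
  obtain ⟨θ, hθ, hθ1⟩ := exists_isParallelOn cov zero_le_one hfσ (right_mem_Icc.2 zero_le_one)
    (Φ (σ 1) (η 1))
  have hζ : IsACOn (I.prod 𝓘(ℝ, F))
      (sectionCurve F (fun t => f (σ t)) fun t => Φ (σ t) (η t)) 0 1 :=
    hη.1.comp fun t _ => hΦ.contMDiffAt
  have h1 := (enorm_sub_le_add_lintegral_covAlong cov hcov zero_le_one hθ hζ).2
  rw [hθ1, sub_self, enorm_zero, zero_add] at h1
  have h2 : ∫⁻ t in Icc (0 : ℝ) 1, ‖(covAlong cov (sectionCurve F (fun t => f (σ t))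
      fun t => Φ (σ t) (η t)) t : V (f (σ t)))‖ₑ ≤ B * ‖η 1‖ₑ * baseLength I σ := by
    rw [baseLength, ← lintegral_const_mul'' _ (aemeasurable_enorm_velocity hσ)]
    refine setLIntegral_mono_ae' measurableSet_Icc ?_
    have h := ae_enorm_covAlong_totalMap_le cov hcov hf hΦ hη
    rw [uIcc_of_le zero_le_one] at h
    filter_upwards [h] with t h3 ht
    refine (h3 ht).trans ?_
    have h4 : ‖η t‖ₑ = ‖η 1‖ₑ := by
      refine IsParallelOn.enorm_eq cov hcov (hη.mono cov ?_)
      rw [uIcc_of_le ht.2, uIcc_of_le zero_le_one]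
      exact Icc_subset_Icc_left ht.1
    rw [h4]
    gcongr
    exact le_supAlong _ σ ht
  have h3 : ‖θ 0 - Φ (σ 0) e‖ₑ ≤ A * ‖η 0 - e‖ₑ + B * ‖η 1‖ₑ * baseLength I σ := by
    have h4 : θ 0 - Φ (σ 0) e = Φ (σ 0) (η 0 - e) + -(Φ (σ 0) (η 0) - θ 0) := by
      rw [map_sub]; abel
    rw [h4]
    refine (enorm_add_le _ _).trans ?_
    rw [enorm_neg]
    refine add_le_add ((enorm_le_fiberNorm_mul
      (fun m => (Φ m : V m →ₗ[ℝ] V (f m))) (σ 0) _).trans ?_) (h1.trans h2)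
    gcongr
    exact le_max_right _ _
  rw [pathDist, pathDist, ← hθ1, IsParallelOn.parallelTransport_eq cov hcov hθ.symm,
    IsParallelOn.parallelTransport_eq cov hcov hη.symm]
  refine le_trans ?_ ENNReal.sqrt_sq_add_sq_le
  gcongr
  exact (baseLength_comp_le hf hσ).trans (by gcongr; exact le_max_left _ _)

end Path

/-! ### Functions with bounded differential -/

theorem _root_.IsCompact.exists_uniform_bound {X : Type*} [TopologicalSpace X] {K : Set X}
    (hK : IsCompact K) {P : X → ℝ → Prop} (hmono : ∀ x C D, C ≤ D → P x C → P x D)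
    (h : ∀ x ∈ K, ∃ C, ∀ᶠ y in 𝓝 x, P y C) : ∃ C, ∀ x ∈ K, P x C := by
  refine hK.induction_on (p := fun s => ∃ C, ∀ x ∈ s, P x C) ⟨0, by simp⟩
    (fun s t hst ⟨C, hC⟩ => ⟨C, fun x hx => hC x (hst hx)⟩) ?_ ?_
  · rintro s t ⟨C, hC⟩ ⟨D, hD⟩
    refine ⟨max C D, fun x hx => ?_⟩
    rcases hx with hx | hx
    exacts [hmono _ _ _ (le_max_left _ _) (hC x hx), hmono _ _ _ (le_max_right _ _) (hD x hx)]
  · intro x hx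
    obtain ⟨C, hC⟩ := h x hx
    exact ⟨_, nhdsWithin_le_nhds hC, C, fun y hy => hy⟩

section LipschitzFunctions

variable {E : Type*} [NormedAddCommGroup E] [NormedSpace ℝ E] [FiniteDimensional ℝ E]
  {H : Type*} [TopologicalSpace H] {I : ModelWithCorners ℝ E H} [I.Boundaryless]
  {M : Type*} [TopologicalSpace M] [ChartedSpace H M] [IsManifold I ∞ M]
  [RiemannianBundle (fun x : M => TangentSpace I x)]
  [IsContMDiffRiemannianBundle I ∞ E (fun x : M => TangentSpace I x)]

theorem mvfderiv_extChartAt_eq {p x : M} (hx : x ∈ (chartAt H p).source) (w : TangentSpace I x) :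
    mvfderiv I (extChartAt I p) x w =
      (trivializationAt E (fun x : M => TangentSpace I x) p).continuousLinearMapAt ℝ x w :=
  (DFunLike.congr_fun (TangentBundle.continuousLinearMapAt_trivializationAt (𝕜 := ℝ) (I := I) hx)
    w).symm

/-- The differential of a `C¹` function is locally bounded. -/
theorem eventually_norm_mvfderiv_le {h : M → ℝ} (hh : ContMDiff I 𝓘(ℝ, ℝ) 1 h) (p : M) :
    ∃ C, ∀ᶠ x in 𝓝 p, ∀ w : TangentSpace I x, ‖mvfderiv I h x w‖ ≤ C * ‖w‖ := by
  have := isContinuousRiemannianBundle (I := I) E (fun x : M => TangentSpace I x)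
  obtain ⟨K, hK, hKev⟩ := eventually_norm_trivializationAt_lt E (fun x : M => TangentSpace I x) p
  set g : E → ℝ := h ∘ (extChartAt I p).symm with hg
  have hgc : ContDiffOn ℝ 1 g (extChartAt I p).target := by
    rw [← contMDiffOn_iff_contDiffOn]
    exact hh.comp_contMDiffOn (contMDiffOn_extChartAt_symm p)
  have hcont : ContinuousAt (fderiv ℝ g) (extChartAt I p p) :=
    (hgc.continuousOn_fderiv_of_isOpen (isOpen_extChartAt_target p) le_rfl).continuousAt
      ((isOpen_extChartAt_target p).mem_nhds (mem_extChartAt_target p))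
  have hbd : ∀ᶠ x in 𝓝 p, ‖fderiv ℝ g (extChartAt I p x)‖ < ‖fderiv ℝ g (extChartAt I p p)‖ + 1 :=
    (continuousAt_extChartAt (I := I) p).eventually
      (hcont.norm.eventually (Iio_mem_nhds (lt_add_one _)))
  refine ⟨(‖fderiv ℝ g (extChartAt I p p)‖ + 1) * K, ?_⟩
  filter_upwards [hKev, hbd, ((chartAt H p).open_source.eventually_mem
    (mem_chart_source H p)).eventually_nhds] with x h1 h2 h3 w
  have hx := h3.self_of_nhds
  have hmem : extChartAt I p x ∈ (extChartAt I p).target :=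
    (extChartAt I p).map_source (by rwa [extChartAt_source])
  have hgd : DifferentiableAt ℝ g (extChartAt I p x) :=
    (hgc.differentiableOn (by simp)).differentiableAt ((isOpen_extChartAt_target p).mem_nhds hmem)
  have heq : h =ᶠ[𝓝 x] fun y => g (extChartAt I p y) := by
    filter_upwards [h3] with y hy
    rw [hg, Function.comp_apply, (extChartAt I p).left_inv (by rwa [extChartAt_source])]
  have h4 : mvfderiv I h x w = fderiv ℝ g (extChartAt I p x)
      ((trivializationAt E (fun x : M => TangentSpace I x) p).continuousLinearMapAt ℝ x w) := by
    have h5 : mvfderiv I h x = mvfderiv I (fun y => g (extChartAt I p y)) x := heq.mfderiv_eq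
    rw [h5, mvfderiv_comp_vector (I' := 𝓘(ℝ, E)) hgd.mdifferentiableAt
        (mdifferentiableAt_extChartAt hx),
      ← mvfderiv_extChartAt_eq hx]
    exact DFunLike.congr_fun mfderiv_eq_fderiv _
  rw [h4, mul_assoc]
  refine (ContinuousLinearMap.le_of_opNorm_le _ h2.le _).trans ?_
  gcongr
  exact ContinuousLinearMap.le_of_opNorm_le _ h1.le w

theorem exists_norm_mvfderiv_le {h : M → ℝ} (hh : ContMDiff I 𝓘(ℝ, ℝ) 1 h)
    (hsupp : HasCompactSupport h) :
    ∃ C > 0, ∀ x, ∀ w : TangentSpace I x, ‖mvfderiv I h x w‖ ≤ C * ‖w‖ := by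
  obtain ⟨C, hC⟩ := IsCompact.exists_uniform_bound hsupp.isCompact
    (P := fun x C => ∀ w : TangentSpace I x, ‖mvfderiv I h x w‖ ≤ C * ‖w‖)
    (fun x C D hCD h1 w => (h1 w).trans (by gcongr)) fun x _ => eventually_norm_mvfderiv_le hh x
  refine ⟨max C 1, by positivity, fun x w => ?_⟩
  by_cases hx : x ∈ tsupport h
  · exact (hC x hx w).trans (by gcongr; exact le_max_left _ _)
  · have h0 : h =ᶠ[𝓝 x] fun _ => 0 := notMem_tsupport_iff_eventuallyEq.1 hx
    have h1 : mvfderiv I h x = 0 := h0.mfderiv_eq.trans mfderiv_const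
    rw [h1]
    simp only [zero_apply, norm_zero]
    positivity

/-- A function with differential bounded by `K` is `K`-Lipschitz for the Riemannian distance. -/
theorem enorm_sub_le_mul_baseDist {h : M → ℝ} (hh : ContMDiff I 𝓘(ℝ, ℝ) 1 h) {K : ℝ} (hK : 0 < K)
    (hbd : ∀ x, ∀ w : TangentSpace I x, ‖mvfderiv I h x w‖ ≤ K * ‖w‖) (x y : M) :
    ‖h y - h x‖ₑ ≤ ENNReal.ofReal K * baseDist I x y := by
  have hK0 : ENNReal.ofReal K ≠ 0 := by simpa using hK
  rw [mul_comm, ← ENNReal.div_le_iff hK0 ENNReal.ofReal_ne_top]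
  refine le_iInf fun σ => le_iInf fun hσ => le_iInf fun h0 => le_iInf fun h1 => ?_
  rw [ENNReal.div_le_iff hK0 ENNReal.ofReal_ne_top, mul_comm, ← h0, ← h1, baseLength,
    ← lintegral_const_mul' _ _ ENNReal.ofReal_ne_top]
  refine (enorm_sub_le_lintegral_deriv zero_le_one
    (hσ.comp_real (G := h) fun t _ => hh.contMDiffAt)).trans
    (setLIntegral_mono_ae' measurableSet_Icc ?_)
  have hae := hσ.ae_mdifferentiableAt
  rw [uIcc_of_le zero_le_one] at hae
  filter_upwards [hae] with t ht htm
  rw [(hasDerivAt_comp_curve (hh.mdifferentiable (by simp) _) (ht htm)).deriv, ← ofReal_norm,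
    ← ofReal_norm, ← ENNReal.ofReal_mul hK.le]
  exact ENNReal.ofReal_le_ofReal (hbd _ _)

variable [T2Space M]

theorem eq_of_baseDist_eq_zero {x y : M} (hxy : baseDist I x y = 0) : x = y := by
  by_contra hne
  obtain ⟨χ, -, hχ⟩ := (SmoothBumpFunction.nhds_basis_tsupport (I := I) x).mem_iff.1
    (compl_singleton_mem_nhds hne)
  obtain ⟨C, hC, hbd⟩ := exists_norm_mvfderiv_le (χ.contMDiff.of_le (by simp)) χ.hasCompactSupport
  have h := enorm_sub_le_mul_baseDist (χ.contMDiff.of_le (by simp)) hC hbd x y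
  rw [hxy, mul_zero, nonpos_iff_eq_zero, enorm_eq_zero, χ.eq_one,
    image_eq_zero_of_notMem_tsupport (fun hy => hχ hy rfl)] at h
  norm_num at h

/-- A nearly optimal function detecting the length of a given tangent vector. Near the given point
it is `δ sin (ψ / δ)` for a linear function `ψ` in a chart and a small `δ`, so that it can be cut
off at the cost of a small derivative. -/
theorem exists_contMDiff_mvfderiv_eq_norm (q : M) (u : TangentSpace I q) {r : ℝ} (hr : 1 < r) :
    ∃ h : M → ℝ, ContMDiff I 𝓘(ℝ, ℝ) 1 h ∧ mvfderiv I h q u = ‖u‖ ∧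
      ∀ x, ∀ w : TangentSpace I x, ‖mvfderiv I h x w‖ ≤ r * ‖w‖ := by
  have := isContinuousRiemannianBundle (I := I) E (fun x : M => TangentSpace I x)
  set T := trivializationAt E (fun x : M => TangentSpace I x) q
  obtain ⟨r', hr', hr'r⟩ := exists_between hr
  have hU := (eventually_norm_symmL_trivializationAt_self_comp_lt E
    (fun x : M => TangentSpace I x) q hr').and
      ((chartAt H q).open_source.eventually_mem (mem_chart_source H q))
  obtain ⟨χ, -, hχ⟩ := (SmoothBumpFunction.nhds_basis_tsupport (I := I) q).mem_iff.1 hU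
  obtain ⟨C, hC, hCbd⟩ := exists_norm_mvfderiv_le (χ.contMDiff.of_le (by simp)) χ.hasCompactSupport
  set δ := (r - r') / C with hδ
  have hδ0 : 0 < δ := div_pos (by linarith) hC
  set lin : E →L[ℝ] ℝ := (innerSL ℝ (‖u‖⁻¹ • u)).comp (T.symmL ℝ q) with hlin
  set ψ : M → ℝ := fun x => lin (extChartAt I q x - extChartAt I q q) with hψ
  have hψm : ∀ x ∈ (chartAt H q).source, ContMDiffAt I 𝓘(ℝ, ℝ) ∞ ψ x := fun x hx =>
    (lin.contMDiff (n := ∞)).contMDiffAt.comp x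
      ((contMDiffAt_extChartAt' hx).sub contMDiffAt_const)
  have hψd : ∀ x ∈ (chartAt H q).source, ∀ w : TangentSpace I x, mvfderiv I ψ x w =
      inner ℝ (‖u‖⁻¹ • u) (T.symmL ℝ q (T.continuousLinearMapAt ℝ x w)) := by
    intro x hx w
    obtain ⟨γ, hγ, rfl, rfl⟩ := exists_curve_velocity_eq x w
    have hγ' := hγ.mdifferentiableAt (by simp)
    have h1 := hasDerivAt_comp_curve ((hψm _ hx).mdifferentiableAt (by simp)) hγ'
    have h2 := (hasDerivAt_comp_curve (mdifferentiableAt_extChartAt (I := I) hx) hγ').sub_const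
      (extChartAt I q q)
    rw [h1.unique (lin.hasFDerivAt.comp_hasDerivAt (0 : ℝ) h2), mvfderiv_extChartAt_eq hx]
    rfl
  have hψq : ψ q = 0 := by simp [hψ]
  set h : M → ℝ := fun x => χ x • (δ * Real.sin (ψ x / δ)) with hh
  have hsm : ContMDiff I 𝓘(ℝ, ℝ) 1 h := by
    refine (χ.contMDiff_smul fun x hx => ?_).of_le (by simp)
    have : ContDiff ℝ ∞ fun s : ℝ => δ * Real.sin (s / δ) := by fun_prop
    exact (this.contMDiff.contMDiffAt.comp x (hψm x hx)).contMDiffWithinAt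
  have hhd : ∀ x ∈ (chartAt H q).source, ∀ w : TangentSpace I x, mvfderiv I h x w =
      mvfderiv I χ x w * (δ * Real.sin (ψ x / δ)) +
        χ x * (Real.cos (ψ x / δ) * mvfderiv I ψ x w) := by
    intro x hx w
    obtain ⟨γ, hγ, rfl, rfl⟩ := exists_curve_velocity_eq x w
    have hγ' := hγ.mdifferentiableAt (by simp)
    have h1 := hasDerivAt_comp_curve (hsm.mdifferentiable (by simp) _) hγ'
    have h2 := hasDerivAt_comp_curve (χ.contMDiff.mdifferentiable (by simp) _) hγ'
    have h3 := hasDerivAt_comp_curve ((hψm _ hx).mdifferentiableAt (by simp)) hγ'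
    have h4 := h2.mul (((h3.div_const δ).sin).const_mul δ)
    refine h1.unique (h4.congr_deriv ?_)
    field_simp
  refine ⟨h, hsm, ?_, fun x w => ?_⟩
  · rw [hhd q (mem_chart_source H q), hψd q (mem_chart_source H q), hψq, χ.eq_one,
      T.symmL_continuousLinearMapAt (FiberBundle.mem_baseSet_trivializationAt' q)]
    rcases eq_or_ne u 0 with rfl | hu
    · simp
    · have := norm_ne_zero_iff.2 hu
      simp only [zero_div, Real.sin_zero, mul_zero, Real.cos_zero, one_mul, zero_add,
        real_inner_smul_left, real_inner_self_eq_norm_sq]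
      field_simp
  · by_cases hx : x ∈ tsupport χ
    · obtain ⟨hx1, hx2⟩ := hχ hx
      rw [hhd x hx2, hψd x hx2]
      have h1 : ‖inner ℝ (‖u‖⁻¹ • u) (T.symmL ℝ q (T.continuousLinearMapAt ℝ x w))‖ ≤ r' * ‖w‖ := by
        refine (norm_inner_le_norm _ _).trans ?_
        have h2 : ‖‖u‖⁻¹ • u‖ ≤ 1 := by
          rw [norm_smul, norm_inv, norm_norm]
          exact inv_mul_le_one
        have h3 := ContinuousLinearMap.le_of_opNorm_le _ hx1.le w
        calc _ ≤ 1 * (r' * ‖w‖) := mul_le_mul h2 h3 (norm_nonneg _) zero_le_one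
          _ = _ := one_mul _
      have h2 : ‖mvfderiv I χ x w * (δ * Real.sin (ψ x / δ))‖ ≤ C * ‖w‖ * δ := by
        rw [norm_mul, norm_mul, Real.norm_of_nonneg hδ0.le]
        refine mul_le_mul (hCbd x w) ?_ (by positivity) (by positivity)
        exact mul_le_of_le_one_right hδ0.le (Real.abs_sin_le_one _)
      have h3 : ∀ s, ‖χ x * (Real.cos (ψ x / δ) * s)‖ ≤ ‖s‖ := fun s => by
        rw [norm_mul, norm_mul, Real.norm_of_nonneg χ.nonneg]
        exact (mul_le_of_le_one_left (by positivity) χ.le_one).trans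
          (mul_le_of_le_one_left (norm_nonneg _) (Real.abs_cos_le_one _))
      calc _ ≤ C * ‖w‖ * δ + r' * ‖w‖ :=
            (norm_add_le _ _).trans (add_le_add h2 ((h3 _).trans h1))
        _ = r * ‖w‖ := by rw [hδ]; field_simp; ring
    · have h0 : h =ᶠ[𝓝 x] fun _ => 0 := by
        filter_upwards [notMem_tsupport_iff_eventuallyEq.1 hx] with y hy
        rw [hh]
        simp [hy]
      have h1 : mvfderiv I h x = 0 := h0.mfderiv_eq.trans mfderiv_const
      rw [h1]
      simp only [zero_apply, norm_zero]
      positivity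

end LipschitzFunctions

/-! ### Lipschitz constants, and connectedness by absolutely continuous curves -/

section Lip

variable {E : Type*} [NormedAddCommGroup E] [NormedSpace ℝ E] [FiniteDimensional ℝ E]
  {H : Type*} [TopologicalSpace H] {I : ModelWithCorners ℝ E H} [I.Boundaryless]
  {M : Type*} [TopologicalSpace M] [ChartedSpace H M] [IsManifold I ∞ M]
  [RiemannianBundle (fun x : M => TangentSpace I x)]
  [IsContMDiffRiemannianBundle I ∞ E (fun x : M => TangentSpace I x)]
  {γ : ℝ → M}

theorem continuousAt_norm_velocity (hγ : ContMDiffAt 𝓘(ℝ, ℝ) I 1 γ 0) :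
    ContinuousAt (fun t => ‖velocity I γ t‖) 0 := by
  have := isContinuousRiemannianBundle (I := I) E (fun x : M => TangentSpace I x)
  have hev := (contMDiffAt_iff_contMDiffAt_nhds (by simp)).1 hγ
  have hsrc : ∀ᶠ t in 𝓝 (0 : ℝ), γ t ∈ (chartAt H (γ 0)).source :=
    hγ.continuousAt.eventually_mem ((chartAt H (γ 0)).open_source.mem_nhds (mem_chart_source H _))
  have hc : ContDiffAt ℝ 1 (fun t => extChartAt I (γ 0) (γ t)) 0 := by
    rw [← contMDiffAt_iff_contDiffAt]
    exact (contMDiffAt_extChartAt (n := 1)).comp _ hγ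
  have hd : ContinuousAt (deriv fun t => extChartAt I (γ 0) (γ t)) 0 :=
    (hc.continuousAt_fderiv one_ne_zero).clm_apply continuousAt_const
  have hV : ContinuousAt (fun t => (⟨γ t, velocity I γ t⟩ : TangentBundle I M)) 0 := by
    refine (FiberBundle.continuousAt_totalSpace E _).2 ⟨hγ.continuousAt, hd.congr ?_⟩
    filter_upwards [hev, hsrc] with t h1 h2
    rw [(hasDerivAt_comp_curve (mdifferentiableAt_extChartAt h2)
      (h1.mdifferentiableAt (by simp))).deriv, mvfderiv_extChartAt_eq h2]
    exact (trivializationAt E (fun x : M => TangentSpace I x) (γ 0))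
      |>.continuousLinearMapAt_apply_of_mem ℝ (by simpa using h2) _
  have h := (ContinuousAt.inner_bundle (F := E) (E := fun x : M => TangentSpace I x)
    (v := fun t => velocity I γ t) (w := fun t => velocity I γ t) hV hV).sqrt
  simpa only [← norm_eq_sqrt_real_inner] using h

theorem eventually_baseDist_le (hγ : ContMDiffAt 𝓘(ℝ, ℝ) I 1 γ 0) (h1 : ‖velocity I γ 0‖ = 1)
    {r : ℝ} (hr : 1 < r) :
    ∀ᶠ t in 𝓝[>] (0 : ℝ), baseDist I (γ 0) (γ t) ≤ ENNReal.ofReal (r * t) := by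
  obtain ⟨ε, hε, hsm, -⟩ := exists_isACOn_of_contMDiffAt hγ
  have hev : ∀ᶠ t in 𝓝 (0 : ℝ), ‖velocity I γ t‖ < r :=
    (continuousAt_norm_velocity hγ).eventually (Iio_mem_nhds (h1.trans_lt hr))
  obtain ⟨ε', hε', hball⟩ := Metric.nhds_basis_closedBall.eventually_iff.1 hev
  filter_upwards [Ioc_mem_nhdsGT (lt_min hε hε')] with t ht
  have hsm' : ∀ s ∈ Icc (0 : ℝ) 1, t * s ∈ Icc (-ε) ε ∧ t * s ∈ Metric.closedBall (0 : ℝ) ε' := by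
    intro s hs
    have h2 : t * s ≤ min ε ε' := (mul_le_of_le_one_right ht.1.le hs.2).trans ht.2
    have h3 : 0 ≤ t * s := mul_nonneg ht.1.le hs.1
    refine ⟨⟨by linarith, h2.trans (min_le_left _ _)⟩, ?_⟩
    rw [mem_closedBall_zero_iff, Real.norm_of_nonneg h3]
    exact h2.trans (min_le_right _ _)
  have hm : ∀ s : ℝ, ContMDiffAt 𝓘(ℝ, ℝ) 𝓘(ℝ, ℝ) 1 (fun s => t * s) s := fun s => by
    have : ContDiff ℝ 1 fun s : ℝ => t * s := by fun_prop
    exact this.contMDiff.contMDiffAt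
  refine iInf₂_le_of_le (fun s => γ (t * s)) (isACOn_of_contMDiffAt fun s hs => ?_)
    (iInf₂_le_of_le (by simp) (by simp) ?_)
  · rw [uIcc_of_le zero_le_one] at hs
    exact (hsm _ (hsm' s hs).1).comp s (hm s)
  · calc baseLength I (fun s => γ (t * s)) ≤ ∫⁻ s in Icc (0 : ℝ) 1, ENNReal.ofReal (r * t) := by
          refine setLIntegral_mono measurable_const fun s hs => ?_
          rw [velocity_comp ((hsm _ (hsm' s hs).1).mdifferentiableAt (by simp))
            ((hm s).mdifferentiableAt (by simp))]
          have h2 : (velocity 𝓘(ℝ, ℝ) (fun s => t * s) s : ℝ) = t • (1 : ℝ) := by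
            have h4 : HasDerivAt (fun s : ℝ => t * s) (t • (1 : ℝ)) s := by
              simpa using (hasDerivAt_id s).const_mul t
            rw [← h4.deriv, ← fderiv_apply_one_eq_deriv]
            exact DFunLike.congr_fun mfderiv_eq_fderiv _
          have h3 : mfderiv 𝓘(ℝ, ℝ) I γ (t * s) (velocity 𝓘(ℝ, ℝ) (fun s => t * s) s) =
              t • velocity I γ (t * s) :=
            (congrArg (mfderiv 𝓘(ℝ, ℝ) I γ (t * s)) h2).trans (map_smul _ _ _)
          rw [h3, ← ofReal_norm, norm_smul, Real.norm_of_nonneg ht.1.le, mul_comm]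
          refine ENNReal.ofReal_le_ofReal (mul_le_mul_of_nonneg_right ?_ ht.1.le)
          exact (hball (hsm' s hs).2).le
      _ = ENNReal.ofReal (r * t) := by simp

variable [T2Space M] {f : M → M}

theorem baseDist_le_lip_mul {x y : M} (hxy : baseDist I x y ≠ ⊤)
    (hne : x ≠ y) : baseDist I (f x) (f y) ≤ lip I f * baseDist I x y := by
  rw [← ENNReal.div_le_iff (fun h => hne (eq_of_baseDist_eq_zero h)) hxy]
  exact le_iSup₂_of_le x y (le_iSup_of_le hne le_rfl)

/-- The differential of `f` is bounded by the Lipschitz constant of `f`: along a curve `γ` with unit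
initial velocity `v`, compare `f (γ t)` with `f (γ 0)` by means of a function with almost unit
differential, whose derivative in the direction `f_* v` is `|f_* v|`. -/
theorem fiberNorm_mfderiv_le_lip (hf : ContMDiff I I 1 f) (m : M) :
    fiberNorm (V := fun x : M => TangentSpace I x) (fun m => mfderiv I I f m) m ≤ lip I f := by
  refine iSup₂_le fun v hv => ?_
  by_cases hlip : lip I f = ⊤
  · rw [hlip]; exact le_top
  obtain ⟨γ, hγ, rfl, rfl⟩ := exists_curve_velocity_eq m v
  have hγ' := hγ.mdifferentiableAt (by simp)
  set u : TangentSpace I (f (γ 0)) := mfderiv I I f (γ 0) (velocity I γ 0) with hu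
  set L := (lip I f).toReal with hL
  have hL0 : 0 ≤ L := ENNReal.toReal_nonneg
  have key : ∀ r > (1 : ℝ), ‖u‖ ≤ r * r * L := by
    intro r hr
    obtain ⟨h, hh, hhu, hbd⟩ := exists_contMDiff_mvfderiv_eq_norm (f (γ 0)) u hr
    have hhf : MDifferentiableAt I 𝓘(ℝ, ℝ) (fun x => h (f x)) (γ 0) :=
      (hh.comp hf).mdifferentiable (by simp) _
    have hder := hasDerivAt_comp_curve hhf hγ'
    rw [mvfderiv_comp_vector (hh.mdifferentiable (by simp) _) (hf.mdifferentiable (by simp) _),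
      ← hu, hhu] at hder
    have hlim := hder.tendsto_slope_zero_right
    refine le_of_tendsto hlim ?_
    filter_upwards [eventually_baseDist_le hγ hv hr, self_mem_nhdsWithin] with t ht htpos
    have htpos : 0 < t := htpos
    rw [zero_add, smul_eq_mul, inv_mul_le_iff₀ htpos]
    by_cases hne : γ 0 = γ t
    · rw [← hne, sub_self]
      positivity
    have h1 := enorm_sub_le_mul_baseDist hh (by linarith) hbd (f (γ 0)) (f (γ t))
    have h2 := baseDist_le_lip_mul (f := f) (ht.trans_lt ENNReal.ofReal_lt_top).ne hne
    have h3 : ‖h (f (γ t)) - h (f (γ 0))‖ₑ ≤ ENNReal.ofReal (t * (r * r * L)) := by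
      calc _ ≤ ENNReal.ofReal r * (ENNReal.ofReal L * ENNReal.ofReal (r * t)) := by
            refine h1.trans (mul_le_mul_right (h2.trans ?_) _)
            rw [hL, ENNReal.ofReal_toReal hlip]
            gcongr
        _ = _ := by
            rw [← ENNReal.ofReal_mul hL0, ← ENNReal.ofReal_mul (by linarith)]
            congr 1; ring
    rw [← ofReal_norm, ENNReal.ofReal_le_ofReal_iff (by positivity)] at h3
    exact (Real.le_norm_self _).trans h3
  have hlim : Filter.Tendsto (fun r : ℝ => r * r * L) (𝓝[>] 1) (𝓝 L) := by
    have h1 : Continuous fun r : ℝ => r * r * L := by fun_prop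
    have h2 := h1.tendsto 1
    simp only [one_mul] at h2
    exact h2.mono_left nhdsWithin_le_nhds
  have h1 : ‖u‖ ≤ L := ge_of_tendsto hlim (by
    filter_upwards [self_mem_nhdsWithin] with r hr using key r hr)
  rw [← ofReal_norm, ← ENNReal.ofReal_toReal hlip]
  exact ENNReal.ofReal_le_ofReal h1

end Lip

section Connected

variable {E : Type*} [NormedAddCommGroup E] [NormedSpace ℝ E] [FiniteDimensional ℝ E]
  {H : Type*} [TopologicalSpace H] {I : ModelWithCorners ℝ E H} [I.Boundaryless]
  {M : Type*} [TopologicalSpace M] [ChartedSpace H M] [IsManifold I ∞ M]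

theorem isACOn_of_contMDiffOn {γ : ℝ → M} {a b : ℝ} (hab : a ≤ b)
    (h : ContMDiffOn 𝓘(ℝ, ℝ) I 1 γ (Icc a b)) : IsACOn I γ a b := by
  refine isACOn_of_locallyACAt hab h.continuousOn fun t ht => ⟨γ t, mem_extChartAt_source _, ?_⟩
  have h1 : ContDiffWithinAt ℝ 1 (fun s => extChartAt I (γ t) (γ s)) (Icc a b) t := by
    rw [← contMDiffWithinAt_iff_contDiffWithinAt]
    exact (contMDiffAt_extChartAt (n := 1)).comp_contMDiffWithinAt t (h t ht)
  obtain ⟨K, u, hu, hK⟩ := h1.exists_lipschitzOnWith (convex_Icc a b)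
  refine ⟨_, mem_nhdsWithin_iff_eventually.1 hu, fun c d hc hcd hd hsub => ?_⟩
  refine (hK.mono ?_).absolutelyContinuousOnInterval
  rw [uIcc_of_le hcd]
  exact fun s hs => hsub hs ⟨hc.trans hs.1, hs.2.trans hd⟩

theorem exists_isACOn [ConnectedSpace M] [RiemannianBundle (fun x : M => TangentSpace I x)]
    [IsContMDiffRiemannianBundle I ∞ E (fun x : M => TangentSpace I x)] (x y : M) :
    ∃ σ : ℝ → M, IsACOn I σ 0 1 ∧ σ 0 = x ∧ σ 1 = y := by
  have := isContinuousRiemannianBundle (I := I) E (fun x : M => TangentSpace I x)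
  have h : riemannianEDist I x y < ⊤ := by
    have : Std.Symm fun x y : M => riemannianEDist I x y < ⊤ :=
      ⟨fun x y h => by rwa [riemannianEDist_comm]⟩
    have : IsTrans M fun x y : M => riemannianEDist I x y < ⊤ :=
      ⟨fun x y z h1 h2 => (riemannianEDist_triangle).trans_lt (ENNReal.add_lt_top.2 ⟨h1, h2⟩)⟩
    exact PreconnectedSpace.induction₂ (fun x y : M => riemannianEDist I x y < ⊤)
      (fun x => eventually_riemannianEDist_lt I x ENNReal.zero_lt_top) this x y
  obtain ⟨σ, h0, h1, hσ, -⟩ := exists_lt_of_riemannianEDist_lt h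
  exact ⟨σ, isACOn_of_contMDiffOn zero_le_one hσ, h0, h1⟩

end Connected

/-! ### Finiteness and separation for the distance on the total space -/

section TotalDist

variable {E : Type*} [NormedAddCommGroup E] [NormedSpace ℝ E] [FiniteDimensional ℝ E]
  {H : Type*} [TopologicalSpace H] {I : ModelWithCorners ℝ E H} [I.Boundaryless]
  {M : Type*} [TopologicalSpace M] [ChartedSpace H M] [IsManifold I ∞ M]
  [RiemannianBundle (fun x : M => TangentSpace I x)]
  [IsContMDiffRiemannianBundle I ∞ E (fun x : M => TangentSpace I x)]
  {F : Type*} [NormedAddCommGroup F] [NormedSpace ℝ F] [FiniteDimensional ℝ F]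
  {V : M → Type*} [TopologicalSpace (TotalSpace F V)]
  [∀ x, NormedAddCommGroup (V x)] [∀ x, InnerProductSpace ℝ (V x)]
  [FiberBundle F V] [VectorBundle ℝ F V] [ContMDiffVectorBundle ∞ F V I]
  [IsContMDiffRiemannianBundle I ∞ F V]
  (cov : CovariantDerivative I F V)
  {σ : ℝ → M} {ξ : ℝ → TotalSpace F V}

theorem covAlong_section {s : ∀ x, V x}
    (hs : ContMDiff I (I.prod 𝓘(ℝ, F)) ∞ (fun x => (⟨x, s x⟩ : TotalSpace F V))) {t : ℝ}
    (hσ : MDifferentiableAt 𝓘(ℝ, ℝ) I σ t) :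
    covAlong cov (sectionCurve F σ fun t => s (σ t)) t = cov s (σ t) (velocity I σ t) := by
  have h := velocity_comp (f := fun x => (⟨x, s x⟩ : TotalSpace F V))
    (hs.mdifferentiable (by simp) _) hσ
  have h2 := (connector_mfderiv_section cov (hs.mdifferentiable (by simp) (σ t))
    (velocity I σ t)).2
  rw [← h] at h2
  exact h2

theorem totalDist_self (e : TotalSpace F V) : totalDist cov e e = 0 := by
  rw [← nonpos_iff_eq_zero]
  refine iInf₂_le_of_le (fun _ => e) (isACOn_of_contMDiffAt fun t _ => contMDiffAt_const)
    (iInf₂_le_of_le rfl rfl ?_)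
  have h : ∀ t, velocity (I.prod 𝓘(ℝ, F)) (fun _ => e) t = 0 := fun t => by
    rw [velocity, mfderiv_const]
    rfl
  simp only [totalLength, totalInner, h, connector_zero, inner_zero_right]
  simp [projDeriv]

variable [T2Space M] [cov.ContMDiffCovariantDerivative ∞]

theorem eventually_norm_cov_le {s : ∀ x, V x}
    (hs : ContMDiff I (I.prod 𝓘(ℝ, F)) ∞ (fun x => (⟨x, s x⟩ : TotalSpace F V))) (p : M) :
    ∃ C, ∀ᶠ x in 𝓝 p, ∀ w : TangentSpace I x, ‖cov s x w‖ ≤ C * ‖w‖ := by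
  have := isContinuousRiemannianBundle (I := I) E (fun x : M => TangentSpace I x)
  have := isContinuousRiemannianBundle (I := I) F V
  obtain ⟨K, hK, hKev⟩ := eventually_norm_trivializationAt_lt E (fun x : M => TangentSpace I x) p
  obtain ⟨K', hK', hKev'⟩ := eventually_norm_symmL_trivializationAt_lt F V p
  have h1 : ContMDiffAt I (I.prod 𝓘(ℝ, E →L[ℝ] F)) ∞ (fun x => (⟨x, cov s x⟩ :
      TotalSpace (E →L[ℝ] F) (fun x => TangentSpace I x →L[ℝ] V x))) p :=
    (CovariantDerivative.ContMDiffCovariantDerivative.contMDiff (cov := cov) (k := ∞)).contMDiff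
      (by simpa using hs.contMDiffOn) |>.contMDiffAt Filter.univ_mem
  have h2 := ((contMDiffAt_hom_bundle _).1 (h1.of_le (m := 1) (by simp))).2.continuousAt
  set A : M → E →L[ℝ] F := fun x =>
    ContinuousLinearMap.inCoordinates E (TangentSpace I : M → Type _) F V p x p x (cov s x)
  have hbd : ∀ᶠ x in 𝓝 p, ‖A x‖ < ‖A p‖ + 1 := h2.norm.eventually (Iio_mem_nhds (lt_add_one _))
  refine ⟨K' * ((‖A p‖ + 1) * K), ?_⟩
  filter_upwards [hKev, hKev', hbd, (chartAt H p).open_source.eventually_mem (mem_chart_source H p),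
    (trivializationAt F V p).open_baseSet.eventually_mem
      (FiberBundle.mem_baseSet_trivializationAt' (F := F) (E := V) p)] with x h1 h2 h3 h4 h5 w
  have h6 : cov s x w = (trivializationAt F V p).symmL ℝ x (A x ((trivializationAt E
      (fun x : M => TangentSpace I x) p).continuousLinearMapAt ℝ x w)) := by
    simp only [A, ContinuousLinearMap.inCoordinates, ContinuousLinearMap.comp_apply]
    rw [(trivializationAt F V p).symmL_continuousLinearMapAt h5]
    congr 1
    exact ((trivializationAt E (fun x : M => TangentSpace I x) p).symmL_continuousLinearMapAt
      (R := ℝ) (by simpa using h4) w).symm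
  rw [h6, mul_assoc, mul_assoc]
  refine (ContinuousLinearMap.le_of_opNorm_le _ h2.le _).trans ?_
  gcongr
  refine (ContinuousLinearMap.le_of_opNorm_le _ h3.le _).trans ?_
  gcongr
  exact ContinuousLinearMap.le_of_opNorm_le _ h1.le w

theorem exists_norm_cov_le {s : ∀ x, V x}
    (hs : ContMDiff I (I.prod 𝓘(ℝ, F)) ∞ (fun x => (⟨x, s x⟩ : TotalSpace F V)))
    (hsupp : HasCompactSupport fun x => ‖s x‖) :
    ∃ C ≥ 0, ∀ x, ∀ w : TangentSpace I x, ‖cov s x w‖ ≤ C * ‖w‖ := by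
  obtain ⟨C, hC⟩ := IsCompact.exists_uniform_bound hsupp.isCompact
    (P := fun x C => ∀ w : TangentSpace I x, ‖cov s x w‖ ≤ C * ‖w‖)
    (fun x C D hCD h1 w => (h1 w).trans (by gcongr)) fun x _ => eventually_norm_cov_le cov hs x
  refine ⟨max C 0, le_max_right _ _, fun x w => ?_⟩
  by_cases hx : x ∈ tsupport fun x => ‖s x‖
  · exact (hC x hx w).trans (by gcongr; exact le_max_left _ _)
  · have h0 : ∀ᶠ y in 𝓝 x, s y = 0 := by
      filter_upwards [notMem_tsupport_iff_eventuallyEq.1 hx] with y hy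
      exact norm_eq_zero.1 hy
    have h1 : cov s x = 0 :=
      (cov.isCovariantDerivativeOnUniv.congr_of_eventuallyEq (hs.mdifferentiable (by simp) x)
        (mdifferentiableAt_zeroSection ..) Filter.univ_mem h0).trans
          cov.isCovariantDerivativeOnUniv.zero
    rw [h1]
    simp only [zero_apply, norm_zero]
    positivity

theorem baseLength_proj_le_totalLength (hcov : cov.IsMetricCompatible)
    (hξ : IsACOn (I.prod 𝓘(ℝ, F)) ξ 0 1) :
    baseLength I (fun t => (ξ t).proj) ≤ totalLength cov ξ := by
  refine le_trans ?_ (pathDist_le_totalLength cov hcov hξ)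
  have h : baseLength I (fun t => (ξ t).proj) =
      (baseLength I (fun t => (ξ t).proj) ^ 2) ^ (1 / 2 : ℝ) := by
    rw [← ENNReal.rpow_natCast, ← ENNReal.rpow_mul]
    norm_num
  rw [pathDist]
  nth_rewrite 1 [h]
  exact ENNReal.rpow_le_rpow le_self_add (by norm_num)

/-- The distance of the total space controls the norm on each fiber. The two vectors are compared by
means of a compactly supported section through one of them. -/
theorem exists_enorm_sub_le_mul_totalDist (hcov : cov.IsMetricCompatible) (x : M) (e : V x) :
    ∃ C : ℝ, 0 < C ∧ ∀ e' : V x, ‖e' - e‖ₑ ≤ ENNReal.ofReal C * totalDist cov ⟨x, e⟩ ⟨x, e'⟩ := by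
  obtain ⟨s, hs, hsupp, hse⟩ := exists_smooth_section (I := I) (V := V) x
    (trivializationAt F V x ⟨x, e⟩).2
  have hsx : s x = e := by
    rw [hse.self_of_nhds]
    exact constSection_trivializationAt (e := ⟨x, e⟩) (FiberBundle.mem_baseSet_trivializationAt' x)
  obtain ⟨C, hC, hbd⟩ := exists_norm_cov_le cov hs hsupp
  refine ⟨1 + C, by positivity, fun e' => ?_⟩
  have hK0 : ENNReal.ofReal (1 + C) ≠ 0 := by simpa using by positivity
  rw [mul_comm, ← ENNReal.div_le_iff hK0 ENNReal.ofReal_ne_top]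
  refine le_iInf fun ξ => le_iInf fun hξ => le_iInf fun h0 => le_iInf fun h1 => ?_
  rw [ENNReal.div_le_iff hK0 ENNReal.ofReal_ne_top, mul_comm]
  have hsξ : IsACOn (I.prod 𝓘(ℝ, F)) (sectionCurve F (fun t => (ξ t).proj) fun t => s (ξ t).proj)
      0 1 := hξ.proj.comp fun t _ => (hs.of_le (by simp)).contMDiffAt
  have h2 := (enorm_le_add_lintegral_covAlong cov hcov zero_le_one
    (isACOn_sub (η := fun t => (ξ t).2) zero_le_one hξ hsξ)).1
  have h3 : ‖(ξ 0).2 - s (ξ 0).proj‖ₑ = 0 := by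
    rw [h0, hsx, sub_self, enorm_zero]
  have h4 : ‖(ξ 1).2 - s (ξ 1).proj‖ₑ = ‖e' - e‖ₑ := by
    rw [h1, hsx]
  simp only [sectionCurve] at h2
  rw [h3, h4, zero_add] at h2
  refine h2.trans ?_
  rw [totalLength_eq cov hξ, ← lintegral_const_mul' _ _ ENNReal.ofReal_ne_top]
  refine setLIntegral_mono_ae' measurableSet_Icc ?_
  have hae := hξ.ae_mdifferentiableAt
  have hae' := hsξ.ae_mdifferentiableAt
  rw [uIcc_of_le zero_le_one] at hae hae'
  filter_upwards [hae, hae'] with t h5 h6 ht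
  have h7 := (covAlong_sub cov (η := fun t => (ξ t).2) (h5 ht) (h6 ht)).2
  have h8 := covAlong_section cov hs (mdifferentiableAt_proj_curve (h5 ht))
  rw [h8] at h7
  rw [← ENNReal.ofReal_mul (by positivity)]
  have h9 : ‖(covAlong cov ξ t : V (ξ t).proj) -
      cov s (ξ t).proj (velocity I (fun t => (ξ t).proj) t)‖ ≤ (1 + C) *
        √(‖velocity I (fun t => (ξ t).proj) t‖ ^ 2 + ‖covAlong cov ξ t‖ ^ 2) := by
    refine (norm_sub_le _ _).trans ?_
    rw [add_mul, one_mul]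
    refine add_le_add (Real.le_sqrt_of_sq_le (le_add_of_nonneg_left (sq_nonneg _)))
      ((hbd _ _).trans ?_)
    gcongr
    exact Real.le_sqrt_of_sq_le (le_add_of_nonneg_right (sq_nonneg _))
  refine le_trans (le_of_eq ?_) (ENNReal.ofReal_le_ofReal h9)
  rw [ofReal_norm]
  exact congrArg enorm h7

theorem eq_of_totalDist_eq_zero (hcov : cov.IsMetricCompatible) {e e' : TotalSpace F V}
    (h : totalDist cov e e' = 0) : e = e' := by
  have h1 : e.proj = e'.proj := by
    refine eq_of_baseDist_eq_zero (I := I) (nonpos_iff_eq_zero.1 (le_trans ?_ h.le))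
    refine le_iInf fun ξ => le_iInf fun hξ => le_iInf fun h0 => le_iInf fun h1 => ?_
    exact (iInf₂_le_of_le (fun t => (ξ t).proj) hξ.proj (iInf₂_le
      (congrArg TotalSpace.proj h0) (congrArg TotalSpace.proj h1))).trans
      (baseLength_proj_le_totalLength cov hcov hξ)
  obtain ⟨x, e⟩ := e
  obtain ⟨x', e'⟩ := e'
  obtain rfl : x = x' := h1
  obtain ⟨C, -, hC⟩ := exists_enorm_sub_le_mul_totalDist cov hcov x e
  have h2 := hC e'
  rw [h, mul_zero, nonpos_iff_eq_zero, enorm_eq_zero, sub_eq_zero] at h2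
  rw [h2]

theorem totalDist_ne_top [ConnectedSpace M] (hcov : cov.IsMetricCompatible)
    (e e' : TotalSpace F V) : totalDist cov e e' ≠ ⊤ := by
  obtain ⟨x, e⟩ := e
  obtain ⟨x', e'⟩ := e'
  obtain ⟨σ, hσ, rfl, rfl⟩ := exists_isACOn (I := I) x x'
  refine ((totalDist_le_pathDist cov hcov hσ e e').trans_lt ?_).ne
  rw [pathDist_eq_ofReal cov hσ]
  exact ENNReal.ofReal_lt_top

/-- To bound a quantity by a multiple of the distance, it is enough to bound it by the same multiple
of the length of each curve. Infinite and vanishing factors are covered because the distance is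
finite and separates points. -/
theorem le_mul_totalDist [ConnectedSpace M] (hcov : cov.IsMetricCompatible) {e e' : TotalSpace F V}
    {X C : ℝ≥0∞} (hX : e = e' → X = 0)
    (h : ∀ ξ : ℝ → TotalSpace F V, IsACOn (I.prod 𝓘(ℝ, F)) ξ 0 1 → ξ 0 = e → ξ 1 = e' →
      X ≤ C * totalLength cov ξ) : X ≤ C * totalDist cov e e' := by
  by_cases hC : C = ⊤
  · by_cases hd : totalDist cov e e' = 0
    · rw [hX (eq_of_totalDist_eq_zero cov hcov hd)]
      exact zero_le
    · rw [hC, ENNReal.top_mul hd]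
      exact le_top
  by_cases hC0 : C = 0
  · have hlt := (totalDist_ne_top cov hcov e e').lt_top
    simp only [totalDist, iInf_lt_iff] at hlt
    obtain ⟨ξ, hξ, h0, h1, -⟩ := hlt
    have := h ξ hξ h0 h1
    rw [hC0, zero_mul] at this ⊢
    exact this
  rw [mul_comm, ← ENNReal.div_le_iff hC0 hC]
  refine le_iInf fun ξ => le_iInf fun hξ => le_iInf fun h0 => le_iInf fun h1 => ?_
  rw [ENNReal.div_le_iff hC0 hC, mul_comm]
  exact h ξ hξ h0 h1

variable {f : M → M} {Φ : ∀ m, V m →L[ℝ] V (f m)}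

theorem totalDist_totalMap_le [ConnectedSpace M] (hcov : cov.IsMetricCompatible)
    (hf : ContMDiff I I 1 f)
    (hΦ : ContMDiff (I.prod 𝓘(ℝ, F)) (I.prod 𝓘(ℝ, F)) 1 (totalMap F f Φ)) (e e' : TotalSpace F V) :
    totalDist cov (totalMap F f Φ e) (totalMap F f Φ e') ≤
      (max (lip I f) (fiberNorm (fun m => Φ m) e.proj)
        + (⨆ m, covDerivNorm cov f (fun m => Φ m) m) * ‖e'.2‖ₑ) * totalDist cov e e' := by
  refine le_mul_totalDist cov hcov (fun h => by rw [h, totalDist_self]) ?_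
  rintro ξ hξ rfl rfl
  have hσ := hξ.proj
  have hfσ : IsACOn I (fun t => f (ξ t).proj) 0 1 := hσ.comp fun t _ => hf.contMDiffAt
  calc totalDist cov (totalMap F f Φ (ξ 0)) (totalMap F f Φ (ξ 1))
      ≤ pathDist cov (fun t => f (ξ t).proj) (Φ (ξ 0).proj (ξ 0).2) (Φ (ξ 1).proj (ξ 1).2) :=
        totalDist_le_pathDist cov hcov hfσ _ _
    _ ≤ _ * pathDist cov (fun t => (ξ t).proj) (ξ 0).2 (ξ 1).2 :=
        pathDist_totalMap_le cov hcov hf hΦ hσ _ _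
    _ ≤ _ := by
        refine mul_le_mul' (add_le_add (max_le_max ?_ le_rfl) ?_)
          (pathDist_le_totalLength cov hcov hξ)
        · exact iSup₂_le fun t _ => fiberNorm_mfderiv_le_lip hf _
        · gcongr
          exact iSup₂_le fun t _ => le_iSup (fun m => covDerivNorm cov f (fun m => Φ m) m) _

end TotalDist

end BundleDistance

end

open BundleDistance in
theorem theorem5p30
    {E : Type*} [NormedAddCommGroup E] [NormedSpace ℝ E] [FiniteDimensional ℝ E]
    {H : Type*} [TopologicalSpace H] (I : ModelWithCorners ℝ E H) [I.Boundaryless]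
    {M : Type*} [TopologicalSpace M] [ChartedSpace H M] [IsManifold I ∞ M]
    [T2Space M] [ConnectedSpace M]
    [RiemannianBundle (fun x : M => TangentSpace I x)]
    [IsContMDiffRiemannianBundle I ∞ E (fun x : M => TangentSpace I x)] :
    (∀ (F : Type*) [NormedAddCommGroup F] [NormedSpace ℝ F] [FiniteDimensional ℝ F]
      (V : M → Type*) [TopologicalSpace (TotalSpace F V)]
      [∀ x, NormedAddCommGroup (V x)] [∀ x, InnerProductSpace ℝ (V x)]
      [FiberBundle F V] [VectorBundle ℝ F V] [ContMDiffVectorBundle ∞ F V I]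
      [IsContMDiffRiemannianBundle I ∞ F V]
      (cov : CovariantDerivative I F V) [cov.ContMDiffCovariantDerivative ∞],
      cov.IsMetricCompatible →
      ∀ (f : M → M) (Φ : ∀ m, V m →L[ℝ] V (f m)),
        ContMDiff I I ∞ f →
        ContMDiff (I.prod 𝓘(ℝ, F)) (I.prod 𝓘(ℝ, F)) ∞
          (fun e : TotalSpace F V => (⟨f e.proj, Φ e.proj e.2⟩ : TotalSpace F V)) →
        (∀ σ : ℝ → M, IsACOn I σ 0 1 → ∀ (e : V (σ 0)) (e' : V (σ 1)),
          totalDist cov ⟨f (σ 0), Φ (σ 0) e⟩ ⟨f (σ 1), Φ (σ 1) e'⟩ ≤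
            (max (supAlong (fiberNorm (V := fun x : M => TangentSpace I x)
                  (fun m => mfderiv I I f m)) σ)
                (fiberNorm (fun m => Φ m) (σ 0))
              + supAlong (covDerivNorm cov f (fun m => Φ m)) σ * ‖e'‖ₑ) * pathDist cov σ e e') ∧
        (∀ e e' : TotalSpace F V,
          totalDist cov ⟨f e.proj, Φ e.proj e.2⟩ ⟨f e'.proj, Φ e'.proj e'.2⟩ ≤
            (max (lip I f) (fiberNorm (fun m => Φ m) e.proj)
              + (⨆ m, covDerivNorm cov f (fun m => Φ m) m) * ‖e'.2‖ₑ) * totalDist cov e e')) ∧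
    (∀ (cov : CovariantDerivative I E (fun x : M => TangentSpace I x))
      [cov.ContMDiffCovariantDerivative ∞],
      cov.IsMetricCompatible → cov.torsion = 0 →
      ∀ f : M → M, ContMDiff I I 2 f →
        (∀ σ : ℝ → M, IsACOn I σ 0 1 → ∀ (v : TangentSpace I (σ 0)) (w : TangentSpace I (σ 1)),
          totalDist cov ⟨f (σ 0), mfderiv I I f (σ 0) v⟩ ⟨f (σ 1), mfderiv I I f (σ 1) w⟩ ≤
            (supAlong (fiberNorm (V := fun x : M => TangentSpace I x)
                (fun m => mfderiv I I f m)) σ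
              + supAlong (covDerivNorm cov f (fun m => mfderiv I I f m)) σ * ‖w‖ₑ)
              * pathDist cov σ v w) ∧
        (∀ v w : TangentBundle I M,
          totalDist cov ⟨f v.proj, mfderiv I I f v.proj v.2⟩
              ⟨f w.proj, mfderiv I I f w.proj w.2⟩ ≤
            (lip I f + (⨆ m, covDerivNorm cov f (fun m => mfderiv I I f m) m) * ‖w.2‖ₑ)
              * totalDist cov v w)) := by
  refine ⟨?_, ?_⟩
  · intro F _ _ _ V _ _ _ _ _ _ _ cov _ hcov f Φ hf hΦ
    have hf' : ContMDiff I I 1 f := hf.of_le (by simp)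
    have hΦ' : ContMDiff (I.prod 𝓘(ℝ, F)) (I.prod 𝓘(ℝ, F)) 1 (totalMap F f Φ) := hΦ.of_le (by simp)
    refine ⟨fun σ hσ e e' => ?_, fun e e' => totalDist_totalMap_le cov hcov hf' hΦ' e e'⟩
    exact (totalDist_le_pathDist cov hcov (σ := fun t => f (σ t))
      (hσ.comp fun t _ => hf'.contMDiffAt) _ _).trans
      (pathDist_totalMap_le cov hcov hf' hΦ' hσ e e')
  · intro cov _ hcov _ f hf
    have hf' : ContMDiff I I 1 f := hf.of_le (by norm_num)
    have hΦ : ContMDiff (I.prod 𝓘(ℝ, E)) (I.prod 𝓘(ℝ, E)) 1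
        (totalMap (V := fun x : M => TangentSpace I x) E f fun m => mfderiv I I f m) :=
      hf.contMDiff_tangentMap (by norm_num)
    -- The fiber metric instances of the tangent bundle have to be found before `cov` is supplied.
    have hA := totalDist_le_pathDist (I := I) (F := E) (V := fun x : M => TangentSpace I x)
    have hC := pathDist_totalMap_le (I := I) (F := E) (V := fun x : M => TangentSpace I x)
    have hD := totalDist_totalMap_le (I := I) (F := E) (V := fun x : M => TangentSpace I x)
    refine ⟨fun σ hσ v w => ?_, fun v w => ?_⟩
    · have h := hC cov hcov hf' hΦ hσ v w
      rw [max_eq_left (le_supAlong _ σ (left_mem_Icc.2 zero_le_one))] at h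
      exact (hA cov hcov (hσ.comp fun t _ => hf'.contMDiffAt) _ _).trans h
    · have h := hD cov hcov hf' hΦ v w
      rw [max_eq_left (fiberNorm_mfderiv_le_lip hf' v.proj)] at h
      exact h
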